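/- For $s\in\mathbb{R}$ let $H^s(\mathbb{R})$ be the Sobolev space of (complex-valued) tempered distributions $f$ on $\mathbb{R}$ with norm $\|f\|_{H^s}=\|(1+|\xi|^2)^{s/2}\hat f(\xi)\|_{L^2}$, where $\hat f(\xi)=\int e^{-2\pi i x\xi}f(x)\,dx$, and let $\mathcal{H}f=i(\operatorname{sgn}(\xi)\hat f)^{\vee}$ be the Hilbert transform. For $\beta>0$ and $\eta\ge 0$ consider $$u_t+uu_x+\beta\mathcal{H}u_{xx}+\eta(\mathcal{H}u_x-u_{xx})=0,\qquad u(0)=\phi, \tag{1}$$ which is the Chen–Lee equation for $\eta>0$ and the Benjamin–Ono equation for $\eta=0$. With $S_\eta(t)=e^{-t(\beta\mathcal{H}\partial_x^2+\eta(\mathcal{H}\partial_x-\partial_x^2))}$, $t\ge 0$, a mild solution of (1) on $[0,T]$ is a function $u\in C([0,T];H^s(\mathbb{R}))$ with $$u(t)=S_\eta(t)\phi-\int_0^t S_\eta(t-\tau)\,[u(\tau)u_x(\tau)]\,d\tau\qquad (0\le t\le T);$$ a strong solution is a function $u\in C([0,T];H^s(\mathbb{R}))\cap C^1([0,T];H^{s-2}(\mathbb{R}))$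 that satisfies (1) on $[0,T]$. **Theorem.** Let $s>3/2$ and $R\in\mathbb{R}$. There is a time $T>0$, depending only on $s$ and $R$, such that for every $\beta>0$ the following hold. (a) For every real-valued $\phi\in H^s(\mathbb{R})$ with $\|\phi\|_{H^s}\le R$ and every $\eta\in(0,1)$, the Chen–Lee equation has a unique mild solution $u^\eta\in C([0,T];H^s(\mathbb{R}))$ with $u^\eta(0)=\phi$; it is real-valued and is also a strong solution. (b) For every such $\phi$, the limit $u^0=\lim_{\eta\to0^+}u^\eta$ exists in $C([0,T];H^s(\mathbb{R}))\cap C^1([0,T];H^{s-2}(\mathbb{R}))$, that is, $u^\eta\to u^0$ in $C([0,T];H^s(\mathbb{R}))$ and $\partial_tu^\eta\to\partial_tu^0$ in $C([0,T];H^{s-2}(\mathbb{R}))$. The limit is real-valued and is the unique strong solution on $[0,T]$ of the Benjamin–Ono equation with $u^0(0)=\phi$. (c) The limit depends continuously on the data: the map $\phi\mapsto u^0$ is continuous from the set of real-valued $\phi\in H^s(\mathbb{R})$ with $\|\phi\|_{H^s}\le R$, with the $H^s$ norm, into $C([0,T];H^s(\mathbb{R}))\cap C^1([0,T];H^{s-2}(\mathbb{R}))$.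 -/

import Mathlib

open MeasureTheory Set Filter Topology FourierTransform TemperedDistribution
open scoped SchwartzMap LineDeriv ENNReal

noncomputable section

namespace ChenLee

/-- The complex Hilbert space `L²(ℝ)`. -/
abbrev L2 : Type := Lp ℂ 2 (volume : Measure ℝ)

/-! ### The Sobolev spaces `H^r(ℝ)` as normed spaces -/

/-- The subspace of tempered distributions of Sobolev order `r`. -/
def sobolevSubmodule (r : ℝ) : Submodule ℂ 𝓢'(ℝ, ℂ) where
  carrier := {f | MemSobolev r 2 f}
  add_mem' hf hg := MemSobolev.add hf hg
  zero_mem' := memSobolev_fun_zero ℝ ℂ r 2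
  smul_mem' c _ hf := MemSobolev.smul c hf

/-- The Sobolev space `H^r(ℝ)`, `r ∈ ℝ`. It is a type of its own, so that it carries the topology of
its norm and not that of the space of tempered distributions. -/
def Hs (r : ℝ) : Type := sobolevSubmodule r

namespace Hs

instance (r : ℝ) : AddCommGroup (Hs r) := inferInstanceAs (AddCommGroup (sobolevSubmodule r))

instance (r : ℝ) : Module ℂ (Hs r) := inferInstanceAs (Module ℂ (sobolevSubmodule r))

/-- The tempered distribution underlying an element of `H^r(ℝ)`. -/
def dist {r : ℝ} : Hs r →ₗ[ℂ] 𝓢'(ℝ, ℂ) := (sobolevSubmodule r).subtype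

theorem memSobolev {r : ℝ} (f : Hs r) : MemSobolev r 2 f.dist := f.2

/-- A tempered distribution of Sobolev order `r` as an element of `H^r(ℝ)`. -/
def mk {r : ℝ} (f : 𝓢'(ℝ, ℂ)) (hf : MemSobolev r 2 f) : Hs r := ⟨f, hf⟩

@[simp] theorem dist_mk {r : ℝ} (f : 𝓢'(ℝ, ℂ)) (hf : MemSobolev r 2 f) : (mk f hf).dist = f := rfl

@[ext] theorem ext {r : ℝ} {f g : Hs r} (h : f.dist = g.dist) : f = g := Subtype.ext h

end Hs

theorem toTemperedDistribution_injective :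
    Function.Injective (Lp.toTemperedDistributionCLM ℂ (volume : Measure ℝ) 2) :=
  LinearMap.ker_eq_bot.mp Lp.ker_toTemperedDistributionCLM_eq_bot

namespace Hs

/-- The `L²` function that represents the Bessel potential of order `r` of `f ∈ H^r(ℝ)`. -/
def rep {r : ℝ} (f : Hs r) : L2 := f.memSobolev.choose

theorem rep_spec {r : ℝ} (f : Hs r) : besselPotential ℝ ℂ r f.dist = (rep f : 𝓢'(ℝ, ℂ)) :=
  f.memSobolev.choose_spec

theorem rep_eq {r : ℝ} {f : Hs r} {g : L2} (h : besselPotential ℝ ℂ r f.dist = (g : 𝓢'(ℝ, ℂ))) :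
    rep f = g :=
  toTemperedDistribution_injective ((rep_spec f).symm.trans h)

/-- The linear isomorphism `H^r(ℝ) ≃ L²(ℝ)` given by the Bessel potential of order `r`. -/
def toL2 (r : ℝ) : Hs r ≃ₗ[ℂ] L2 where
  toFun f := rep f
  map_add' f g := rep_eq (by
    rw [map_add, map_add, rep_spec, rep_spec]
    exact (map_add (Lp.toTemperedDistributionCLM ℂ (volume : Measure ℝ) 2) _ _).symm)
  map_smul' c f := rep_eq (by
    rw [map_smul, map_smul, rep_spec]
    exact (map_smul (Lp.toTemperedDistributionCLM ℂ (volume : Measure ℝ) 2) _ _).symm)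
  invFun g := mk (besselPotential ℝ ℂ (-r) (g : 𝓢'(ℝ, ℂ)))
    (memSobolev_besselPotential_iff.mpr (by
      rw [neg_add_cancel, memSobolev_zero_iff]; exact ⟨g, rfl⟩))
  left_inv f := by
    apply Hs.ext
    rw [dist_mk, ← rep_spec]
    simp
  right_inv g := rep_eq (by simp)

theorem besselPotential_dist {r : ℝ} (f : Hs r) :
    besselPotential ℝ ℂ r f.dist = (toL2 r f : 𝓢'(ℝ, ℂ)) := rep_spec f

/-- The norm of `H^r(ℝ)`: `‖f‖ = ‖(1 + |ξ|²)^{r/2} 𝓕 f‖_{L²}`. -/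
instance (r : ℝ) : NormedAddCommGroup (Hs r) :=
  NormedAddCommGroup.induced (Hs r) L2 (toL2 r) (toL2 r).injective

instance (r : ℝ) : NormedSpace ℂ (Hs r) := NormedSpace.induced ℂ (Hs r) L2 (toL2 r)

/-- `toL2` as a linear isometry. -/
def toL2Isometry (r : ℝ) : Hs r ≃ₗᵢ[ℂ] L2 where
  toLinearEquiv := toL2 r
  norm_map' _ := rfl

instance (r : ℝ) : CompleteSpace (Hs r) :=
  (toL2Isometry r).toIsometryEquiv.completeSpace_iff.mpr inferInstance

/-- The inclusion `H^s(ℝ) ⊆ H^r(ℝ)` for `r ≤ s`. -/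
def incl {r s : ℝ} (h : r ≤ s) (f : Hs s) : Hs r := mk f.dist (f.memSobolev.mono h)

/-- The derivative `∂ₓ : H^r(ℝ) → H^{r-1}(ℝ)`, in the sense of distributions. -/
def deriv {r : ℝ} (f : Hs r) : Hs (r - 1) := mk (∂_{(1 : ℝ)} f.dist) f.memSobolev.lineDerivOp

/-- The Fourier multiplier operator `f ↦ 𝓕⁻¹ (m · 𝓕 f)` on `H^r(ℝ)` with an essentially bounded
symbol `m`. Here `𝓕 f (ξ) = ∫ exp (-2πi x ξ) f x dx`, so that `∂ₓ` corresponds to `2πiξ`. (It is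
used only for symbols in `L^∞`; for other `m` the operator is set to be zero.) -/
def multiplier (m : ℝ → ℂ) {r : ℝ} (f : Hs r) : Hs r := by
  classical
  exact if hm : MemLp m ∞ (volume : Measure ℝ) then
    (toL2 r).symm (𝓕⁻ ((hm.toLp m • 𝓕 (toL2 r f) : L2)))
  else 0

/-- The Hilbert transform `ℋ f = i (sgn(ξ) 𝓕 f)^∨`, i.e.
`ℋ f (x) = (1/π) p.v. ∫ f y / (y - x) dy`. -/
def hilbert {r : ℝ} (f : Hs r) : Hs r :=
  multiplier (fun ξ : ℝ => Complex.I * ((Real.sign ξ : ℝ) : ℂ)) f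

/-- The semigroup `S(t) = exp (-t (β ℋ∂ₓ² + η (ℋ∂ₓ - ∂ₓ²)))`, `t ≥ 0`, whose symbol is
`exp (i q(ω) t - p(ω) t)` with `q(ω) = β ω |ω|` and `p(ω) = η (ω² - |ω|)`, where `ω = 2πξ`. -/
def semigroup (β η t : ℝ) {r : ℝ} (f : Hs r) : Hs r :=
  multiplier (fun ξ : ℝ =>
    Complex.exp
      (Complex.I * ((β * (2 * Real.pi * ξ) * |2 * Real.pi * ξ| * t : ℝ) : ℂ)
        - ((η * ((2 * Real.pi * ξ) ^ 2 - |2 * Real.pi * ξ|) * t : ℝ) : ℂ))) f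

/-- `f` is real-valued: it takes real values on real-valued test functions. -/
def IsReal {r : ℝ} (f : Hs r) : Prop :=
  ∀ ψ : 𝓢(ℝ, ℂ), (∀ x, (ψ x).im = 0) → (f.dist ψ).im = 0

end Hs

/-- The pointwise product `f g ∈ L¹(ℝ)`, as a distribution, of two distributions `f`, `g` that are
given by `L²` functions. (It is used only for such distributions, and set to be zero for others.) -/
def mulDist (f g : 𝓢'(ℝ, ℂ)) : 𝓢'(ℝ, ℂ) := by
  classical
  exact if h : (∃ F : L2, f = (F : 𝓢'(ℝ, ℂ))) ∧ (∃ G : L2, g = (G : 𝓢'(ℝ, ℂ))) then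
    ((h.1.choose • h.2.choose : Lp ℂ 1 (volume : Measure ℝ)) : 𝓢'(ℝ, ℂ))
  else 0

/-! ### The equation `u_t + u u_x + β ℋ u_xx + η (ℋ u_x - u_xx) = 0`, `u(0) = φ`

For `η > 0` it is the Chen–Lee equation, for `η = 0` the Benjamin–Ono equation. -/

/-- `u ∈ C([0,T]; H^s)` solves the integral equation
`u(t) = S(t) φ - ∫₀ᵗ S(t - τ) [u(τ) u_x(τ)] dτ` for `t ∈ [0,T]`. The curve `N` is `u u_x`, and the
integral is a Bochner integral in `H^{s-1}`. -/
def IsMildSolution (β η : ℝ) {s T : ℝ} (hT : 0 < T) (φ : Hs s) (u : C(Icc (0 : ℝ) T, Hs s)) :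
    Prop :=
  ∃ N : C(Icc (0 : ℝ) T, Hs (s - 1)),
    (∀ t, (N t).dist = mulDist (u t).dist (u t).deriv.dist) ∧
    ∀ t : Icc (0 : ℝ) T,
      (u t).incl (sub_le_self s zero_le_one) =
        (φ.incl (sub_le_self s zero_le_one)).semigroup β η t
          - ∫ τ in (0 : ℝ)..t, (IccExtend hT.le N τ).semigroup β η (t - τ)

/-- `u ∈ C([0,T]; H^s) ∩ C¹([0,T]; H^{s-2})` with time derivative `u_t = u'` solves the differential
equation on `[0,T]`, and `u(0) = φ`. -/
def IsStrongSolution (β η : ℝ) {s T : ℝ} (hT : 0 < T) (φ : Hs s) (u : C(Icc (0 : ℝ) T, Hs s))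
    (u' : C(Icc (0 : ℝ) T, Hs (s - 2))) : Prop :=
  u ⟨0, left_mem_Icc.mpr hT.le⟩ = φ ∧
  ∀ t : Icc (0 : ℝ) T,
    HasDerivWithinAt (fun τ : ℝ => (IccExtend hT.le u τ).incl (sub_le_self s zero_le_two))
      (u' t) (Icc (0 : ℝ) T) t ∧
    (u' t).dist + mulDist (u t).dist (u t).deriv.dist
      + (β : ℂ) • (u t).deriv.deriv.hilbert.dist
      + (η : ℂ) • ((u t).deriv.hilbert.dist - (u t).deriv.deriv.dist) = 0

end ChenLee

end

/-!
All of the analysis takes place on the Fourier side. An element `u` of `H^s` is represented by its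
weighted Fourier transform `g = (1 + ξ²)^{s/2} û ∈ L²` (`wF`). In terms of `g` the inclusion
`H^s ⊆ H^{s-r}` is the multiplication operator `J r`, the linear part of the equation is the bounded
multiplication operator `linOp β η`, and the product `u v_x`, which maps `H^s × H^s` to `H^{s-1}`
because `s > 3/2`, is a bounded bilinear map `bil`. The equation becomes the evolution equation
`Evol` for curves in `L²`.

*A priori bounds.* The linear part has a symbol with real part at most `1/4` for `0 ≤ η ≤ 1` and
every `β` (`re_asym_le`): the dispersion is skew-symmetric and the dissipation can amplify only low
frequencies. In the pairing of `u u_x` with `u`, in a weighted `L²` norm, the integral is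
symmetrised (`re_triKer_le`), which for real-valued `u` puts a commutator in place of the unbounded
weight; the commutator is estimated pointwise (`IsTameWeight.kernel_bound`). This applies not only
to the weight of `H^s` but, with the same constant, to all the weights
`(1 + ξ²)^{s/2} min 1 ((1 + ξ²)^{1/2} / N)`, which measure the mass of `u` at frequencies above `N`
(`abs_inner_tail_bil_le`). So on a time interval that depends only on `s` and on a bound for the
data, the norm of a solution, and its norm at frequencies above `N`, are at most twice those of its
data, uniformly in `N`, `β` and `η ∈ [0, 1]`. The same holds for the equation truncated to the
frequencies `|ξ| ≤ n`, which is an ordinary differential equation and hence has solutions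
(`exists_galerkin`).

*Stability.* The `L²` distance of two solutions of two equations, with different data, `η` or
truncation, is estimated by Gronwall's inequality (`Evol.compare`). The low frequencies of the
difference of the solutions are therefore small in `H^s`, and its high frequencies are small by the
bound on the tails (`Sol.stable`). In this way the loss of derivatives in the difference of two
solutions, which usually calls for a regularisation of the data, does no harm. This one statement
gives the convergence of the Galerkin approximations to a solution (`exists_sol`), for every
`η ∈ [0, 1]`, the limit `η → 0⁺`, and the continuous dependence on the data (`Solves.stable`);
the time derivatives converge because they are continuous functions of `η` and the solution.
Uniqueness, among complex-valued solutions too, is the case of equal data in `Evol.compare`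
(`Evol.eq_of_herm`).

*Translation.* The Fourier transform of a product is a convolution (`hasHat_mulDist`), and
real-valuedness is the symmetry `g(-ξ) = conj g(ξ)` (`isReal_iff_herm`). Hence strong solutions are
the solutions of `Evol` (`isStrongSolution_iff`). The integral equation and the differential
equation are equivalent because on each band `|ξ| ≤ n` the linear part is bounded (`evol_iff_mild`),
which identifies the mild solutions with the solutions of `Evol` as well (`isMildSolution_iff`).
-/

noncomputable section

namespace ChenLee

/-! ### Weights on the Fourier side -/

/-- The weight `(1 + ξ²)^{r/2}`. -/
def wt (r ξ : ℝ) : ℝ := (1 + ξ ^ 2) ^ (r / 2)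

lemma wt_pos (r ξ : ℝ) : 0 < wt r ξ := Real.rpow_pos_of_pos (by positivity) _

lemma wt_nonneg (r ξ : ℝ) : 0 ≤ wt r ξ := (wt_pos r ξ).le

@[simp] lemma wt_zero (ξ : ℝ) : wt 0 ξ = 1 := by simp [wt]

lemma wt_add (a b ξ : ℝ) : wt (a + b) ξ = wt a ξ * wt b ξ := by
  rw [wt, wt, wt, ← Real.rpow_add (by positivity)]; congr 1; ring

lemma wt_neg_mul_self (r ξ : ℝ) : wt (-r) ξ * wt r ξ = 1 := by
  rw [← wt_add]; simp

lemma wt_neg (r ξ : ℝ) : wt (-r) ξ = (wt r ξ)⁻¹ :=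
  eq_inv_of_mul_eq_one_left (wt_neg_mul_self r ξ)

@[fun_prop] lemma continuous_wt (r : ℝ) : Continuous (wt r) := by
  refine Continuous.rpow_const (by fun_prop) fun ξ => Or.inl ?_
  positivity

@[fun_prop] lemma measurable_wt (r : ℝ) : Measurable (wt r) := (continuous_wt r).measurable

@[simp] lemma wt_even (r ξ : ℝ) : wt r (-ξ) = wt r ξ := by simp [wt]

lemma wt_mono_abs {r ξ η : ℝ} (hr : 0 ≤ r) (h : |ξ| ≤ |η|) : wt r ξ ≤ wt r η :=
  Real.rpow_le_rpow (by positivity) (by have := sq_le_sq.mpr h; linarith) (by positivity)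

lemma wt_le_wt {r r' : ℝ} (h : r ≤ r') (ξ : ℝ) : wt r ξ ≤ wt r' ξ :=
  Real.rpow_le_rpow_of_exponent_le (by nlinarith [sq_nonneg ξ]) (by linarith)

lemma wt_le_one {r : ℝ} (h : r ≤ 0) (ξ : ℝ) : wt r ξ ≤ 1 := by
  simpa using wt_le_wt h ξ

lemma one_le_wt {r : ℝ} (h : 0 ≤ r) (ξ : ℝ) : 1 ≤ wt r ξ := by
  simpa using wt_le_wt h ξ

lemma wt_two (ξ : ℝ) : wt 2 ξ = 1 + ξ ^ 2 := by simp [wt]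

lemma wt_one_sq (ξ : ℝ) : wt 1 ξ ^ 2 = 1 + ξ ^ 2 := by
  rw [← wt_two, show (2 : ℝ) = 1 + 1 by norm_num, wt_add, sq]

lemma abs_le_wt_one (ξ : ℝ) : |ξ| ≤ wt 1 ξ := by
  refine abs_le_of_sq_le_sq ?_ (wt_nonneg _ _)
  rw [wt_one_sq]; linarith

lemma wt_dilate {r l : ℝ} (hr : 0 ≤ r) (hl : 1 ≤ l) (ξ : ℝ) :
    wt r (l * ξ) ≤ l ^ r * wt r ξ := by
  have h1 : l ^ r = (l ^ 2) ^ (r / 2) := by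
    rw [← Real.rpow_natCast l 2, ← Real.rpow_mul (by linarith)]; congr 1; push_cast; ring
  rw [wt, wt, h1, ← Real.mul_rpow (by positivity) (by positivity)]
  refine Real.rpow_le_rpow (by positivity) ?_ (by positivity)
  nlinarith [sq_nonneg ξ, one_le_pow₀ hl (n := 2)]

lemma wt_triangle {r : ℝ} (hr : 0 ≤ r) (ξ η : ℝ) :
    wt r ξ ≤ 2 ^ r * (wt r (ξ - η) + wt r η) := by
  have key : ∀ x : ℝ, |ξ| ≤ 2 * |x| → wt r ξ ≤ 2 ^ r * wt r x := fun x hx =>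
    (wt_mono_abs hr (by rwa [abs_mul, abs_two])).trans (wt_dilate hr one_le_two x)
  have h0 : (0 : ℝ) ≤ 2 ^ r := by positivity
  have h1 : |ξ| ≤ |ξ - η| + |η| := by simpa using abs_add_le (ξ - η) η
  rcases le_total |ξ - η| |η| with h | h
  · refine (key η (by linarith)).trans ?_
    gcongr; linarith [wt_nonneg r (ξ - η)]
  · refine (key (ξ - η) (by linarith)).trans ?_
    gcongr; linarith [wt_nonneg r η]

/-- An even weight that grows with `|ξ|`, at most like `|ξ|^k` under dilations. -/
structure IsTameWeight (k : ℕ) (m : ℝ → ℝ) : Prop where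
  nonneg : ∀ ξ, 0 ≤ m ξ
  mono : ∀ ξ η, |ξ| ≤ |η| → m ξ ≤ m η
  dilate : ∀ l ξ, 1 ≤ l → m (l * ξ) ≤ l ^ k * m ξ

lemma pow_sub_one_le {l : ℝ} (k : ℕ) (h1 : 1 ≤ l) (h2 : l ≤ 2) :
    l ^ k - 1 ≤ (2 ^ k - 1) * (l - 1) := by
  induction k with
  | zero => simp
  | succ k ih =>
    have : (1 : ℝ) ≤ 2 ^ k := one_le_pow₀ (by norm_num)
    rw [pow_succ, pow_succ]
    nlinarith [mul_nonneg (sub_nonneg.mpr this) (sub_nonneg.mpr h1),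
      mul_nonneg (mul_nonneg (sub_nonneg.mpr this) (sub_nonneg.mpr h1)) (sub_nonneg.mpr h2)]

namespace IsTameWeight

variable {k : ℕ} {m : ℝ → ℝ}

lemma le_of_abs_le (hm : IsTameWeight k m) {l ξ η : ℝ} (hl : 1 ≤ l) (h : |ξ| ≤ l * |η|) :
    m ξ ≤ l ^ k * m η :=
  (hm.mono ξ (l * η) (by rwa [abs_mul, abs_of_nonneg (zero_le_one.trans hl)])).trans
    (hm.dilate l η hl)

/-- A tame weight varies slowly: its increments are those of a differentiable function with
`|m'(ξ)| ≲ m(ξ) / |ξ|`. -/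
lemma sub_mul_le (hm : IsTameWeight k m) {ξ η : ℝ} (h0 : 0 < |η|) (h1 : |η| ≤ |ξ|)
    (h2 : |ξ| ≤ 2 * |η|) : (m ξ - m η) * |η| ≤ 2 ^ k * (|ξ| - |η|) * m η := by
  have hl1 : 1 ≤ |ξ| / |η| := by rwa [le_div_iff₀ h0, one_mul]
  have hl2 : |ξ| / |η| ≤ 2 := by rwa [div_le_iff₀ h0]
  have h3 : m ξ ≤ (|ξ| / |η|) ^ k * m η :=
    hm.le_of_abs_le hl1 (by rw [div_mul_cancel₀ _ h0.ne'])
  have h4 := pow_sub_one_le k hl1 hl2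
  have h5 : (|ξ| / |η| - 1) * |η| = |ξ| - |η| := by field_simp
  have h6 : 0 ≤ |ξ| / |η| - 1 := by linarith
  have h7 := hm.nonneg η
  calc (m ξ - m η) * |η| ≤ (((|ξ| / |η|) ^ k - 1) * m η) * |η| := by gcongr; linarith
    _ ≤ ((2 ^ k * (|ξ| / |η| - 1)) * m η) * |η| := by
        gcongr; nlinarith
    _ = 2 ^ k * ((|ξ| / |η| - 1) * |η|) * m η := by ring
    _ = _ := by rw [h5]

/-- The pointwise form of the commutator estimate: after symmetrisation, the derivative in the
nonlinearity falls on a factor that does not carry the weight. -/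
lemma kernel_bound (hm : IsTameWeight k m) (ξ η : ℝ) :
    |m ξ ^ 2 * η - m η ^ 2 * ξ| ≤ 5 * 9 ^ k *
      (|ξ - η| * (m ξ * m η) + |η| * (m ξ * m (ξ - η)) + |ξ| * (m η * m (ξ - η))) := by
  have q1 : (1 : ℝ) ≤ 3 ^ k := one_le_pow₀ (by norm_num)
  have q2 : (2 : ℝ) ^ k ≤ 3 ^ k := pow_le_pow_left₀ (by norm_num) (by norm_num) k
  have q3 : (9 : ℝ) ^ k = 3 ^ k * 3 ^ k := by rw [← mul_pow]; norm_num
  set q : ℝ := 3 ^ k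
  have a0 := hm.nonneg ξ
  have b0 := hm.nonneg η
  have c0 := hm.nonneg (ξ - η)
  have tri1 : |ξ| ≤ |ξ - η| + |η| := by simpa using abs_add_le (ξ - η) η
  have tri2 : |η| ≤ |ξ - η| + |ξ| := by
    have := abs_add_le (η - ξ) ξ
    rwa [sub_add_cancel, abs_sub_comm] at this
  have ha := abs_nonneg ξ
  have hb := abs_nonneg η
  have hc := abs_nonneg (ξ - η)
  -- if `|ξ - η|` is small, then `ξ` and `η` are comparable and the increment of `m` is small;
  -- otherwise `m η` and `m ξ` are controlled by `m (ξ - η)`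
  rcases lt_or_ge (2 * |ξ - η|) |η| with h | h
  · have hb' : 0 < |η| := by linarith
    have ha' : 0 < |ξ| := by linarith
    have e1 : m η ≤ q * m ξ :=
      (hm.le_of_abs_le one_le_two (by linarith)).trans (mul_le_mul_of_nonneg_right q2 ‹_›)
    have e2 : m ξ ≤ q * m η :=
      (hm.le_of_abs_le one_le_two (by linarith)).trans (mul_le_mul_of_nonneg_right q2 ‹_›)
    have main : |m ξ - m η| * |η| * (m ξ + m η) ≤ 4 * q ^ 2 * (|ξ - η| * (m ξ * m η)) := by
      rcases le_total |η| |ξ| with hab | hab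
      · have h1 := hm.sub_mul_le hb' hab (by linarith)
        rw [abs_of_nonneg (sub_nonneg.mpr (hm.mono η ξ hab))]
        calc (m ξ - m η) * |η| * (m ξ + m η) ≤ (q * |ξ - η| * m η) * (m ξ + q * m ξ) := by
              refine mul_le_mul (h1.trans ?_) (by linarith) (by positivity) (by positivity)
              gcongr
              linarith
          _ = q * (1 + q) * (|ξ - η| * (m ξ * m η)) := by ring
          _ ≤ _ := mul_le_mul_of_nonneg_right (by nlinarith) (by positivity)
      · have h1 := hm.sub_mul_le ha' hab (by linarith)
        rw [abs_sub_comm, abs_of_nonneg (sub_nonneg.mpr (hm.mono ξ η hab))]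
        have h2 : (m η - m ξ) * |ξ| ≤ q * |ξ - η| * m ξ := by
          refine h1.trans ?_
          gcongr
          linarith
        have h3 : 0 ≤ m η - m ξ := sub_nonneg.mpr (hm.mono ξ η hab)
        calc (m η - m ξ) * |η| * (m ξ + m η) ≤ (m η - m ξ) * (2 * |ξ|) * (q * m η + m η) := by
              gcongr; linarith
          _ = 2 * ((m η - m ξ) * |ξ|) * (q * m η + m η) := by ring
          _ ≤ 2 * (q * |ξ - η| * m ξ) * (q * m η + m η) := by gcongr
          _ = 2 * q * (1 + q) * (|ξ - η| * (m ξ * m η)) := by ring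
          _ ≤ _ := mul_le_mul_of_nonneg_right (by nlinarith) (by positivity)
    calc |m ξ ^ 2 * η - m η ^ 2 * ξ|
        = |(m ξ - m η) * η * (m ξ + m η) + m η ^ 2 * (η - ξ)| := by congr 1; ring
      _ ≤ |(m ξ - m η) * η * (m ξ + m η)| + |m η ^ 2 * (η - ξ)| := abs_add_le _ _
      _ = |m ξ - m η| * |η| * (m ξ + m η) + m η * m η * |ξ - η| := by
          rw [abs_mul, abs_mul, abs_mul, abs_of_nonneg (add_nonneg a0 b0),
            abs_of_nonneg (sq_nonneg (m η)), abs_sub_comm η ξ, sq]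
      _ ≤ 4 * q ^ 2 * (|ξ - η| * (m ξ * m η)) + q * m ξ * m η * |ξ - η| := by gcongr
      _ = (4 * q ^ 2 + q) * (|ξ - η| * (m ξ * m η)) := by ring
      _ ≤ 5 * (q * q) * (|ξ - η| * (m ξ * m η)) := by gcongr; nlinarith
      _ ≤ _ := by
          rw [q3]; gcongr
          have := mul_nonneg hb (mul_nonneg a0 c0)
          have := mul_nonneg ha (mul_nonneg b0 c0)
          linarith
  · have e1 : m η ≤ q * m (ξ - η) := hm.le_of_abs_le (by norm_num) (by linarith)
    have e2 : m ξ ≤ q * m (ξ - η) := hm.le_of_abs_le (by norm_num) (by linarith)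
    calc |m ξ ^ 2 * η - m η ^ 2 * ξ| ≤ |m ξ ^ 2 * η| + |m η ^ 2 * ξ| := abs_sub _ _
      _ = m ξ * m ξ * |η| + m η * m η * |ξ| := by
          rw [abs_mul, abs_mul, abs_of_nonneg (sq_nonneg (m ξ)),
            abs_of_nonneg (sq_nonneg (m η)), sq, sq]
      _ ≤ m ξ * (q * m (ξ - η)) * |η| + m η * (q * m (ξ - η)) * |ξ| := by gcongr
      _ = q * (|η| * (m ξ * m (ξ - η)) + |ξ| * (m η * m (ξ - η))) := by ring
      _ ≤ _ := by
          rw [q3]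
          have := mul_nonneg hb (mul_nonneg a0 c0)
          have := mul_nonneg ha (mul_nonneg b0 c0)
          have := mul_nonneg hc (mul_nonneg a0 b0)
          gcongr
          · nlinarith
          · linarith

end IsTameWeight

/-- The weight `min 1 ((1 + ξ²)^{1/2} / N)`, which is small at frequencies below `N` and equal to
one above. -/
def tailWt (N ξ : ℝ) : ℝ := min 1 (wt 1 ξ / N)

lemma tailWt_nonneg {N : ℝ} (hN : 0 < N) (ξ : ℝ) : 0 ≤ tailWt N ξ :=
  le_min zero_le_one (div_nonneg (wt_nonneg _ _) hN.le)

lemma tailWt_le_one (N ξ : ℝ) : tailWt N ξ ≤ 1 := min_le_left _ _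

lemma tailWt_one (ξ : ℝ) : tailWt 1 ξ = 1 := by
  simp [tailWt, one_le_wt zero_le_one]

@[fun_prop] lemma measurable_tailWt (N : ℝ) : Measurable (tailWt N) := by
  unfold tailWt; fun_prop

/-- The constants of the weights `(1 + ξ²)^{s/2} min 1 ((1 + ξ²)^{1/2} / N)` do not depend
on `N`. -/
lemma isTameWeight_tail {s N : ℝ} (hs : 0 ≤ s) (hN : 0 < N) {k : ℕ} (hk : s + 1 ≤ k) :
    IsTameWeight k (fun ξ => wt s ξ * tailWt N ξ) where
  nonneg ξ := mul_nonneg (wt_nonneg _ _) (tailWt_nonneg hN ξ)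
  mono ξ η h := by
    refine mul_le_mul (wt_mono_abs hs h) ?_ (tailWt_nonneg hN ξ) (wt_nonneg _ _)
    exact min_le_min le_rfl (div_le_div_of_nonneg_right (wt_mono_abs zero_le_one h) hN.le)
  dilate l ξ hl := by
    have h1 := wt_dilate hs hl ξ
    have h2 : tailWt N (l * ξ) ≤ l * tailWt N ξ := by
      have := wt_dilate zero_le_one hl ξ
      rw [Real.rpow_one] at this
      rw [tailWt, tailWt, mul_min_of_nonneg _ _ (zero_le_one.trans hl), mul_one]
      refine min_le_min hl ?_
      rw [← mul_div_assoc]; gcongr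
    calc wt s (l * ξ) * tailWt N (l * ξ) ≤ (l ^ s * wt s ξ) * (l * tailWt N ξ) :=
          mul_le_mul h1 h2 (tailWt_nonneg hN _)
            (mul_nonneg (Real.rpow_nonneg (by linarith) _) (wt_nonneg _ _))
      _ = l ^ (s + 1) * (wt s ξ * tailWt N ξ) := by
          rw [Real.rpow_add (by linarith), Real.rpow_one]; ring
      _ ≤ l ^ k * (wt s ξ * tailWt N ξ) := by
          have := mul_nonneg (wt_nonneg s ξ) (tailWt_nonneg hN ξ)
          gcongr
          rw [← Real.rpow_natCast]
          exact Real.rpow_le_rpow_of_exponent_le hl hk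

lemma lintegral_wt_lt_top {σ : ℝ} (hσ : 1 / 2 < σ) :
    ∫⁻ ξ : ℝ, ENNReal.ofReal (wt (-σ) ξ) ^ (2 : ℝ) < ∞ := by
  have h := (integrable_rpow_neg_one_add_norm_sq (E := ℝ) (μ := volume) (r := 2 * σ)
    (by simp; linarith)).lintegral_lt_top
  refine lt_of_le_of_lt (lintegral_mono fun ξ => le_of_eq ?_) h
  rw [ENNReal.ofReal_rpow_of_pos (wt_pos _ _)]
  congr 1
  rw [wt, ← Real.rpow_mul (by positivity)]
  simp only [Real.norm_eq_abs, sq_abs]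
  congr 1; ring

/-! ### Convolution inequalities -/

/-- The `L²` norm of a nonnegative function, with values in `[0, ∞]`. -/
def n2 (P : ℝ → ℝ≥0∞) : ℝ≥0∞ := (∫⁻ ξ, P ξ ^ (2 : ℝ)) ^ (1 / 2 : ℝ)

lemma n2_mono {P Q : ℝ → ℝ≥0∞} (h : ∀ᵐ ξ, P ξ ≤ Q ξ) : n2 P ≤ n2 Q := by
  refine ENNReal.rpow_le_rpow (lintegral_mono_ae ?_) (by norm_num)
  filter_upwards [h] with ξ hξ using ENNReal.rpow_le_rpow hξ (by norm_num)

lemma n2_congr {P Q : ℝ → ℝ≥0∞} (h : ∀ᵐ ξ, P ξ = Q ξ) : n2 P = n2 Q :=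
  le_antisymm (n2_mono (h.mono fun _ => le_of_eq)) (n2_mono (h.mono fun _ h => h.ge))

lemma n2_sq (P : ℝ → ℝ≥0∞) : n2 P ^ (2 : ℝ) = ∫⁻ ξ, P ξ ^ (2 : ℝ) := by
  rw [n2, ← ENNReal.rpow_mul]; norm_num

lemma le_n2_of_sq_le {a : ℝ≥0∞} {P : ℝ → ℝ≥0∞} (h : ∫⁻ ξ, P ξ ^ (2 : ℝ) ≤ a ^ (2 : ℝ)) :
    n2 P ≤ a := by
  rw [← n2_sq] at h
  exact (ENNReal.rpow_le_rpow_iff (by norm_num)).mp h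

lemma n2_const_mul (c : ℝ≥0∞) {P : ℝ → ℝ≥0∞} (hP : Measurable P) :
    n2 (fun ξ => c * P ξ) = c * n2 P := by
  simp only [n2, ENNReal.mul_rpow_of_nonneg _ _ (zero_le_two (α := ℝ))]
  rw [lintegral_const_mul _ (hP.pow_const _), ENNReal.mul_rpow_of_nonneg _ _ (by norm_num),
    ← ENNReal.rpow_mul]
  norm_num

lemma n2_add {P Q : ℝ → ℝ≥0∞} (hP : Measurable P) (hQ : Measurable Q) :
    n2 (fun ξ => P ξ + Q ξ) ≤ n2 P + n2 Q :=
  ENNReal.lintegral_Lp_add_le hP.aemeasurable hQ.aemeasurable (by norm_num)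

lemma lintegral_mul_le_n2 {P Q : ℝ → ℝ≥0∞} (hP : Measurable P) (hQ : Measurable Q) :
    ∫⁻ ξ, P ξ * Q ξ ≤ n2 P * n2 Q :=
  ENNReal.lintegral_mul_le_Lp_mul_Lq _ Real.HolderConjugate.two_two hP.aemeasurable
    hQ.aemeasurable

/-- Young's inequality `‖P * Q‖₂ ≤ ‖P‖₁ ‖Q‖₂`. -/
lemma n2_conv_le {P Q : ℝ → ℝ≥0∞} (hP : Measurable P) (hQ : Measurable Q) :
    n2 (fun ξ => ∫⁻ η, P (ξ - η) * Q η) ≤ (∫⁻ ξ, P ξ) * n2 Q := by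
  refine le_n2_of_sq_le ?_
  have h1 : ∀ ξ, (∫⁻ η, P (ξ - η) * Q η) ^ (2 : ℝ)
      ≤ (∫⁻ ξ, P ξ) * ∫⁻ η, P (ξ - η) * Q η ^ (2 : ℝ) := by
    intro ξ
    have hm : Measurable fun η => P (ξ - η) := by fun_prop
    have h2 := lintegral_mul_le_n2 (P := fun η => P (ξ - η) ^ (1 / 2 : ℝ))
      (Q := fun η => P (ξ - η) ^ (1 / 2 : ℝ) * Q η) (by fun_prop) (by fun_prop)
    have h3 : ∀ x : ℝ≥0∞, (x ^ (1 / 2 : ℝ)) ^ (2 : ℝ) = x := fun x => by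
      rw [← ENNReal.rpow_mul]; norm_num
    have h4 : ∀ x : ℝ≥0∞, x ^ (1 / 2 : ℝ) * x ^ (1 / 2 : ℝ) = x := fun x => by
      rw [← ENNReal.rpow_add_of_nonneg _ _ (by norm_num) (by norm_num)]; norm_num
    simp only [← mul_assoc, h4] at h2
    refine (ENNReal.rpow_le_rpow h2 (zero_le_two (α := ℝ))).trans (le_of_eq ?_)
    rw [ENNReal.mul_rpow_of_nonneg _ _ zero_le_two, n2_sq, n2_sq]
    simp only [h3, ENNReal.mul_rpow_of_nonneg _ _ (zero_le_two (α := ℝ))]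
    rw [lintegral_sub_left_eq_self (fun x => P x) ξ]
  calc ∫⁻ ξ, (∫⁻ η, P (ξ - η) * Q η) ^ (2 : ℝ)
      ≤ ∫⁻ ξ, (∫⁻ ξ, P ξ) * ∫⁻ η, P (ξ - η) * Q η ^ (2 : ℝ) := lintegral_mono h1
    _ = (∫⁻ ξ, P ξ) * ∫⁻ ξ, ∫⁻ η, P (ξ - η) * Q η ^ (2 : ℝ) := by
        rw [lintegral_const_mul]
        exact Measurable.lintegral_prod_right (by fun_prop)
    _ = (∫⁻ ξ, P ξ) * ∫⁻ η, ∫⁻ ξ, P (ξ - η) * Q η ^ (2 : ℝ) := by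
        rw [lintegral_lintegral_swap]
        exact Measurable.aemeasurable (by fun_prop)
    _ = (∫⁻ ξ, P ξ) * ∫⁻ η, (∫⁻ ξ, P ξ) * Q η ^ (2 : ℝ) := by
        congr 2; ext η
        rw [lintegral_mul_const _ (by fun_prop), lintegral_sub_right_eq_self (fun x => P x) η]
    _ = ((∫⁻ ξ, P ξ) * n2 Q) ^ (2 : ℝ) := by
        rw [lintegral_const_mul _ (by fun_prop), ENNReal.mul_rpow_of_nonneg _ _ zero_le_two, n2_sq,
          ← mul_assoc]
        norm_num [sq]

lemma conv_comm (P Q : ℝ → ℝ≥0∞) (ξ : ℝ) :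
    ∫⁻ η, P (ξ - η) * Q η = ∫⁻ η, Q (ξ - η) * P η := by
  rw [← lintegral_sub_left_eq_self (fun η => P (ξ - η) * Q η) ξ]
  simp [mul_comm]

lemma n2_conv_le' {P Q : ℝ → ℝ≥0∞} (hP : Measurable P) (hQ : Measurable Q) :
    n2 (fun ξ => ∫⁻ η, P (ξ - η) * Q η) ≤ n2 P * ∫⁻ ξ, Q ξ := by
  simp only [conv_comm P Q]
  rw [mul_comm]
  exact n2_conv_le hQ hP

/-- Trilinear forms `∫∫ P(ξ-η) Q(η) R(ξ)` are bounded with any one factor in `L¹` and the others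
in `L²`; here the first one is in `L¹`. -/
lemma tri_le₁ {P Q R : ℝ → ℝ≥0∞} (hP : Measurable P) (hQ : Measurable Q) (hR : Measurable R) :
    ∫⁻ ξ, ∫⁻ η, P (ξ - η) * Q η * R ξ ≤ (∫⁻ ξ, P ξ) * n2 Q * n2 R := by
  have h1 : ∀ ξ, ∫⁻ η, P (ξ - η) * Q η * R ξ = (∫⁻ η, P (ξ - η) * Q η) * R ξ := fun ξ => by
    rw [lintegral_mul_const _ (by fun_prop)]
  simp only [h1]
  refine (lintegral_mul_le_n2 (Measurable.lintegral_prod_right (by fun_prop)) hR).trans ?_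
  gcongr
  exact n2_conv_le hP hQ

lemma tri_le₂ {P Q R : ℝ → ℝ≥0∞} (hP : Measurable P) (hQ : Measurable Q) (hR : Measurable R) :
    ∫⁻ ξ, ∫⁻ η, P (ξ - η) * Q η * R ξ ≤ n2 P * (∫⁻ ξ, Q ξ) * n2 R := by
  have h1 : ∀ ξ, ∫⁻ η, P (ξ - η) * Q η * R ξ = (∫⁻ η, P (ξ - η) * Q η) * R ξ := fun ξ => by
    rw [lintegral_mul_const _ (by fun_prop)]
  simp only [h1]
  refine (lintegral_mul_le_n2 (Measurable.lintegral_prod_right (by fun_prop)) hR).trans ?_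
  gcongr
  exact n2_conv_le' hP hQ

lemma tri_le₃ {P Q R : ℝ → ℝ≥0∞} (hP : Measurable P) (hQ : Measurable Q) (hR : Measurable R) :
    ∫⁻ ξ, ∫⁻ η, P (ξ - η) * Q η * R ξ ≤ n2 P * n2 Q * ∫⁻ ξ, R ξ := by
  have hn : n2 (fun x => P (-x)) = n2 P := by
    rw [n2, n2, lintegral_neg_eq_self (fun x => P x ^ (2 : ℝ))]
  have h := tri_le₂ (P := fun x => P (-x)) (hP.comp measurable_neg) hR hQ
  rw [lintegral_lintegral_swap (Measurable.aemeasurable (by fun_prop))]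
  rw [hn] at h
  calc _ = ∫⁻ ξ, ∫⁻ η, P (-(ξ - η)) * R η * Q ξ := by
        congr 1; ext ξ; congr 1; ext η; rw [neg_sub]; ring
    _ ≤ _ := h.trans (le_of_eq (by ring))

/-! ### Multiplication operators on `L²(ℝ)` -/

lemma L2_measurable (g : L2) : Measurable (g : ℝ → ℂ) := (Lp.stronglyMeasurable g).measurable

lemma enorm_eq_n2 (g : L2) : ‖g‖ₑ = n2 (fun ξ => ‖g ξ‖ₑ) := by
  rw [Lp.enorm_def, eLpNorm_eq_lintegral_rpow_enorm_toReal (by norm_num) (by norm_num)]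
  simp [n2]

lemma memLp_two_of_n2 {f : ℝ → ℂ} (hf : Measurable f) (h : n2 (fun ξ => ‖f ξ‖ₑ) < ∞) :
    MemLp f 2 volume := by
  refine ⟨hf.aestronglyMeasurable, ?_⟩
  rw [eLpNorm_eq_lintegral_rpow_enorm_toReal (by norm_num) (by norm_num)]
  simpa [n2] using h

/-- A bounded measurable function. -/
structure BddMeas (m : ℝ → ℂ) : Prop where
  meas : Measurable m
  bdd : ∃ C : ℝ, ∀ ξ, ‖m ξ‖ ≤ C

lemma BddMeas.memLp {m : ℝ → ℂ} (hm : BddMeas m) : MemLp m ∞ (volume : Measure ℝ) := by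
  obtain ⟨C, hC⟩ := hm.bdd
  exact memLp_top_of_bound hm.meas.aestronglyMeasurable C (ae_of_all _ hC)

/-- Multiplication by a bounded measurable function on `L²(ℝ)` (zero for other functions). -/
def mulOp (m : ℝ → ℂ) : L2 →L[ℂ] L2 := by
  classical
  exact if hm : BddMeas m then
    (ContinuousLinearMap.mul ℂ ℂ).holderL volume ∞ 2 2 (hm.memLp.toLp m) else 0

lemma mulOp_coe {m : ℝ → ℂ} (hm : BddMeas m) (g : L2) :
    mulOp m g =ᵐ[volume] fun ξ => m ξ * g ξ := by
  rw [mulOp, dif_pos hm]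
  have h1 := (ContinuousLinearMap.mul ℂ ℂ).coeFn_holder (r := 2) (hm.memLp.toLp m) g
  filter_upwards [h1, hm.memLp.coeFn_toLp] with ξ h1 h2
  rw [← h2]
  exact h1

lemma L2_norm_le_of_ae {f g : L2} {C : ℝ} (h : ∀ᵐ ξ, ‖f ξ‖ ≤ C * ‖g ξ‖) :
    ‖f‖ ≤ C * ‖g‖ := Lp.norm_le_mul_norm_of_ae_le_mul h

lemma norm_mulOp_le {m : ℝ → ℂ} (hm : BddMeas m) {C : ℝ} (h : ∀ ξ, ‖m ξ‖ ≤ C)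
    (g : L2) : ‖mulOp m g‖ ≤ C * ‖g‖ := by
  refine L2_norm_le_of_ae ?_
  filter_upwards [mulOp_coe hm g] with ξ hξ
  rw [hξ, norm_mul]
  gcongr
  exact h ξ

lemma BddMeas.mul {m m' : ℝ → ℂ} (hm : BddMeas m) (hm' : BddMeas m') :
    BddMeas (fun ξ => m ξ * m' ξ) := by
  obtain ⟨C, hC⟩ := hm.bdd
  obtain ⟨C', hC'⟩ := hm'.bdd
  refine ⟨hm.meas.mul hm'.meas, C * C', fun ξ => ?_⟩
  rw [norm_mul]
  exact mul_le_mul (hC ξ) (hC' ξ) (norm_nonneg _) ((norm_nonneg _).trans (hC ξ))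

lemma mulOp_mulOp {m m' : ℝ → ℂ} (hm : BddMeas m) (hm' : BddMeas m') (g : L2) :
    mulOp m (mulOp m' g) = mulOp (fun ξ => m ξ * m' ξ) g := by
  apply Lp.ext
  filter_upwards [mulOp_coe hm (mulOp m' g), mulOp_coe hm' g, mulOp_coe (hm.mul hm') g]
    with ξ h1 h2 h3
  rw [h1, h2, h3, mul_assoc]

lemma mulOp_comm {m m' : ℝ → ℂ} (hm : BddMeas m) (hm' : BddMeas m') (g : L2) :
    mulOp m (mulOp m' g) = mulOp m' (mulOp m g) := by
  rw [mulOp_mulOp hm hm', mulOp_mulOp hm' hm]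
  simp [mul_comm]

lemma real_inner_L2 (f g : L2) :
    inner ℝ f g = ∫ ξ, ((starRingEnd ℂ) (f ξ) * g ξ).re := by
  rw [L2.inner_def]
  simp only [Complex.inner, mul_comm]

/-! ### Convolutions and the nonlinearity -/

/-- The convolution `∫ f(ξ - η) h(η) dη`. -/
def cv (f h : ℝ → ℂ) (ξ : ℝ) : ℂ := ∫ η, f (ξ - η) * h η

/-- The function `wt (-s) * g`. For `g ∈ L²` these are the Fourier transforms of the elements of
`H^s`. -/
def fh (s : ℝ) (g : L2) (ξ : ℝ) : ℂ := (wt (-s) ξ : ℂ) * g ξ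

/-- The Fourier symbol of `∂ₓ` applied to a function on the Fourier side. -/
def dsym (f : ℝ → ℂ) (ξ : ℝ) : ℂ := 2 * Real.pi * Complex.I * ξ * f ξ

@[fun_prop] lemma measurable_fh (s : ℝ) (g : L2) : Measurable (fh s g) :=
  (Complex.measurable_ofReal.comp (measurable_wt _)).mul (L2_measurable g)

@[fun_prop] lemma measurable_dsym {f : ℝ → ℂ} (hf : Measurable f) : Measurable (dsym f) := by
  unfold dsym; fun_prop

lemma measurable_cv {f h : ℝ → ℂ} (hf : Measurable f) (hh : Measurable h) :
    Measurable (cv f h) := by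
  have : Measurable (Function.uncurry fun ξ η => f (ξ - η) * h η) := by
    unfold Function.uncurry; fun_prop
  exact (this.stronglyMeasurable.integral_prod_right).measurable

lemma enorm_cv_le (f h : ℝ → ℂ) (ξ : ℝ) : ‖cv f h ξ‖ₑ ≤ ∫⁻ η, ‖f (ξ - η)‖ₑ * ‖h η‖ₑ := by
  refine (enorm_integral_le_lintegral_enorm _).trans (le_of_eq ?_)
  simp

lemma enorm_coe_of_nonneg {x : ℝ} (hx : 0 ≤ x) : ‖(x : ℂ)‖ₑ = ENNReal.ofReal x := by
  rw [← ofReal_norm, Complex.norm_real, Real.norm_of_nonneg hx]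

lemma enorm_fh (s : ℝ) (g : L2) (ξ : ℝ) :
    ‖fh s g ξ‖ₑ = ENNReal.ofReal (wt (-s) ξ) * ‖g ξ‖ₑ := by
  rw [fh, enorm_mul, enorm_coe_of_nonneg (wt_nonneg _ _)]

lemma enorm_dsym (f : ℝ → ℂ) (ξ : ℝ) :
    ‖dsym f ξ‖ₑ = ENNReal.ofReal (2 * Real.pi) * (ENNReal.ofReal |ξ| * ‖f ξ‖ₑ) := by
  rw [dsym, enorm_mul, ← mul_assoc]
  congr 1
  rw [← ofReal_norm, ← ENNReal.ofReal_mul (by positivity)]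
  congr 1
  simp [abs_of_pos Real.pi_pos]

lemma abs_mul_wt_le (s ξ : ℝ) : |ξ| * wt (-s) ξ ≤ wt (-(s - 1)) ξ := by
  rw [show -(s - 1) = 1 + -s by ring, wt_add]
  exact mul_le_mul_of_nonneg_right (abs_le_wt_one ξ) (wt_nonneg _ _)

/-- The `L²` norm of `(1 + ξ²)^{-(s-1)/2}`, the constant of the embedding of `H^{s-1}` into the
functions with integrable Fourier transform. -/
def embK (s : ℝ) : ℝ≥0∞ := n2 (fun ξ => ENNReal.ofReal (wt (-(s - 1)) ξ))

lemma embK_lt_top {s : ℝ} (hs : 3 / 2 < s) : embK s < ∞ :=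
  ENNReal.rpow_lt_top_of_nonneg (by norm_num) (lintegral_wt_lt_top (by linarith)).ne

lemma lintegral_wt_mul_le (s : ℝ) (g : L2) :
    ∫⁻ ξ, ENNReal.ofReal (wt (-(s - 1)) ξ) * ‖g ξ‖ₑ ≤ embK s * ‖g‖ₑ := by
  rw [enorm_eq_n2, embK]
  exact lintegral_mul_le_n2 (by fun_prop) (L2_measurable g).enorm

lemma lintegral_fh_le (s : ℝ) (g : L2) : ∫⁻ ξ, ‖fh s g ξ‖ₑ ≤ embK s * ‖g‖ₑ := by
  refine le_trans (lintegral_mono fun ξ => ?_) (lintegral_wt_mul_le s g)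
  simp only [enorm_fh]
  gcongr
  exact wt_le_wt (by linarith) ξ

lemma lintegral_abs_fh_le (s : ℝ) (g : L2) :
    ∫⁻ ξ, ENNReal.ofReal |ξ| * ‖fh s g ξ‖ₑ ≤ embK s * ‖g‖ₑ := by
  refine le_trans (lintegral_mono fun ξ => ?_) (lintegral_wt_mul_le s g)
  simp only [enorm_fh]
  rw [← mul_assoc, ← ENNReal.ofReal_mul (abs_nonneg _)]
  gcongr
  exact abs_mul_wt_le s ξ

lemma lintegral_dsym_le (s : ℝ) (g : L2) :
    ∫⁻ ξ, ‖dsym (fh s g) ξ‖ₑ ≤ ENNReal.ofReal (2 * Real.pi) * (embK s * ‖g‖ₑ) := by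
  simp only [enorm_dsym]
  rw [lintegral_const_mul _ (by fun_prop)]
  gcongr
  exact lintegral_abs_fh_le s g

lemma n2_wt_fh_le {r s : ℝ} (h : r ≤ s) (g : L2) :
    n2 (fun ξ => ENNReal.ofReal (wt r ξ) * ‖fh s g ξ‖ₑ) ≤ ‖g‖ₑ := by
  rw [enorm_eq_n2]
  refine n2_mono (ae_of_all _ fun ξ => ?_)
  simp only [enorm_fh]
  rw [← mul_assoc, ← ENNReal.ofReal_mul (wt_nonneg _ _), ← wt_add]
  refine mul_le_of_le_one_left zero_le ?_
  rw [← ENNReal.ofReal_one]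
  exact ENNReal.ofReal_le_ofReal (wt_le_one (by linarith) ξ)

lemma n2_wt_dsym_le {r s : ℝ} (h : r + 1 ≤ s) (g : L2) :
    n2 (fun ξ => ENNReal.ofReal (wt r ξ) * ‖dsym (fh s g) ξ‖ₑ)
      ≤ ENNReal.ofReal (2 * Real.pi) * ‖g‖ₑ := by
  refine le_trans ?_ (mul_le_mul_right (n2_wt_fh_le h g) _)
  rw [← n2_const_mul _ (by fun_prop)]
  refine n2_mono (ae_of_all _ fun ξ => ?_)
  simp only [enorm_dsym, wt_add]
  rw [ENNReal.ofReal_mul (wt_nonneg _ _)]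
  calc _ = ENNReal.ofReal (2 * Real.pi) *
        (ENNReal.ofReal (wt r ξ) * ENNReal.ofReal |ξ| * ‖fh s g ξ‖ₑ) := by ring
    _ ≤ _ := by gcongr; exact abs_le_wt_one ξ

lemma memLp_fh {s : ℝ} (hs : 0 ≤ s) (g : L2) : MemLp (fh s g) 2 volume := by
  refine memLp_two_of_n2 (by fun_prop) ?_
  have := n2_wt_fh_le hs g
  simp only [wt_zero, ENNReal.ofReal_one, one_mul] at this
  exact this.trans_lt (by simp)

lemma memLp_dsym_fh {s : ℝ} (hs : 1 ≤ s) (g : L2) : MemLp (dsym (fh s g)) 2 volume := by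
  refine memLp_two_of_n2 (by fun_prop) ?_
  have := n2_wt_dsym_le (r := 0) (by linarith) g
  simp only [wt_zero, ENNReal.ofReal_one, one_mul] at this
  exact this.trans_lt (by simp [ENNReal.mul_lt_top])

lemma integrable_fh {s : ℝ} (hs : 3 / 2 < s) (g : L2) : Integrable (fh s g) :=
  ⟨(measurable_fh s g).aestronglyMeasurable, (lintegral_fh_le s g).trans_lt
    (ENNReal.mul_lt_top (embK_lt_top hs) (by simp))⟩

lemma integrable_dsym_fh {s : ℝ} (hs : 3 / 2 < s) (g : L2) : Integrable (dsym (fh s g)) :=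
  ⟨(measurable_dsym (measurable_fh s g)).aestronglyMeasurable, (lintegral_dsym_le s g).trans_lt
    (ENNReal.mul_lt_top ENNReal.ofReal_lt_top (ENNReal.mul_lt_top (embK_lt_top hs) (by simp)))⟩

lemma integrable_cv {f h : ℝ → ℂ} (hf : MemLp f 2 volume) (hh : MemLp h 2 volume) (ξ : ℝ) :
    Integrable (fun η => f (ξ - η) * h η) :=
  (hf.comp_measurePreserving (Measure.measurePreserving_sub_left volume ξ)).integrable_mul hh

lemma ae_sub_left {p : ℝ → Prop} (h : ∀ᵐ η, p η) (ξ : ℝ) : ∀ᵐ η, p (ξ - η) :=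
  (Measure.measurePreserving_sub_left volume ξ).quasiMeasurePreserving.ae h

lemma cv_congr {f f' h h' : ℝ → ℂ} (hf : f =ᵐ[volume] f') (hh : h =ᵐ[volume] h') (ξ : ℝ) :
    cv f h ξ = cv f' h' ξ := by
  refine integral_congr_ae ?_
  filter_upwards [ae_sub_left hf ξ, hh] with η h1 h2
  rw [h1, h2]

lemma cv_add_left {f f' h : ℝ → ℂ} (hf : MemLp f 2 volume) (hf' : MemLp f' 2 volume)
    (hh : MemLp h 2 volume) (ξ : ℝ) :
    cv (fun η => f η + f' η) h ξ = cv f h ξ + cv f' h ξ := by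
  simp only [cv, add_mul]
  exact integral_add (integrable_cv hf hh ξ) (integrable_cv hf' hh ξ)

lemma cv_add_right {f h h' : ℝ → ℂ} (hf : MemLp f 2 volume) (hh : MemLp h 2 volume)
    (hh' : MemLp h' 2 volume) (ξ : ℝ) :
    cv f (fun η => h η + h' η) ξ = cv f h ξ + cv f h' ξ := by
  simp only [cv, mul_add]
  exact integral_add (integrable_cv hf hh ξ) (integrable_cv hf hh' ξ)

lemma cv_smul_left (c : ℂ) (f h : ℝ → ℂ) (ξ : ℝ) :
    cv (fun η => c * f η) h ξ = c * cv f h ξ := by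
  simp only [cv, mul_assoc]
  exact integral_const_mul _ _

lemma cv_smul_right (c : ℂ) (f h : ℝ → ℂ) (ξ : ℝ) :
    cv f (fun η => c * h η) ξ = c * cv f h ξ := by
  simp only [cv, mul_left_comm _ c]
  exact integral_const_mul _ _

/-- The product `u v_x` on the Fourier side, with the weight of `H^{s-1}`, for `u`, `v` given by
their weighted Fourier transforms `g`, `h`. -/
def bilFun (s : ℝ) (g h : L2) (ξ : ℝ) : ℂ := (wt (s - 1) ξ : ℂ) * cv (fh s g) (dsym (fh s h)) ξ

lemma measurable_bilFun (s : ℝ) (g h : L2) : Measurable (bilFun s g h) :=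
  (Complex.measurable_ofReal.comp (measurable_wt _)).mul
    (measurable_cv (measurable_fh s g) (measurable_dsym (measurable_fh s h)))

/-- The constant of the product estimate `H^s × H^s → H^{s-1}`. -/
def bilK (s : ℝ) : ℝ≥0∞ :=
  ENNReal.ofReal (2 ^ (s - 1)) * (2 * (ENNReal.ofReal (2 * Real.pi) * embK s))

lemma bilK_lt_top {s : ℝ} (hs : 3 / 2 < s) : bilK s < ∞ :=
  ENNReal.mul_lt_top (by simp) (ENNReal.mul_lt_top (by simp)
    (ENNReal.mul_lt_top ENNReal.ofReal_lt_top (embK_lt_top hs)))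

/-- The weight of `H^{s-1}` at `ξ` is at most a multiple of the sum of its values at `ξ - η` and
`η`. The factor that carries it is estimated in `L²`, the other one in `L¹`, by Young's inequality. -/
lemma n2_bilFun_le {s : ℝ} (hs : 3 / 2 < s) (g h : L2) :
    n2 (fun ξ => ‖bilFun s g h ξ‖ₑ) ≤ bilK s * (‖g‖ₑ * ‖h‖ₑ) := by
  set W : ℝ → ℝ≥0∞ := fun ξ => ENNReal.ofReal (wt (s - 1) ξ)
  set P : ℝ → ℝ≥0∞ := fun ξ => ‖fh s g ξ‖ₑ
  set Q : ℝ → ℝ≥0∞ := fun ξ => ‖dsym (fh s h) ξ‖ₑ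
  have hW : Measurable W := by fun_prop
  have hP : Measurable P := by fun_prop
  have hQ : Measurable Q := by fun_prop
  have m1 : Measurable fun ξ => ∫⁻ η, (W (ξ - η) * P (ξ - η)) * Q η :=
    Measurable.lintegral_prod_right (by fun_prop)
  have m2 : Measurable fun ξ => ∫⁻ η, P (ξ - η) * (W η * Q η) :=
    Measurable.lintegral_prod_right (by fun_prop)
  have h1 : ∀ ξ, ‖bilFun s g h ξ‖ₑ ≤ ENNReal.ofReal (2 ^ (s - 1)) *
      ((∫⁻ η, (W (ξ - η) * P (ξ - η)) * Q η) + ∫⁻ η, P (ξ - η) * (W η * Q η)) := by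
    intro ξ
    rw [bilFun, enorm_mul, enorm_coe_of_nonneg (wt_nonneg _ _)]
    refine (mul_le_mul_right (enorm_cv_le _ _ ξ) _).trans ?_
    rw [← lintegral_const_mul _ (by fun_prop), ← lintegral_add_left (by fun_prop),
      ← lintegral_const_mul _ (by fun_prop)]
    refine lintegral_mono fun η => ?_
    have h2 : W ξ ≤ ENNReal.ofReal (2 ^ (s - 1)) * (W (ξ - η) + W η) := by
      rw [← ENNReal.ofReal_add (wt_nonneg _ _) (wt_nonneg _ _),
        ← ENNReal.ofReal_mul (by positivity)]
      exact ENNReal.ofReal_le_ofReal (wt_triangle (by linarith) ξ η)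
    refine (mul_le_mul_left h2 _).trans (le_of_eq ?_)
    simp only [P, Q]; ring
  calc n2 (fun ξ => ‖bilFun s g h ξ‖ₑ)
      ≤ n2 (fun ξ => ENNReal.ofReal (2 ^ (s - 1)) *
        ((∫⁻ η, (W (ξ - η) * P (ξ - η)) * Q η) + ∫⁻ η, P (ξ - η) * (W η * Q η))) :=
        n2_mono (ae_of_all _ h1)
    _ ≤ ENNReal.ofReal (2 ^ (s - 1)) * (n2 (fun ξ => W ξ * P ξ) * (∫⁻ ξ, Q ξ)
          + (∫⁻ ξ, P ξ) * n2 (fun ξ => W ξ * Q ξ)) := by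
        refine (n2_const_mul _ (m1.add m2)).le.trans ?_
        gcongr
        refine (n2_add m1 m2).trans ?_
        gcongr
        · exact n2_conv_le' (P := fun ξ => W ξ * P ξ) (by fun_prop) hQ
        · exact n2_conv_le (Q := fun ξ => W ξ * Q ξ) hP (by fun_prop)
    _ ≤ ENNReal.ofReal (2 ^ (s - 1)) * (‖g‖ₑ * (ENNReal.ofReal (2 * Real.pi) * (embK s * ‖h‖ₑ))
          + (embK s * ‖g‖ₑ) * (ENNReal.ofReal (2 * Real.pi) * ‖h‖ₑ)) := by
        gcongr
        · exact n2_wt_fh_le (by linarith) g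
        · exact lintegral_dsym_le s h
        · exact lintegral_fh_le s g
        · exact n2_wt_dsym_le (by linarith) h
    _ = _ := by rw [bilK]; ring

lemma memLp_bilFun {s : ℝ} (hs : 3 / 2 < s) (g h : L2) : MemLp (bilFun s g h) 2 volume :=
  memLp_two_of_n2 (measurable_bilFun s g h) ((n2_bilFun_le hs g h).trans_lt
    (ENNReal.mul_lt_top (bilK_lt_top hs) (by simp [ENNReal.mul_lt_top])))

lemma fh_add (s : ℝ) (g g' : L2) :
    fh s (g + g') =ᵐ[volume] fun ξ => fh s g ξ + fh s g' ξ := by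
  filter_upwards [Lp.coeFn_add g g'] with ξ h
  simp only [fh, h, Pi.add_apply, mul_add]

lemma fh_smul (s : ℝ) (c : ℂ) (g : L2) : fh s (c • g) =ᵐ[volume] fun ξ => c * fh s g ξ := by
  filter_upwards [Lp.coeFn_smul c g] with ξ h
  simp only [fh, h, Pi.smul_apply, smul_eq_mul]; ring

lemma dsym_congr {f f' : ℝ → ℂ} (h : f =ᵐ[volume] f') : dsym f =ᵐ[volume] dsym f' := by
  filter_upwards [h] with ξ h
  simp only [dsym, h]

/-- The product `(u, v) ↦ u v_x`, `H^s × H^s → H^{s-1}`, in terms of weighted Fourier transforms,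
as a bounded bilinear map. -/
def bil (s : ℝ) (hs : 3 / 2 < s) : L2 →L[ℂ] L2 →L[ℂ] L2 :=
  LinearMap.mkContinuous₂
    (LinearMap.mk₂ ℂ (fun g h => (memLp_bilFun hs g h).toLp _)
      (fun g g' h => by
        rw [← MemLp.toLp_add]
        refine MemLp.toLp_congr _ _ (ae_of_all _ fun ξ => ?_)
        simp only [bilFun, Pi.add_apply]
        rw [cv_congr (fh_add s g g') (ae_eq_refl _), cv_add_left (memLp_fh (by linarith) g)
          (memLp_fh (by linarith) g') (memLp_dsym_fh (by linarith) h), mul_add])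
      (fun c g h => by
        rw [← MemLp.toLp_const_smul]
        refine MemLp.toLp_congr _ _ (ae_of_all _ fun ξ => ?_)
        simp only [bilFun, Pi.smul_apply, smul_eq_mul]
        rw [cv_congr (fh_smul s c g) (ae_eq_refl _), cv_smul_left]; ring)
      (fun g h h' => by
        rw [← MemLp.toLp_add]
        refine MemLp.toLp_congr _ _ (ae_of_all _ fun ξ => ?_)
        simp only [bilFun, Pi.add_apply]
        have e : dsym (fun ξ => fh s h ξ + fh s h' ξ)
            = fun ξ => dsym (fh s h) ξ + dsym (fh s h') ξ := by
          ext ξ; simp only [dsym]; ring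
        rw [cv_congr (ae_eq_refl _) (dsym_congr (fh_add s h h')), e,
          cv_add_right (memLp_fh (by linarith) g) (memLp_dsym_fh (by linarith) h)
          (memLp_dsym_fh (by linarith) h'), mul_add])
      (fun c g h => by
        rw [← MemLp.toLp_const_smul]
        refine MemLp.toLp_congr _ _ (ae_of_all _ fun ξ => ?_)
        simp only [bilFun, Pi.smul_apply, smul_eq_mul]
        have e : dsym (fun ξ => c * fh s h ξ) = fun ξ => c * dsym (fh s h) ξ := by
          ext ξ; simp only [dsym]; ring
        rw [cv_congr (ae_eq_refl _) (dsym_congr (fh_smul s c h)), e, cv_smul_right]; ring))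
    (bilK s).toReal
    (fun g h => by
      have h1 := n2_bilFun_le hs g h
      have h2 : ‖(memLp_bilFun hs g h).toLp (bilFun s g h)‖ₑ
          = n2 (fun ξ => ‖bilFun s g h ξ‖ₑ) := by
        rw [enorm_eq_n2]
        refine n2_congr ?_
        filter_upwards [(memLp_bilFun hs g h).coeFn_toLp] with ξ hξ
        rw [hξ]
      rw [← h2] at h1
      have h3 := ENNReal.toReal_mono (ENNReal.mul_lt_top (bilK_lt_top hs)
        (by simp [ENNReal.mul_lt_top])).ne h1
      simpa [mul_assoc] using h3)

lemma bil_coe {s : ℝ} (hs : 3 / 2 < s) (g h : L2) : bil s hs g h =ᵐ[volume] bilFun s g h :=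
  (memLp_bilFun hs g h).coeFn_toLp

lemma norm_bil_le {s : ℝ} (hs : 3 / 2 < s) (g h : L2) :
    ‖bil s hs g h‖ ≤ (bilK s).toReal * ‖g‖ * ‖h‖ :=
  (ContinuousLinearMap.le_opNorm₂ _ g h).trans (by
    gcongr
    exact LinearMap.mkContinuous₂_norm_le _ ENNReal.toReal_nonneg _)

/-! ### Energy estimates for the nonlinearity -/

/-- The symmetry `f(-ξ) = conj (f ξ)` of the Fourier transform of a real-valued function. -/
def Herm (f : ℝ → ℂ) : Prop := ∀ᵐ ξ : ℝ, f (-ξ) = (starRingEnd ℂ) (f ξ)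

lemma Herm.fh {g : L2} (hg : Herm g) (s : ℝ) : Herm (fh s g) := by
  filter_upwards [hg] with ξ h
  simp [ChenLee.fh, h]

/-- The integrand of `∫ M(ξ) conj (g ξ) (f * dsym g)(ξ) dξ`. -/
def triKer (M : ℝ → ℝ) (f g : ℝ → ℂ) (z : ℝ × ℝ) : ℂ :=
  (M z.1 : ℂ) * (starRingEnd ℂ) (g z.1) * (f (z.1 - z.2) * dsym g z.2)

lemma measurable_triKer {M : ℝ → ℝ} {f g : ℝ → ℂ} (hM : Measurable M) (hf : Measurable f)
    (hg : Measurable g) : Measurable (triKer M f g) := by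
  have h1 : Measurable fun z : ℝ × ℝ => (starRingEnd ℂ) (g z.1) :=
    Complex.continuous_conj.measurable.comp (hg.comp measurable_fst)
  unfold triKer
  fun_prop

lemma enorm_conj (z : ℂ) : ‖(starRingEnd ℂ) z‖ₑ = ‖z‖ₑ := by
  rw [← ofReal_norm, ← ofReal_norm, RCLike.norm_conj]

lemma integral_triKer {M : ℝ → ℝ} {f g : ℝ → ℂ}
    (hK : Integrable (triKer M f g) (volume.prod volume)) :
    ∫ z, triKer M f g z ∂(volume.prod volume)
      = ∫ ξ, (M ξ : ℂ) * (starRingEnd ℂ) (g ξ) * cv f (dsym g) ξ := by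
  rw [integral_prod _ hK]
  simp only [triKer, cv, integral_const_mul]

/-- Symmetrising `∫∫ M(ξ) conj (g ξ) f(ξ - η) iη g(η)` under `ξ ↔ η` with `f` hermitian replaces
the kernel `M(ξ) η` by `(M(ξ) η - M(η) ξ) / 2`. This is integration by parts. -/
lemma re_triKer_le {M : ℝ → ℝ} {f g : ℝ → ℂ} (hM : Measurable M) (hf : Measurable f)
    (hg : Measurable g) (hherm : Herm f)
    (hK : Integrable (triKer M f g) (volume.prod volume)) :
    ENNReal.ofReal |(∫ z, triKer M f g z ∂(volume.prod volume)).re| ≤ ENNReal.ofReal Real.pi *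
      ∫⁻ ξ, ∫⁻ η, ENNReal.ofReal |M ξ * η - M η * ξ| * (‖f (ξ - η)‖ₑ * ‖g η‖ₑ * ‖g ξ‖ₑ) := by
  set I := ∫ z, triKer M f g z ∂(volume.prod volume)
  have hconj : ∫ z : ℝ × ℝ, (starRingEnd ℂ) (triKer M f g z.swap) ∂(volume.prod volume)
      = (starRingEnd ℂ) I := by
    rw [integral_conj, integral_prod_swap (triKer M f g)]
  have hint : Integrable (fun z : ℝ × ℝ => (starRingEnd ℂ) (triKer M f g z.swap))
      (volume.prod volume) :=
    (hK.swap).congr' (Complex.continuous_conj.comp_aestronglyMeasurable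
      hK.swap.aestronglyMeasurable) (ae_of_all _ fun z => by
        simp)
  have hsum : 2 * I.re = (∫ z : ℝ × ℝ, (triKer M f g z + (starRingEnd ℂ) (triKer M f g z.swap))
      ∂(volume.prod volume)).re := by
    rw [integral_add hK hint, hconj]
    simp [I, two_mul]
  have hae : ∀ᵐ z : ℝ × ℝ ∂(volume.prod volume), f (-(z.1 - z.2)) =
      (starRingEnd ℂ) (f (z.1 - z.2)) :=
    (quasiMeasurePreserving_sub (volume : Measure ℝ) volume).ae hherm
  have hbd : ENNReal.ofReal |2 * I.re| ≤ ∫⁻ z : ℝ × ℝ, ENNReal.ofReal (2 * Real.pi) *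
      (ENNReal.ofReal |M z.1 * z.2 - M z.2 * z.1| *
        (‖f (z.1 - z.2)‖ₑ * ‖g z.2‖ₑ * ‖g z.1‖ₑ)) ∂(volume.prod volume) := by
    rw [hsum]
    refine (ENNReal.ofReal_le_ofReal (Complex.abs_re_le_norm _)).trans ?_
    rw [ofReal_norm]
    refine (enorm_integral_le_lintegral_enorm _).trans (lintegral_mono_ae ?_)
    filter_upwards [hae] with z hz
    have e : triKer M f g z + (starRingEnd ℂ) (triKer M f g z.swap)
        = (2 * Real.pi * Complex.I) * ((M z.1 * z.2 - M z.2 * z.1 : ℝ) : ℂ)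
          * (f (z.1 - z.2) * g z.2 * (starRingEnd ℂ) (g z.1)) := by
      have hz' : (starRingEnd ℂ) (f (z.2 - z.1)) = f (z.1 - z.2) := by
        rw [show z.2 - z.1 = -(z.1 - z.2) by ring, hz, Complex.conj_conj]
      simp only [triKer, Prod.fst_swap, Prod.snd_swap, map_mul, dsym, Complex.conj_conj,
        Complex.conj_ofReal, Complex.conj_I, map_ofNat, hz']
      push_cast
      ring
    rw [e, enorm_mul (_ * _) (f (z.1 - z.2) * g z.2 * _), enorm_mul (2 * Real.pi * Complex.I : ℂ),
      enorm_mul (f (z.1 - z.2) * g z.2), enorm_mul (f (z.1 - z.2)), enorm_conj, mul_assoc]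
    gcongr
    · rw [← ofReal_norm]
      apply ENNReal.ofReal_le_ofReal
      simp [abs_of_pos Real.pi_pos]
    · rw [← ofReal_norm, Complex.norm_real, Real.norm_eq_abs]
  rw [lintegral_const_mul _ (by fun_prop), abs_mul, abs_two, ENNReal.ofReal_mul zero_le_two,
    ENNReal.ofReal_mul zero_le_two, mul_assoc,
    ENNReal.mul_le_mul_iff_right (by simp) (by simp)] at hbd
  rwa [lintegral_prod _ (Measurable.aemeasurable (by fun_prop))] at hbd

/-- A bound without symmetrisation, which ensures the convergence of the integral. For the energy
weights `M` it is finite only if `g` is truncated or more regular. -/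
lemma lintegral_triKer_le {M : ℝ → ℝ} {f g : ℝ → ℂ} (hM : Measurable M) (hf : Measurable f)
    (hg : Measurable g) :
    ∫⁻ z, ‖triKer M f g z‖ₑ ∂(volume.prod volume) ≤
      (∫⁻ ξ, ‖f ξ‖ₑ) * n2 (fun η => ‖dsym g η‖ₑ) * n2 (fun ξ => ‖(M ξ : ℂ)‖ₑ * ‖g ξ‖ₑ) := by
  rw [lintegral_prod _ (measurable_triKer hM hf hg).enorm.aemeasurable]
  refine le_trans (le_of_eq ?_) (tri_le₁ (P := fun ξ => ‖f ξ‖ₑ) (Q := fun η => ‖dsym g η‖ₑ)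
    (R := fun ξ => ‖(M ξ : ℂ)‖ₑ * ‖g ξ‖ₑ) (by fun_prop) (by fun_prop) (by fun_prop))
  congr 1; ext ξ; congr 1; ext η
  simp only [triKer, enorm_mul, enorm_conj]
  ring

lemma n2_lt_top_of_memLp {f : ℝ → ℂ} (hf : MemLp f 2 volume) : n2 (fun ξ => ‖f ξ‖ₑ) < ∞ := by
  have h := hf.2
  rw [eLpNorm_eq_lintegral_rpow_enorm_toReal (by norm_num) (by norm_num)] at h
  simpa [n2] using h

lemma enorm_mulOp {m : ℝ → ℂ} (hm : BddMeas m) (g : L2) :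
    ‖mulOp m g‖ₑ = n2 (fun ξ => ‖m ξ‖ₑ * ‖g ξ‖ₑ) := by
  rw [enorm_eq_n2]
  refine n2_congr ?_
  filter_upwards [mulOp_coe hm g] with ξ h
  rw [h, enorm_mul]

/-- The weights `(1 + ξ²)^{r/2}`, `r ≤ 0`, are bounded. -/
lemma bddMeas_wt {r : ℝ} (hr : r ≤ 0) : BddMeas (fun ξ => (wt r ξ : ℂ)) :=
  ⟨by fun_prop, 1, fun ξ => by
    rw [Complex.norm_real, Real.norm_of_nonneg (wt_nonneg _ _)]; exact wt_le_one hr ξ⟩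

lemma bddMeas_tailWt {N : ℝ} (hN : 0 < N) : BddMeas (fun ξ => (tailWt N ξ : ℂ)) :=
  ⟨by fun_prop, 1, fun ξ => by
    rw [Complex.norm_real, Real.norm_of_nonneg (tailWt_nonneg hN _)]; exact tailWt_le_one _ ξ⟩

/-- The embedding `H^{s} ⊆ H^{s-r}`, `r ≥ 0`, in terms of weighted Fourier transforms. -/
def J (r : ℝ) : L2 →L[ℂ] L2 := mulOp (fun ξ => (wt (-r) ξ : ℂ))

lemma J_coe {r : ℝ} (hr : 0 ≤ r) (g : L2) : J r g =ᵐ[volume] fh r g :=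
  mulOp_coe (bddMeas_wt (by linarith)) g

lemma enorm_J {r : ℝ} (hr : 0 ≤ r) (g : L2) : ‖J r g‖ₑ = n2 (fun ξ => ‖fh r g ξ‖ₑ) := by
  rw [enorm_eq_n2]
  refine n2_congr ?_
  filter_upwards [J_coe hr g] with ξ h
  rw [h]

lemma norm_J_le {r : ℝ} (hr : 0 ≤ r) (g : L2) : ‖J r g‖ ≤ ‖g‖ := by
  have := norm_mulOp_le (bddMeas_wt (r := -r) (by linarith)) (C := 1) (fun ξ => by
    rw [Complex.norm_real, Real.norm_of_nonneg (wt_nonneg _ _)]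
    exact wt_le_one (by linarith) ξ) g
  simpa [J] using this

/-- The truncation of the Fourier side to `|ξ| ≤ N`, with a weight `m`. -/
def lowSym (N : ℝ) (m : ℝ → ℂ) (ξ : ℝ) : ℂ := (Icc (-N) N).indicator m ξ

lemma lowSym_of_le {N ξ : ℝ} (h : |ξ| ≤ N) (m : ℝ → ℂ) : lowSym N m ξ = m ξ :=
  indicator_of_mem (by rwa [mem_Icc, ← abs_le]) m

lemma lowSym_of_lt {N ξ : ℝ} (h : N < |ξ|) (m : ℝ → ℂ) : lowSym N m ξ = 0 :=
  indicator_of_notMem (by rw [mem_Icc, ← abs_le]; exact not_le.mpr h) m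

lemma bddMeas_lowSym (N : ℝ) {m : ℝ → ℂ} (hm : Continuous m) : BddMeas (lowSym N m) := by
  refine ⟨hm.measurable.indicator measurableSet_Icc, ?_⟩
  obtain ⟨C, hC⟩ := (isCompact_Icc (a := -N) (b := N)).exists_bound_of_continuousOn hm.continuousOn
  refine ⟨max C 0, fun ξ => ?_⟩
  rcases le_or_gt |ξ| N with h | h
  · rw [lowSym_of_le h]
    exact (hC ξ (by rwa [mem_Icc, ← abs_le])).trans (le_max_left _ _)
  · rw [lowSym_of_lt h, norm_zero]; exact le_max_right _ _

/-- The constant of the energy estimates for the nonlinearity. -/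
def nlK (s : ℝ) : ℝ≥0∞ :=
  ENNReal.ofReal Real.pi * (ENNReal.ofReal (5 * 9 ^ ⌈s + 1⌉₊) * (3 * embK s))

lemma nlK_lt_top {s : ℝ} (hs : 3 / 2 < s) : nlK s < ∞ :=
  ENNReal.mul_lt_top ENNReal.ofReal_lt_top (ENNReal.mul_lt_top ENNReal.ofReal_lt_top
    (ENNReal.mul_lt_top (by simp) (embK_lt_top hs)))

/-- The energy estimate for `u u_x` with the weight `(1 + ξ²)^{s/2} tailWt N`, for `u` with
frequencies `|ξ| ≤ n`. The constant depends neither on `N` nor on `n`. -/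
lemma abs_inner_tail_bil_le {s : ℝ} (hs : 3 / 2 < s) {N n : ℝ} (hN : 0 < N) {g : L2}
    (hherm : Herm g) (hsupp : ∀ᵐ ξ, n < |ξ| → g ξ = 0) :
    |inner ℝ (mulOp (fun ξ => (tailWt N ξ : ℂ)) g) (mulOp (fun ξ => (tailWt N ξ : ℂ))
      (mulOp (lowSym n fun ξ => (wt 1 ξ : ℂ)) (bil s hs g g)))|
      ≤ (nlK s).toReal * ‖g‖ * ‖mulOp (fun ξ => (tailWt N ξ : ℂ)) g‖ ^ 2 := by
  have hτ := bddMeas_tailWt hN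
  set τ : ℝ → ℂ := fun ξ => (tailWt N ξ : ℂ) with hτdef
  set m : ℝ → ℝ := fun ξ => wt s ξ * tailWt N ξ with hmdef
  have hm : IsTameWeight ⌈s + 1⌉₊ m := isTameWeight_tail (by linarith) hN (Nat.le_ceil _)
  have hmm : Measurable m := by fun_prop
  set f := fh s g with hfdef
  have hf : Measurable f := measurable_fh s g
  -- the weight cancels in `m f = tailWt N * g`
  have hmf : ∀ ξ, ENNReal.ofReal (m ξ) * ‖f ξ‖ₑ = ‖τ ξ‖ₑ * ‖g ξ‖ₑ := fun ξ => by
    rw [hfdef, enorm_fh, ← mul_assoc, ← ENNReal.ofReal_mul (hm.nonneg ξ),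
      enorm_coe_of_nonneg (tailWt_nonneg hN ξ)]
    congr 2
    have := wt_neg_mul_self s ξ
    calc _ = (wt (-s) ξ * wt s ξ) * tailWt N ξ := by simp only [hmdef]; ring
      _ = _ := by rw [this, one_mul]
  have hK : Integrable (triKer (fun ξ => m ξ ^ 2) f f) (volume.prod volume) := by
    refine ⟨(measurable_triKer (by fun_prop) hf hf).aestronglyMeasurable, ?_⟩
    refine (lintegral_triKer_le (by fun_prop) hf hf).trans_lt ?_
    refine ENNReal.mul_lt_top (ENNReal.mul_lt_top (integrable_fh hs g).2
      (n2_lt_top_of_memLp (memLp_dsym_fh (by linarith) g))) ?_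
    refine lt_of_le_of_lt (n2_mono (Q := fun ξ => ENNReal.ofReal (wt s n) * ‖g ξ‖ₑ) ?_) ?_
    · filter_upwards [hsupp] with ξ hξ
      rcases le_or_gt |ξ| n with h | h
      · have e1 : ‖((m ξ ^ 2 : ℝ) : ℂ)‖ₑ * ‖f ξ‖ₑ
            = ENNReal.ofReal (m ξ) * (ENNReal.ofReal (m ξ) * ‖f ξ‖ₑ) := by
          rw [enorm_coe_of_nonneg (sq_nonneg _), sq, ENNReal.ofReal_mul (hm.nonneg ξ), mul_assoc]
        rw [e1, hmf, ← mul_assoc]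
        gcongr
        rw [enorm_coe_of_nonneg (tailWt_nonneg hN ξ), ← ENNReal.ofReal_mul (hm.nonneg ξ)]
        apply ENNReal.ofReal_le_ofReal
        have h1 : wt s ξ ≤ wt s n :=
          wt_mono_abs (by linarith) (h.trans (le_abs_self n))
        have h2 := tailWt_le_one N ξ
        have h3 := tailWt_nonneg hN ξ
        have h4 := wt_nonneg s ξ
        calc wt s ξ * tailWt N ξ * tailWt N ξ ≤ wt s ξ * 1 * 1 := by gcongr
          _ ≤ _ := by simpa using h1
      · have : f ξ = 0 := by simp [hfdef, fh, hξ h]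
        simp [this]
    · rw [n2_const_mul _ (L2_measurable g).enorm, ← enorm_eq_n2]
      exact ENNReal.mul_lt_top ENNReal.ofReal_lt_top (by simp)
  have hinner : inner ℝ (mulOp τ g) (mulOp τ (mulOp (lowSym n fun ξ => (wt 1 ξ : ℂ))
      (bil s hs g g))) = (∫ z, triKer (fun ξ => m ξ ^ 2) f f z ∂(volume.prod volume)).re := by
    have hi : Integrable
        (fun ξ => ((m ξ ^ 2 : ℝ) : ℂ) * (starRingEnd ℂ) (f ξ) * cv f (dsym f) ξ) := by
      have := hK.integral_prod_left
      simpa only [triKer, cv, integral_const_mul] using this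
    rw [integral_triKer hK, real_inner_L2, ← RCLike.re_to_complex, ← integral_re hi]
    have hlow := bddMeas_lowSym n (m := fun ξ => (wt 1 ξ : ℂ))
      (Complex.continuous_ofReal.comp (continuous_wt 1))
    refine integral_congr_ae ?_
    filter_upwards [mulOp_coe hτ g, mulOp_coe hτ (mulOp (lowSym n fun ξ => (wt 1 ξ : ℂ))
      (bil s hs g g)), mulOp_coe hlow (bil s hs g g), bil_coe hs g g, hsupp]
      with ξ h1 h2 h3 h4 h5
    rw [h1, h2, h3, h4, RCLike.re_to_complex]
    congr 1
    rcases le_or_gt |ξ| n with h | h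
    · rw [lowSym_of_le h, bilFun, hfdef]
      have e1 : wt 1 ξ * wt (s - 1) ξ = wt s ξ := by rw [← wt_add]; congr 1; ring
      have e2 : g ξ = (wt s ξ : ℂ) * fh s g ξ := by
        rw [fh, ← mul_assoc, ← Complex.ofReal_mul, mul_comm (wt s ξ), wt_neg_mul_self]; simp
      rw [e2]
      simp only [hτdef, hmdef, map_mul, Complex.conj_ofReal, ← e1]
      push_cast
      ring
    · simp [hfdef, fh, h5 h]
  rw [hinner]
  have hbound := re_triKer_le (M := fun ξ => m ξ ^ 2) (by fun_prop) hf hf (hherm.fh s) hK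
  have hR : n2 (fun ξ => ENNReal.ofReal (m ξ) * ‖f ξ‖ₑ) = ‖mulOp τ g‖ₑ := by
    rw [enorm_mulOp hτ]; simp only [hmf]
  have hA : ∫⁻ ξ, ENNReal.ofReal |ξ| * ‖f ξ‖ₑ ≤ embK s * ‖g‖ₑ := lintegral_abs_fh_le s g
  set A : ℝ → ℝ≥0∞ := fun ξ => ENNReal.ofReal |ξ| * ‖f ξ‖ₑ with hAdef
  set Q : ℝ → ℝ≥0∞ := fun ξ => ENNReal.ofReal (m ξ) * ‖f ξ‖ₑ with hQdef
  have hAm : Measurable A := by fun_prop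
  have hQm : Measurable Q := by fun_prop
  have hpt : ∀ ξ η, ENNReal.ofReal |m ξ ^ 2 * η - m η ^ 2 * ξ| *
      (‖f (ξ - η)‖ₑ * ‖f η‖ₑ * ‖f ξ‖ₑ) ≤ ENNReal.ofReal (5 * 9 ^ ⌈s + 1⌉₊) *
        (A (ξ - η) * Q η * Q ξ + Q (ξ - η) * A η * Q ξ + Q (ξ - η) * Q η * A ξ) := by
    intro ξ η
    have n0 := hm.nonneg
    refine (mul_le_mul_left (ENNReal.ofReal_le_ofReal (hm.kernel_bound ξ η)) _).trans (le_of_eq ?_)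
    rw [ENNReal.ofReal_mul (by positivity),
      ENNReal.ofReal_add (add_nonneg (mul_nonneg (abs_nonneg _) (mul_nonneg (n0 _) (n0 _)))
        (mul_nonneg (abs_nonneg _) (mul_nonneg (n0 _) (n0 _))))
        (mul_nonneg (abs_nonneg _) (mul_nonneg (n0 _) (n0 _))),
      ENNReal.ofReal_add (mul_nonneg (abs_nonneg _) (mul_nonneg (n0 _) (n0 _)))
        (mul_nonneg (abs_nonneg _) (mul_nonneg (n0 _) (n0 _)))]
    simp only [ENNReal.ofReal_mul (abs_nonneg _), ENNReal.ofReal_mul (n0 _), hAdef, hQdef]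
    ring
  have htri : ∫⁻ ξ, ∫⁻ η, ENNReal.ofReal |m ξ ^ 2 * η - m η ^ 2 * ξ| *
      (‖f (ξ - η)‖ₑ * ‖f η‖ₑ * ‖f ξ‖ₑ) ≤ ENNReal.ofReal (5 * 9 ^ ⌈s + 1⌉₊) *
        (3 * ((∫⁻ ξ, A ξ) * n2 Q * n2 Q)) := by
    refine (lintegral_mono fun ξ => lintegral_mono fun η => hpt ξ η).trans ?_
    have e1 : ∀ ξ, ∫⁻ η, ENNReal.ofReal (5 * 9 ^ ⌈s + 1⌉₊) * (A (ξ - η) * Q η * Q ξ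
        + Q (ξ - η) * A η * Q ξ + Q (ξ - η) * Q η * A ξ)
        = ENNReal.ofReal (5 * 9 ^ ⌈s + 1⌉₊) * ((∫⁻ η, A (ξ - η) * Q η * Q ξ)
          + (∫⁻ η, Q (ξ - η) * A η * Q ξ) + ∫⁻ η, Q (ξ - η) * Q η * A ξ) := fun ξ => by
      rw [lintegral_const_mul _ (by fun_prop), lintegral_add_left (by fun_prop),
        lintegral_add_left (by fun_prop)]
    simp only [e1]
    have m1 : Measurable fun ξ => ∫⁻ η, A (ξ - η) * Q η * Q ξ :=
      Measurable.lintegral_prod_right (by fun_prop)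
    have m2 : Measurable fun ξ => ∫⁻ η, Q (ξ - η) * A η * Q ξ :=
      Measurable.lintegral_prod_right (by fun_prop)
    have m3 : Measurable fun ξ => ∫⁻ η, Q (ξ - η) * Q η * A ξ :=
      Measurable.lintegral_prod_right (by fun_prop)
    refine (lintegral_const_mul _ ((m1.add m2).add m3)).le.trans ?_
    gcongr
    refine (lintegral_add_left (m1.add m2) _).le.trans ?_
    refine (add_le_add_left (lintegral_add_left m1 _).le _).trans ?_
    calc _ ≤ (∫⁻ ξ, A ξ) * n2 Q * n2 Q + n2 Q * (∫⁻ ξ, A ξ) * n2 Q + n2 Q * n2 Q * ∫⁻ ξ, A ξ :=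
          add_le_add (add_le_add (tri_le₁ hAm hQm hQm) (tri_le₂ hQm hAm hQm))
            (tri_le₃ hQm hQm hAm)
      _ = _ := by ring
  have hfin : ENNReal.ofReal |(∫ z, triKer (fun ξ => m ξ ^ 2) f f z ∂(volume.prod volume)).re|
      ≤ nlK s * ‖g‖ₑ * ‖mulOp τ g‖ₑ ^ 2 := by
    refine hbound.trans ?_
    calc _ ≤ ENNReal.ofReal Real.pi * (ENNReal.ofReal (5 * 9 ^ ⌈s + 1⌉₊) *
        (3 * ((embK s * ‖g‖ₑ) * n2 Q * n2 Q))) := by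
          gcongr
          refine htri.trans ?_
          gcongr
      _ = _ := by rw [hR, nlK]; ring
  have := ENNReal.toReal_mono (ENNReal.mul_lt_top (ENNReal.mul_lt_top (nlK_lt_top hs) (by simp))
    (by simp)).ne hfin
  simpa [ENNReal.toReal_ofReal (abs_nonneg _)] using this

/-- The term `w v_x`, where the derivative falls on the more regular factor, is bounded on `L²`. -/
lemma abs_inner_bil_right_le {s : ℝ} (hs : 3 / 2 < s) (D g : L2) :
    |inner ℝ (J s D) (J (s - 1) (bil s hs D g))|
      ≤ (nlK s).toReal * ‖g‖ * ‖J s D‖ ^ 2 := by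
  have h1 : ‖J (s - 1) (bil s hs D g)‖ₑ ≤ nlK s * ‖g‖ₑ * ‖J s D‖ₑ := by
    rw [enorm_J (by linarith), enorm_J (by linarith)]
    calc n2 (fun ξ => ‖fh (s - 1) (bil s hs D g) ξ‖ₑ)
        ≤ n2 (fun ξ => ∫⁻ η, ‖fh s D (ξ - η)‖ₑ * ‖dsym (fh s g) η‖ₑ) := by
          refine n2_mono ?_
          filter_upwards [bil_coe hs D g] with ξ h
          refine le_trans (le_of_eq ?_) (enorm_cv_le _ _ ξ)
          rw [fh, h, bilFun, ← mul_assoc, ← Complex.ofReal_mul, wt_neg_mul_self]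
          simp
      _ ≤ n2 (fun ξ => ‖fh s D ξ‖ₑ) * ∫⁻ ξ, ‖dsym (fh s g) ξ‖ₑ :=
          n2_conv_le' (measurable_fh s D).enorm (measurable_dsym (measurable_fh s g)).enorm
      _ ≤ n2 (fun ξ => ‖fh s D ξ‖ₑ) * (ENNReal.ofReal (2 * Real.pi) * (embK s * ‖g‖ₑ)) := by
          gcongr
          exact lintegral_dsym_le s g
      _ = (ENNReal.ofReal Real.pi * (2 * embK s)) * ‖g‖ₑ * n2 (fun ξ => ‖fh s D ξ‖ₑ) := by
          rw [ENNReal.ofReal_mul zero_le_two]; simp; ring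
      _ ≤ nlK s * ‖g‖ₑ * n2 (fun ξ => ‖fh s D ξ‖ₑ) := by
          rw [nlK]
          gcongr
          · rw [show (2 : ℝ≥0∞) = ENNReal.ofReal 2 by simp]
            apply ENNReal.ofReal_le_ofReal
            have : (1 : ℝ) ≤ 9 ^ ⌈s + 1⌉₊ := one_le_pow₀ (by norm_num)
            linarith
          · exact le_mul_of_one_le_left zero_le (by norm_num)
  have h2 := ENNReal.toReal_mono (ENNReal.mul_lt_top (ENNReal.mul_lt_top (nlK_lt_top hs) (by simp))
    (by simp)).ne h1
  have h3 : ‖J (s - 1) (bil s hs D g)‖ ≤ (nlK s).toReal * ‖g‖ * ‖J s D‖ := by simpa using h2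
  calc _ ≤ ‖J s D‖ * ‖J (s - 1) (bil s hs D g)‖ := abs_real_inner_le_norm _ _
    _ ≤ ‖J s D‖ * ((nlK s).toReal * ‖g‖ * ‖J s D‖) := by gcongr
    _ = _ := by ring

/-- The transport term `u w_x` is skew-symmetric up to a bounded operator on `L²`, for real `u`. -/
lemma abs_inner_bil_left_le {s : ℝ} (hs : 3 / 2 < s) {g : L2} (hherm : Herm g) (D : L2) :
    |inner ℝ (J s D) (J (s - 1) (bil s hs g D))|
      ≤ (nlK s).toReal * ‖g‖ * ‖J s D‖ ^ 2 := by
  set f := fh s g with hfdef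
  set w := fh s D with hwdef
  have hf : Measurable f := measurable_fh s g
  have hw : Measurable w := measurable_fh s D
  have hw2 : n2 (fun ξ => ‖w ξ‖ₑ) = ‖J s D‖ₑ := (enorm_J (by linarith) D).symm
  have hK : Integrable (triKer (fun _ => 1) f w) (volume.prod volume) := by
    refine ⟨(measurable_triKer (by fun_prop) hf hw).aestronglyMeasurable, ?_⟩
    refine (lintegral_triKer_le (by fun_prop) hf hw).trans_lt ?_
    refine ENNReal.mul_lt_top (ENNReal.mul_lt_top (integrable_fh hs g).2
      (n2_lt_top_of_memLp (memLp_dsym_fh (by linarith) D))) ?_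
    simp [hw2]
  have hinner : inner ℝ (J s D) (J (s - 1) (bil s hs g D))
      = (∫ z, triKer (fun _ => 1) f w z ∂(volume.prod volume)).re := by
    have hi : Integrable (fun ξ => (starRingEnd ℂ) (w ξ) * cv f (dsym w) ξ) := by
      have := hK.integral_prod_left
      simpa only [triKer, cv, integral_const_mul, Complex.ofReal_one, one_mul] using this
    rw [integral_triKer hK, real_inner_L2]
    simp only [Complex.ofReal_one, one_mul]
    rw [← RCLike.re_to_complex, ← integral_re hi]
    refine integral_congr_ae ?_
    filter_upwards [J_coe (r := s) (by linarith) D, J_coe (r := s - 1) (by linarith)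
      (bil s hs g D), bil_coe hs g D] with ξ h1 h2 h3
    rw [h1, h2, ← hwdef, fh, h3, bilFun, ← mul_assoc (wt (-(s - 1)) ξ : ℂ), ← Complex.ofReal_mul,
      wt_neg_mul_self]
    simp [hfdef, hwdef]
  rw [hinner]
  have hbound := re_triKer_le (M := fun _ => 1) (by fun_prop) hf hw (hherm.fh s) hK
  have htri : ∫⁻ ξ, ∫⁻ η, ENNReal.ofReal |1 * η - 1 * ξ| *
      (‖f (ξ - η)‖ₑ * ‖w η‖ₑ * ‖w ξ‖ₑ) ≤ (embK s * ‖g‖ₑ) * ‖J s D‖ₑ * ‖J s D‖ₑ := by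
    rw [← hw2]
    refine le_trans (le_of_eq ?_) ((tri_le₁ (P := fun ξ => ENNReal.ofReal |ξ| * ‖f ξ‖ₑ)
      (Q := fun ξ => ‖w ξ‖ₑ) (R := fun ξ => ‖w ξ‖ₑ) (by fun_prop) (by fun_prop)
      (by fun_prop)).trans ?_)
    · congr 1; ext ξ; congr 1; ext η
      rw [one_mul, one_mul, abs_sub_comm]; ring
    · gcongr
      exact lintegral_abs_fh_le s g
  have hfin : ENNReal.ofReal |(∫ z, triKer (fun _ => 1) f w z ∂(volume.prod volume)).re|
      ≤ nlK s * ‖g‖ₑ * ‖J s D‖ₑ ^ 2 := by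
    refine hbound.trans ?_
    calc _ ≤ ENNReal.ofReal Real.pi * ((embK s * ‖g‖ₑ) * ‖J s D‖ₑ * ‖J s D‖ₑ) := by gcongr
      _ = (ENNReal.ofReal Real.pi * (1 * (1 * embK s))) * ‖g‖ₑ * ‖J s D‖ₑ ^ 2 := by ring
      _ ≤ _ := by
        rw [nlK]
        gcongr
        · rw [← ENNReal.ofReal_one]
          apply ENNReal.ofReal_le_ofReal
          have : (1 : ℝ) ≤ 9 ^ ⌈s + 1⌉₊ := one_le_pow₀ (by norm_num)
          linarith
        · norm_num
  have := ENNReal.toReal_mono (ENNReal.mul_lt_top (ENNReal.mul_lt_top (nlK_lt_top hs) (by simp))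
    (by simp)).ne hfin
  simpa [ENNReal.toReal_ofReal (abs_nonneg _)] using this

/-! ### The linear part and comparison of solutions -/

/-- A linear differential inequality, in a form without exceptional values of the constants. -/
lemma gronwall_le {e e' : ℝ → ℝ} {T K ε : ℝ} (hK : 0 ≤ K) (hε : 0 ≤ ε)
    (hd : ∀ t ∈ Icc (0 : ℝ) T, HasDerivWithinAt e (e' t) (Icc 0 T) t)
    (hle : ∀ t ∈ Icc (0 : ℝ) T, e' t ≤ K * e t + ε) :
    ∀ t ∈ Icc (0 : ℝ) T, e t ≤ (e 0 + ε * T) * Real.exp (K * t) := by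
  intro t ht
  have hT : 0 ≤ T := ht.1.trans ht.2
  -- `(e t) exp (-K t) - ε t` does not increase
  have hd2 : ∀ τ ∈ Icc (0 : ℝ) T, HasDerivWithinAt
      (fun τ => e τ * Real.exp (-K * τ) - ε * τ)
      (e' τ * Real.exp (-K * τ) + e τ * (Real.exp (-K * τ) * (-K)) - ε) (Icc 0 T) τ := by
    intro τ hτ
    have h1 : HasDerivAt (fun τ : ℝ => Real.exp (-K * τ)) (Real.exp (-K * τ) * (-K)) τ := by
      simpa using ((hasDerivAt_id τ).const_mul (-K)).exp
    have h2 : HasDerivAt (fun τ : ℝ => ε * τ) ε τ := by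
      simpa using (hasDerivAt_id τ).const_mul ε
    exact ((hd τ hτ).mul h1.hasDerivWithinAt).sub h2.hasDerivWithinAt
  have hanti : AntitoneOn (fun τ => e τ * Real.exp (-K * τ) - ε * τ) (Icc 0 T) := by
    refine antitoneOn_of_hasDerivWithinAt_nonpos (convex_Icc 0 T)
      (fun τ hτ => (hd2 τ hτ).continuousWithinAt)
      (fun τ hτ => (hd2 τ (interior_subset hτ)).mono interior_subset) ?_
    intro τ hτ
    have h1 := hle τ (interior_subset hτ)
    have h2 : Real.exp (-K * τ) ≤ 1 :=
      Real.exp_le_one_iff.mpr (by nlinarith [(interior_subset hτ).1])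
    have h3 := Real.exp_pos (-K * τ)
    nlinarith [mul_le_mul_of_nonneg_right h1 h3.le, mul_le_mul_of_nonneg_left h2 hε]
  have h := hanti (left_mem_Icc.mpr hT) ht ht.1
  simp only [mul_zero, Real.exp_zero, mul_one, sub_zero] at h
  have h4 : e t * Real.exp (-K * t) ≤ e 0 + ε * T := by
    have := mul_le_mul_of_nonneg_left ht.2 hε
    linarith
  have h5 : Real.exp (-K * t) * Real.exp (K * t) = 1 := by rw [← Real.exp_add]; simp
  calc e t = e t * Real.exp (-K * t) * Real.exp (K * t) := by rw [mul_assoc, h5, mul_one]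
    _ ≤ _ := by gcongr

/-- The symbol `i q - p` of `-(β ℋ∂ₓ² + η (ℋ∂ₓ - ∂ₓ²))`, where `q = β ω |ω|` and
`p = η (ω² - |ω|)`, `ω = 2πξ`. -/
def asym (β η ξ : ℝ) : ℂ :=
  Complex.I * ((β * (2 * Real.pi * ξ) * |2 * Real.pi * ξ| : ℝ) : ℂ)
    - ((η * ((2 * Real.pi * ξ) ^ 2 - |2 * Real.pi * ξ|) : ℝ) : ℂ)

lemma continuous_asym (β η : ℝ) : Continuous (asym β η) := by unfold asym; fun_prop

/-- The dissipation may amplify low frequencies, but at a bounded rate. -/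
lemma re_asym_le {η : ℝ} (h0 : 0 ≤ η) (h1 : η ≤ 1) (β ξ : ℝ) : (asym β η ξ).re ≤ 1 / 4 := by
  have : (asym β η ξ).re = -(η * (|2 * Real.pi * ξ| ^ 2 - |2 * Real.pi * ξ|)) := by
    rw [sq_abs, asym, Complex.sub_re, Complex.ofReal_re, Complex.I_mul_re, Complex.ofReal_im]
    ring
  rw [this]
  nlinarith [sq_nonneg (|2 * Real.pi * ξ| - 1 / 2), mul_nonneg h0
    (sq_nonneg (|2 * Real.pi * ξ| - 1 / 2))]

lemma abs_om_sq_le (ξ : ℝ) : |(2 * Real.pi * ξ)| ^ 2 + |2 * Real.pi * ξ|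
    ≤ 8 * Real.pi ^ 2 * wt 2 ξ := by
  rw [wt_two, sq_abs]
  have hpi := Real.pi_gt_three
  have h1 : |2 * Real.pi * ξ| = 2 * Real.pi * |ξ| := by
    rw [abs_mul, abs_of_pos (by positivity)]
  have h2 : |ξ| ≤ 1 + ξ ^ 2 := by nlinarith [sq_nonneg (|ξ| - 1), sq_abs ξ]
  rw [h1]
  have h3 : 2 * Real.pi * |ξ| ≤ (2 * Real.pi) * (1 + ξ ^ 2) := by gcongr
  nlinarith [sq_nonneg ξ, mul_nonneg (sub_nonneg.mpr hpi.le) (sq_nonneg ξ), sq_nonneg (Real.pi * ξ)]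

lemma wt_mul_norm_asym_sub_le (β η η' ξ : ℝ) :
    ‖(wt (-2) ξ : ℂ) * asym β η ξ - (wt (-2) ξ : ℂ) * asym β η' ξ‖
      ≤ 8 * Real.pi ^ 2 * |η - η'| := by
  have e : (wt (-2) ξ : ℂ) * asym β η ξ - (wt (-2) ξ : ℂ) * asym β η' ξ
      = ((wt (-2) ξ * ((η' - η) * ((2 * Real.pi * ξ) ^ 2 - |2 * Real.pi * ξ|)) : ℝ) : ℂ) := by
    simp only [asym]; push_cast; ring
  rw [e, Complex.norm_real, Real.norm_eq_abs, abs_mul, abs_mul, abs_of_pos (wt_pos _ _),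
    abs_sub_comm η' η]
  have h1 : abs ((2 * Real.pi * ξ) ^ 2 - |2 * Real.pi * ξ|) ≤ 8 * Real.pi ^ 2 * wt 2 ξ := by
    refine le_trans ?_ (abs_om_sq_le ξ)
    rw [sq_abs]
    refine (abs_sub _ _).trans (le_of_eq ?_)
    rw [abs_of_nonneg (sq_nonneg (2 * Real.pi * ξ)), abs_abs]
  have h2 := wt_neg_mul_self 2 ξ
  calc wt (-2) ξ * (|η - η'| * abs ((2 * Real.pi * ξ) ^ 2 - |2 * Real.pi * ξ|))
      ≤ wt (-2) ξ * (|η - η'| * (8 * Real.pi ^ 2 * wt 2 ξ)) := by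
        have := wt_nonneg (-2) ξ
        gcongr
    _ = (wt (-2) ξ * wt 2 ξ) * (8 * Real.pi ^ 2 * |η - η'|) := by ring
    _ = _ := by rw [h2, one_mul]

lemma bddMeas_asym (β η : ℝ) : BddMeas (fun ξ => (wt (-2) ξ : ℂ) * asym β η ξ) := by
  have hm : Measurable (asym β η) := (continuous_asym β η).measurable
  refine ⟨by fun_prop, 8 * Real.pi ^ 2 * (|β| + |η|), fun ξ => ?_⟩
  have h1 : ‖asym β η ξ‖ ≤ (|β| + |η|) * (|2 * Real.pi * ξ| ^ 2 + |2 * Real.pi * ξ|) := by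
    rw [asym]
    refine (norm_sub_le _ _).trans ?_
    generalize 2 * Real.pi * ξ = w
    rw [norm_mul, Complex.norm_I, one_mul, Complex.norm_real, Complex.norm_real, Real.norm_eq_abs,
      Real.norm_eq_abs, mul_assoc, abs_mul, abs_mul, abs_mul, abs_abs]
    have hw : 0 ≤ |w| := abs_nonneg _
    have h2 : abs (w ^ 2 - |w|) ≤ |w| ^ 2 + |w| := by
      refine (abs_sub _ _).trans (le_of_eq ?_)
      rw [abs_of_nonneg (sq_nonneg w), abs_of_nonneg hw, sq_abs]
    have h3 : |β| * (|w| * |w|) ≤ |β| * (|w| ^ 2 + |w|) := by gcongr; nlinarith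
    have h4 : |η| * abs (w ^ 2 - |w|) ≤ |η| * (|w| ^ 2 + |w|) := by gcongr
    linarith
  rw [norm_mul, Complex.norm_real, Real.norm_of_nonneg (wt_nonneg _ _)]
  have h2 := wt_neg_mul_self 2 ξ
  calc wt (-2) ξ * ‖asym β η ξ‖ ≤ wt (-2) ξ * ((|β| + |η|) * (8 * Real.pi ^ 2 * wt 2 ξ)) := by
        have := wt_nonneg (-2) ξ
        gcongr
        exact h1.trans (by gcongr; exact abs_om_sq_le ξ)
    _ = (wt (-2) ξ * wt 2 ξ) * (8 * Real.pi ^ 2 * (|β| + |η|)) := by ring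
    _ = _ := by rw [h2, one_mul]

/-- The operator `-(β ℋ∂ₓ² + η (ℋ∂ₓ - ∂ₓ²))`, `H^s → H^{s-2}`, in terms of weighted Fourier
transforms. -/
def linOp (β η : ℝ) : L2 →L[ℂ] L2 := mulOp (fun ξ => (wt (-2) ξ : ℂ) * asym β η ξ)

lemma linOp_coe (β η : ℝ) (g : L2) :
    linOp β η g =ᵐ[volume] fun ξ => (wt (-2) ξ : ℂ) * asym β η ξ * g ξ :=
  mulOp_coe (bddMeas_asym β η) g

lemma norm_linOp_sub_le (β η η' : ℝ) (g : L2) :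
    ‖linOp β η g - linOp β η' g‖ ≤ 8 * Real.pi ^ 2 * |η - η'| * ‖g‖ := by
  refine L2_norm_le_of_ae ?_
  filter_upwards [linOp_coe β η g, linOp_coe β η' g, Lp.coeFn_sub (linOp β η g) (linOp β η' g)]
    with ξ h1 h2 h3
  rw [h3, Pi.sub_apply, h1, h2, ← sub_mul, norm_mul]
  gcongr
  exact wt_mul_norm_asym_sub_le β η η' ξ

/-- The duality pairings between Sobolev spaces depend only on the total order. -/
lemma inner_J_J {a b c d : ℝ} (ha : 0 ≤ a) (hb : 0 ≤ b) (hc : 0 ≤ c) (hd : 0 ≤ d)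
    (h : a + b = c + d) (f g : L2) : inner ℝ (J a f) (J b g) = inner ℝ (J c f) (J d g) := by
  rw [real_inner_L2, real_inner_L2]
  refine integral_congr_ae ?_
  filter_upwards [J_coe ha f, J_coe hb g, J_coe hc f, J_coe hd g] with ξ h1 h2 h3 h4
  rw [h1, h2, h3, h4]
  have e : (wt (-a) ξ : ℂ) * wt (-b) ξ = wt (-c) ξ * wt (-d) ξ := by
    rw [← Complex.ofReal_mul, ← Complex.ofReal_mul, ← wt_add, ← wt_add]
    congr 2; linarith
  simp only [fh, map_mul, Complex.conj_ofReal]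
  congr 1
  calc _ = ((wt (-a) ξ : ℂ) * wt (-b) ξ) * ((starRingEnd ℂ) (f ξ) * g ξ) := by ring
    _ = _ := by rw [e]; ring

/-- The linear part in the `L²` energy identity. The operator `J (2 * s - 2)` makes the pairing that
of `H^{s-2}` with `H^{2-s}`. -/
lemma inner_linOp_le {s : ℝ} (hs : 1 ≤ s) {η : ℝ} (h0 : 0 ≤ η) (h1 : η ≤ 1) (β : ℝ) (D : L2) :
    inner ℝ (linOp β η D) (J (2 * s - 2) D) ≤ 1 / 4 * ‖J s D‖ ^ 2 := by
  rw [← real_inner_self_eq_norm_sq, real_inner_L2, real_inner_L2, ← integral_const_mul]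
  have hi : ∀ f g : L2, Integrable (fun ξ => ((starRingEnd ℂ) (f ξ) * g ξ).re) := fun f g => by
    have := L2.integrable_inner (𝕜 := ℝ) f g
    simpa only [Complex.inner, mul_comm] using this
  refine integral_mono_ae (hi _ _) ((hi _ _).const_mul _) ?_
  filter_upwards [linOp_coe β η D, J_coe (r := 2 * s - 2) (by linarith) D,
    J_coe (r := s) (by linarith) D] with ξ e1 e2 e3
  rw [e1, e2, e3]
  have e4 : wt (-2) ξ * wt (-(2 * s - 2)) ξ = wt (-s) ξ * wt (-s) ξ := by
    rw [← wt_add, ← wt_add]; congr 1; ring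
  have h5 : ((starRingEnd ℂ) ((wt (-2) ξ : ℂ) * asym β η ξ * D ξ)
      * fh (2 * s - 2) D ξ).re = wt (-2) ξ * wt (-(2 * s - 2)) ξ *
        ((asym β η ξ).re * Complex.normSq (D ξ)) := by
    simp only [fh, map_mul, Complex.conj_ofReal, Complex.normSq_apply, Complex.mul_re,
      Complex.mul_im, Complex.ofReal_re, Complex.ofReal_im, Complex.conj_re, Complex.conj_im]
    ring
  have h6 : ((starRingEnd ℂ) (fh s D ξ) * fh s D ξ).re
      = wt (-s) ξ * wt (-s) ξ * Complex.normSq (D ξ) := by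
    simp only [fh, map_mul, Complex.conj_ofReal, Complex.normSq_apply, Complex.mul_re,
      Complex.mul_im, Complex.ofReal_re, Complex.ofReal_im, Complex.conj_re, Complex.conj_im]
    ring
  rw [h5, h6, e4]
  have h7 := re_asym_le h0 h1 β ξ
  have h8 := Complex.normSq_nonneg (D ξ)
  have h9 := mul_nonneg (wt_nonneg (-s) ξ) (wt_nonneg (-s) ξ)
  nlinarith [mul_le_mul_of_nonneg_left (mul_le_mul_of_nonneg_right h7 h8) h9]

/-- If a curve is continuous in `H^s` and differentiable in `H^{s-2}`, then its `L²` norm is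
differentiable, since `H^{s-2}` and `H^{2-s} ⊇ H^s` are dual to each other. -/
lemma hasDerivWithinAt_norm_J_sq {s : ℝ} (hs : 1 ≤ s) {D : ℝ → L2} {D' : L2} {S : Set ℝ} {t : ℝ}
    (hd : HasDerivWithinAt (fun τ => J 2 (D τ)) D' S t) (hc : ContinuousWithinAt D S t) :
    HasDerivWithinAt (fun τ => ‖J s (D τ)‖ ^ 2) (2 * inner ℝ D' (J (2 * s - 2) (D t))) S t := by
  rw [hasDerivWithinAt_iff_tendsto_slope] at hd ⊢
  have e : ∀ τ, slope (fun τ => ‖J s (D τ)‖ ^ 2) t τ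
      = inner ℝ (slope (fun τ => J 2 (D τ)) t τ) (J (2 * s - 2) (D τ + D t)) := by
    intro τ
    rw [slope_def_module, slope_def_module, real_inner_smul_left, ← map_sub,
      inner_J_J (c := s) (d := s) (by norm_num) (by linarith) (by linarith) (by linarith) (by ring),
      map_sub, map_add, smul_eq_mul, inner_add_right, inner_sub_left, inner_sub_left,
      real_inner_self_eq_norm_sq, real_inner_self_eq_norm_sq, real_inner_comm (J s (D t))]
    congr 1; ring
  have hlim : Tendsto (fun τ => J (2 * s - 2) (D τ + D t)) (𝓝[S \ {t}] t)
      (𝓝 (J (2 * s - 2) (D t + D t))) :=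
    ((J (2 * s - 2)).continuous.tendsto _).comp
      ((hc.mono sdiff_subset).tendsto.add tendsto_const_nhds)
  have := Filter.Tendsto.inner (𝕜 := ℝ) hd hlim
  refine (this.congr fun τ => (e τ).symm).trans (le_of_eq ?_)
  congr 1
  rw [map_add, inner_add_right]; ring

/-- A curve in `H^s`, given by its weighted Fourier transform, that solves
`u_t + χ(D) (u u_x) + β ℋ u_xx + η (ℋ u_x - u_xx) = 0` in `H^{s-2}` on `[0, T]`. -/
structure Evol (s : ℝ) (hs : 3 / 2 < s) (T β η : ℝ) (χ : ℝ → ℂ) (g : ℝ → L2) : Prop where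
  cont : ContinuousOn g (Icc 0 T)
  deriv : ∀ t ∈ Icc (0 : ℝ) T, HasDerivWithinAt (fun τ => J 2 (g τ))
    (linOp β η (g t) - J 1 (mulOp χ (bil s hs (g t) (g t)))) (Icc 0 T) t

/-- The error of a truncation `χ(D)` of the nonlinearity in the `L²` energy identity. -/
lemma abs_inner_cutoff_error_le {s : ℝ} (hs : 3 / 2 < s) {χ : ℝ → ℂ} (hχ : BddMeas χ) {δ : ℝ}
    (hδ : ∀ ξ, ‖χ ξ - 1‖ * wt (-(s - 1)) ξ ≤ δ) (B D : L2) :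
    |inner ℝ (J 1 (mulOp χ B - B)) (J (2 * s - 2) D)| ≤ δ * ‖B‖ * ‖D‖ := by
  rw [inner_J_J (c := s - 1) (d := s) (by norm_num) (by linarith) (by linarith) (by linarith)
    (by ring)]
  refine (abs_real_inner_le_norm _ _).trans ?_
  have h1 : ‖J (s - 1) (mulOp χ B - B)‖ ≤ δ * ‖B‖ := by
    refine L2_norm_le_of_ae ?_
    filter_upwards [J_coe (r := s - 1) (by linarith) (mulOp χ B - B), Lp.coeFn_sub (mulOp χ B) B,
      mulOp_coe hχ B] with ξ h1 h2 h3
    rw [h1, fh, h2, Pi.sub_apply, h3]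
    have e : (wt (-(s - 1)) ξ : ℂ) * (χ ξ * B ξ - B ξ)
        = (χ ξ - 1) * (wt (-(s - 1)) ξ : ℂ) * B ξ := by ring
    rw [e, norm_mul, norm_mul, Complex.norm_real, Real.norm_of_nonneg (wt_nonneg _ _)]
    gcongr
    exact hδ ξ
  exact mul_le_mul h1 (norm_J_le (by linarith) D) (norm_nonneg _) ((norm_nonneg _).trans h1)

/-- The `L²` distance of two solutions of perturbed equations. Only the first one has to be
real-valued. -/
lemma Evol.compare {s : ℝ} {hs : 3 / 2 < s} {T β η₁ η₂ M δ₁ δ₂ : ℝ} {χ₁ χ₂ : ℝ → ℂ}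
    {g₁ g₂ : ℝ → L2} (h₁ : Evol s hs T β η₁ χ₁ g₁) (h₂ : Evol s hs T β η₂ χ₂ g₂)
    (hη0 : 0 ≤ η₁) (hη1 : η₁ ≤ 1) (hherm : ∀ t ∈ Icc (0 : ℝ) T, Herm (g₁ t))
    (hM₁ : ∀ t ∈ Icc (0 : ℝ) T, ‖g₁ t‖ ≤ M) (hM₂ : ∀ t ∈ Icc (0 : ℝ) T, ‖g₂ t‖ ≤ M)
    (hχ₁ : BddMeas χ₁) (hχ₂ : BddMeas χ₂) (hδ₁ : ∀ ξ, ‖χ₁ ξ - 1‖ * wt (-(s - 1)) ξ ≤ δ₁)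
    (hδ₂ : ∀ ξ, ‖χ₂ ξ - 1‖ * wt (-(s - 1)) ξ ≤ δ₂) :
    ∀ t ∈ Icc (0 : ℝ) T, ‖J s (g₁ t - g₂ t)‖ ^ 2 ≤
      (‖J s (g₁ 0 - g₂ 0)‖ ^ 2 + (4 * M ^ 2 * (8 * Real.pi ^ 2 * |η₁ - η₂|
        + (bilK s).toReal * M * (δ₁ + δ₂))) * T)
        * Real.exp ((1 / 2 + 4 * (nlK s).toReal * M) * T) := by
  intro t ht
  have hT : 0 ≤ T := ht.1.trans ht.2
  have hM : 0 ≤ M := (norm_nonneg _).trans (hM₁ t ht)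
  have hδ₁0 : 0 ≤ δ₁ := (mul_nonneg (norm_nonneg _) (wt_nonneg _ _)).trans (hδ₁ 0)
  have hδ₂0 : 0 ≤ δ₂ := (mul_nonneg (norm_nonneg _) (wt_nonneg _ _)).trans (hδ₂ 0)
  have hn : 0 ≤ (nlK s).toReal := ENNReal.toReal_nonneg
  have hb : 0 ≤ (bilK s).toReal := ENNReal.toReal_nonneg
  set D : ℝ → L2 := fun τ => g₁ τ - g₂ τ with hD
  have hder : ∀ τ ∈ Icc (0 : ℝ) T, HasDerivWithinAt (fun τ => ‖J s (D τ)‖ ^ 2)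
      (2 * inner ℝ ((linOp β η₁ (g₁ τ) - J 1 (mulOp χ₁ (bil s hs (g₁ τ) (g₁ τ))))
        - (linOp β η₂ (g₂ τ) - J 1 (mulOp χ₂ (bil s hs (g₂ τ) (g₂ τ)))))
          (J (2 * s - 2) (D τ))) (Icc 0 T) τ := by
    intro τ hτ
    refine hasDerivWithinAt_norm_J_sq (by linarith) ?_ ((h₁.cont τ hτ).sub (h₂.cont τ hτ))
    exact ((h₁.deriv τ hτ).sub (h₂.deriv τ hτ)).congr (fun τ _ => map_sub _ _ _) (map_sub _ _ _)
  have hbound := gronwall_le (K := 1 / 2 + 4 * (nlK s).toReal * M)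
    (ε := 4 * M ^ 2 * (8 * Real.pi ^ 2 * |η₁ - η₂| + (bilK s).toReal * M * (δ₁ + δ₂)))
    (by positivity) (by positivity) hder ?_ t ht
  · refine hbound.trans ?_
    gcongr
    exact ht.2
  · intro τ hτ
    have b1 := hM₁ τ hτ
    have b2 := hM₂ τ hτ
    have bD : ‖D τ‖ ≤ 2 * M := (norm_sub_le _ _).trans (by linarith)
    set B₁ := bil s hs (g₁ τ) (g₁ τ)
    set B₂ := bil s hs (g₂ τ) (g₂ τ)
    have bB₁ : ‖B₁‖ ≤ (bilK s).toReal * M * M := (norm_bil_le hs _ _).trans (by gcongr)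
    have bB₂ : ‖B₂‖ ≤ (bilK s).toReal * M * M := (norm_bil_le hs _ _).trans (by gcongr)
    -- bilinearity is used so that the derivative of the difference `D` is multiplied by the
    -- real-valued solution `g₁`
    have hsplit : (linOp β η₁ (g₁ τ) - J 1 (mulOp χ₁ B₁)) - (linOp β η₂ (g₂ τ) - J 1 (mulOp χ₂ B₂))
        = linOp β η₁ (D τ) + (linOp β η₁ (g₂ τ) - linOp β η₂ (g₂ τ))
          - J 1 (bil s hs (g₁ τ) (D τ)) - J 1 (bil s hs (D τ) (g₂ τ))
          - J 1 (mulOp χ₁ B₁ - B₁) + J 1 (mulOp χ₂ B₂ - B₂) := by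
      simp only [hD, B₁, B₂, map_sub, sub_apply]
      abel
    have i1 := inner_linOp_le (s := s) (by linarith) hη0 hη1 β (D τ)
    have i2 : inner ℝ (linOp β η₁ (g₂ τ) - linOp β η₂ (g₂ τ)) (J (2 * s - 2) (D τ))
        ≤ 8 * Real.pi ^ 2 * |η₁ - η₂| * M * (2 * M) := by
      refine (real_inner_le_norm _ _).trans ?_
      refine mul_le_mul ((norm_linOp_sub_le β η₁ η₂ _).trans (by gcongr))
        ((norm_J_le (by linarith) _).trans bD) (norm_nonneg _) (by positivity)
    have i3 : |inner ℝ (J 1 (bil s hs (g₁ τ) (D τ))) (J (2 * s - 2) (D τ))|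
        ≤ (nlK s).toReal * M * ‖J s (D τ)‖ ^ 2 := by
      rw [inner_J_J (c := s - 1) (d := s) (by norm_num) (by linarith) (by linarith) (by linarith)
        (by ring), real_inner_comm]
      exact (abs_inner_bil_left_le hs (hherm τ hτ) (D τ)).trans (by gcongr)
    have i4 : |inner ℝ (J 1 (bil s hs (D τ) (g₂ τ))) (J (2 * s - 2) (D τ))|
        ≤ (nlK s).toReal * M * ‖J s (D τ)‖ ^ 2 := by
      rw [inner_J_J (c := s - 1) (d := s) (by norm_num) (by linarith) (by linarith) (by linarith)
        (by ring), real_inner_comm]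
      exact (abs_inner_bil_right_le hs (D τ) (g₂ τ)).trans (by gcongr)
    have i5 : |inner ℝ (J 1 (mulOp χ₁ B₁ - B₁)) (J (2 * s - 2) (D τ))|
        ≤ δ₁ * ((bilK s).toReal * M * M) * (2 * M) :=
      (abs_inner_cutoff_error_le hs hχ₁ hδ₁ B₁ (D τ)).trans (by gcongr)
    have i6 : |inner ℝ (J 1 (mulOp χ₂ B₂ - B₂)) (J (2 * s - 2) (D τ))|
        ≤ δ₂ * ((bilK s).toReal * M * M) * (2 * M) :=
      (abs_inner_cutoff_error_le hs hχ₂ hδ₂ B₂ (D τ)).trans (by gcongr)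
    rw [hsplit]
    simp only [inner_add_left, inner_sub_left]
    simp only [inner_sub_left] at i2
    have := (abs_le.mp i3).1
    have := (abs_le.mp i4).1
    have := (abs_le.mp i5).1
    have := (abs_le.mp i6).2
    linarith

/-! ### Ordinary differential equations with a truncated vector field -/

/-- The radial retraction onto the ball of radius `M`. -/
def retr {E : Type*} [NormedAddCommGroup E] [NormedSpace ℝ E] (M : ℝ) (x : E) : E :=
  (M / max M ‖x‖) • x

lemma retr_coef_nonneg {M : ℝ} (hM : 0 < M) (r : ℝ) : 0 ≤ M / max M r :=
  div_nonneg hM.le (hM.le.trans (le_max_left _ _))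

lemma retr_coef_le_one {M : ℝ} (hM : 0 < M) (r : ℝ) : M / max M r ≤ 1 :=
  (div_le_one (hM.trans_le (le_max_left _ _))).mpr (le_max_left _ _)

lemma retr_coef_mul_le {M : ℝ} (hM : 0 < M) (r : ℝ) : M / max M r * r ≤ M := by
  have h : 0 < max M r := hM.trans_le (le_max_left _ _)
  rw [div_mul_eq_mul_div, div_le_iff₀ h]
  exact mul_le_mul_of_nonneg_left (le_max_right _ _) hM.le

section Retraction

variable {E : Type*} [NormedAddCommGroup E] [NormedSpace ℝ E] {M : ℝ}

lemma norm_retr_le (hM : 0 < M) (x : E) : ‖retr M x‖ ≤ M := by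
  rw [retr, norm_smul, Real.norm_of_nonneg (retr_coef_nonneg hM ‖x‖)]
  exact retr_coef_mul_le hM ‖x‖

lemma retr_of_norm_le {x : E} (hM : 0 < M) (h : ‖x‖ ≤ M) : retr M x = x := by
  rw [retr, max_eq_left h, div_self hM.ne', one_smul]

lemma norm_retr_sub_le (hM : 0 < M) (x y : E) : ‖retr M x - retr M y‖ ≤ 2 * ‖x - y‖ := by
  have hx : 0 < max M ‖x‖ := hM.trans_le (le_max_left _ _)
  have hy : 0 < max M ‖y‖ := hM.trans_le (le_max_left _ _)
  have e : retr M x - retr M y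
      = (M / max M ‖y‖) • (x - y) + (M / max M ‖x‖ - M / max M ‖y‖) • x := by
    rw [retr, retr, smul_sub, sub_smul]; abel
  have h1 : ‖(M / max M ‖y‖) • (x - y)‖ ≤ 1 * ‖x - y‖ := by
    rw [norm_smul, Real.norm_of_nonneg (retr_coef_nonneg hM ‖y‖)]
    gcongr
    exact retr_coef_le_one hM ‖y‖
  have h2 : ‖(M / max M ‖x‖ - M / max M ‖y‖) • x‖ ≤ ‖x - y‖ := by
    have h3 : M / max M ‖x‖ - M / max M ‖y‖
        = (M / max M ‖y‖) * ((max M ‖y‖ - max M ‖x‖) / max M ‖x‖) := by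
      field_simp
    have h4 : |max M ‖y‖ - max M ‖x‖| ≤ ‖x - y‖ := by
      have := abs_max_sub_max_le_max M ‖y‖ M ‖x‖
      rw [sub_self, abs_zero, max_eq_right (abs_nonneg (‖y‖ - ‖x‖))] at this
      refine this.trans ?_
      rw [abs_sub_comm]
      exact abs_norm_sub_norm_le x y
    rw [norm_smul, h3, norm_mul, Real.norm_of_nonneg (retr_coef_nonneg hM ‖y‖), norm_div,
      Real.norm_eq_abs, Real.norm_of_nonneg hx.le]
    calc M / max M ‖y‖ * (|max M ‖y‖ - max M ‖x‖| / max M ‖x‖) * ‖x‖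
        = (M / max M ‖y‖) * (|max M ‖y‖ - max M ‖x‖| * (‖x‖ / max M ‖x‖)) := by ring
      _ ≤ 1 * (‖x - y‖ * 1) := by
          gcongr
          · exact retr_coef_le_one hM ‖y‖
          · exact (div_le_one hx).mpr (le_max_right _ _)
      _ = _ := by ring
  rw [e]
  refine (norm_add_le _ _).trans ?_
  linarith

end Retraction

/-- A bounded Lipschitz vector field has integral curves on intervals of any length. -/
lemma exists_integralCurve {E : Type*} [NormedAddCommGroup E] [NormedSpace ℝ E] [CompleteSpace E]
    {V : E → E} {K L : NNReal} (hV : LipschitzWith K V) (hL : ∀ x, ‖V x‖ ≤ L) {T : ℝ} (hT : 0 ≤ T)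
    (x₀ : E) : ∃ α : ℝ → E, α 0 = x₀ ∧
      ∀ t ∈ Icc (0 : ℝ) T, HasDerivWithinAt α (V (α t)) (Icc 0 T) t := by
  have h : IsPicardLindelof (fun _ => V) (⟨0, left_mem_Icc.mpr hT⟩ : Icc (0 : ℝ) T) x₀
      (L * T.toNNReal) 0 L K :=
    IsPicardLindelof.of_time_independent (fun x _ => hL x) hV.lipschitzOnWith (by
      simp [hT])
  exact h.exists_eq_forall_mem_Icc_hasDerivWithinAt₀

lemma hasDerivWithinAt_clm {g : ℝ → L2} {g' : L2} {S : Set ℝ} {t : ℝ}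
    (h : HasDerivWithinAt g g' S t) (A : L2 →L[ℂ] L2) :
    HasDerivWithinAt (fun τ => A (g τ)) (A g') S t :=
  (A.restrictScalars ℝ).hasFDerivAt.comp_hasDerivWithinAt t h

/-! ### The reflection that characterises real-valued functions -/

/-- `f ↦ conj (f (-·))`, which is complex conjugation of the inverse Fourier transform. It is only
`ℝ`-linear. -/
def refl : L2 →L[ℝ] L2 :=
  ((Complex.conjCLE : ℂ ≃L[ℝ] ℂ) : ℂ →L[ℝ] ℂ).compLpL 2 volume ∘L
    (Lp.compMeasurePreservingₗᵢ ℝ (fun ξ : ℝ => -ξ)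
      (Measure.measurePreserving_neg volume)).toContinuousLinearMap

lemma refl_coe (g : L2) : refl g =ᵐ[volume] fun ξ => (starRingEnd ℂ) (g (-ξ)) := by
  have h1 := ContinuousLinearMap.coeFn_compLpL (p := 2)
    ((Complex.conjCLE : ℂ ≃L[ℝ] ℂ) : ℂ →L[ℝ] ℂ)
    (Lp.compMeasurePreservingₗᵢ ℝ (fun ξ : ℝ => -ξ) (Measure.measurePreserving_neg volume) g)
  have h2 := Lp.coeFn_compMeasurePreserving g (Measure.measurePreserving_neg (volume : Measure ℝ))
  filter_upwards [h1, h2] with ξ h1 h2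
  refine h1.trans ?_
  erw [h2]
  rfl

lemma ae_neg {p : ℝ → Prop} (h : ∀ᵐ ξ, p ξ) : ∀ᵐ ξ : ℝ, p (-ξ) :=
  (Measure.measurePreserving_neg (volume : Measure ℝ)).quasiMeasurePreserving.ae h

lemma refl_eq_iff (g : L2) : refl g = g ↔ Herm g := by
  constructor
  · intro h
    have h1 := refl_coe g
    rw [h] at h1
    filter_upwards [h1] with ξ h1
    rw [h1, Complex.conj_conj]
  · intro h
    apply Lp.ext
    filter_upwards [refl_coe g, h] with ξ h1 h2
    rw [h1, h2, Complex.conj_conj]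

lemma norm_refl (g : L2) : ‖refl g‖ = ‖g‖ := by
  have h : ‖refl g‖ₑ = ‖g‖ₑ := by
    rw [enorm_eq_n2, enorm_eq_n2, n2_congr (Q := fun ξ => ‖g (-ξ)‖ₑ)]
    · rw [n2, n2, lintegral_neg_eq_self (fun x => ‖g x‖ₑ ^ (2 : ℝ))]
    · filter_upwards [refl_coe g] with ξ h
      rw [h, enorm_conj]
  simpa using congrArg ENNReal.toReal h

lemma refl_mulOp {m : ℝ → ℂ} (hm : BddMeas m) (hsym : ∀ ξ, m (-ξ) = (starRingEnd ℂ) (m ξ))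
    (g : L2) : refl (mulOp m g) = mulOp m (refl g) := by
  apply Lp.ext
  filter_upwards [refl_coe (mulOp m g), ae_neg (mulOp_coe hm g), mulOp_coe hm (refl g), refl_coe g]
    with ξ h1 h2 h3 h4
  rw [h1, h2, h3, h4, hsym, map_mul, Complex.conj_conj]

lemma conj_cv_neg (f h : ℝ → ℂ) (ξ : ℝ) :
    (starRingEnd ℂ) (cv f h (-ξ))
      = cv (fun ζ => (starRingEnd ℂ) (f (-ζ))) (fun ζ => (starRingEnd ℂ) (h (-ζ))) ξ := by
  rw [cv, cv, ← integral_conj, ← integral_neg_eq_self]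
  congr 1; ext η
  rw [map_mul]
  congr 3
  ring

/-- The equation has real coefficients. -/
lemma refl_bil {s : ℝ} (hs : 3 / 2 < s) (g h : L2) :
    refl (bil s hs g h) = bil s hs (refl g) (refl h) := by
  have hf : ∀ g : L2, (fun ζ => (starRingEnd ℂ) (fh s g (-ζ))) =ᵐ[volume] fh s (refl g) := by
    intro g
    filter_upwards [refl_coe g] with ξ h
    simp [fh, h]
  have hd : (fun ζ => (starRingEnd ℂ) (dsym (fh s h) (-ζ))) =ᵐ[volume] dsym (fh s (refl h)) := by
    filter_upwards [hf h] with ξ h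
    simp [dsym, ← h, map_ofNat]
  apply Lp.ext
  filter_upwards [refl_coe (bil s hs g h), ae_neg (bil_coe hs g h), bil_coe hs (refl g) (refl h)]
    with ξ h1 h2 h3
  rw [h1, h2, h3, bilFun, bilFun, map_mul, conj_cv_neg, cv_congr (hf g) hd]
  simp

/-! ### Galerkin approximations -/

/-- The weight `tailWt N` as an operator. Its smallness for large `N` expresses that there is
little mass at high frequencies. -/
def tailOp (N : ℝ) : L2 →L[ℂ] L2 := mulOp (fun ξ => (tailWt N ξ : ℂ))

lemma mulOp_one (g : L2) : mulOp (fun _ => 1) g = g := by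
  apply Lp.ext
  filter_upwards [mulOp_coe (m := fun _ => 1) ⟨measurable_const, 1, by simp⟩ g] with ξ h
  rw [h, one_mul]

lemma bddMeas_one : BddMeas (fun _ => (1 : ℂ)) := ⟨measurable_const, 1, by simp⟩

lemma tailOp_one (g : L2) : tailOp 1 g = g := by
  have : (fun ξ => (tailWt 1 ξ : ℂ)) = fun _ => 1 := by ext ξ; simp [tailWt_one]
  rw [tailOp, this, mulOp_one]

lemma norm_tailOp_le {N : ℝ} (hN : 0 < N) (g : L2) : ‖tailOp N g‖ ≤ ‖g‖ := by
  have := norm_mulOp_le (bddMeas_tailWt hN) (C := 1) (fun ξ => by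
    rw [Complex.norm_real, Real.norm_of_nonneg (tailWt_nonneg hN _)]
    exact tailWt_le_one _ ξ) g
  simpa [tailOp] using this

lemma inner_mulOp_le {m : ℝ → ℂ} (hm : BddMeas m) {c : ℝ} (h : ∀ ξ, (m ξ).re ≤ c) (g : L2) :
    inner ℝ g (mulOp m g) ≤ c * ‖g‖ ^ 2 := by
  rw [← real_inner_self_eq_norm_sq, real_inner_L2, real_inner_L2, ← integral_const_mul]
  have hi : ∀ f g : L2, Integrable (fun ξ => ((starRingEnd ℂ) (f ξ) * g ξ).re) := fun f g => by
    have := L2.integrable_inner (𝕜 := ℝ) f g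
    simpa only [Complex.inner, mul_comm] using this
  refine integral_mono_ae (hi _ _) ((hi _ _).const_mul _) ?_
  filter_upwards [mulOp_coe hm g] with ξ e1
  rw [e1]
  have h5 : ((starRingEnd ℂ) (g ξ) * (m ξ * g ξ)).re = (m ξ).re * Complex.normSq (g ξ) := by
    simp only [Complex.normSq_apply, Complex.mul_re, Complex.mul_im, Complex.conj_re,
      Complex.conj_im]
    ring
  have h6 : ((starRingEnd ℂ) (g ξ) * g ξ).re = Complex.normSq (g ξ) := by
    simp only [Complex.normSq_apply, Complex.mul_re, Complex.conj_re, Complex.conj_im]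
    ring
  rw [h5, h6]
  exact mul_le_mul_of_nonneg_right (h ξ) (Complex.normSq_nonneg _)

/-- A real-valued solution with data `χ(D) φ` whose mass at high frequencies is controlled by that
of `φ`. -/
structure Sol (s : ℝ) (hs : 3 / 2 < s) (T M β η : ℝ) (χ : ℝ → ℂ) (φ : L2) (g : ℝ → L2) :
    Prop where
  evol : Evol s hs T β η χ g
  init : g 0 = mulOp χ φ
  herm : ∀ t ∈ Icc (0 : ℝ) T, Herm (g t)
  bound : ∀ t ∈ Icc (0 : ℝ) T, ‖g t‖ ≤ M
  tail : ∀ N, 0 < N → ∀ t ∈ Icc (0 : ℝ) T, ‖tailOp N (g t)‖ ≤ 2 * ‖tailOp N φ‖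

/-- The vector field of the equation truncated to frequencies `|ξ| ≤ n`. -/
def galVec (s : ℝ) (hs : 3 / 2 < s) (β η n : ℝ) (g : L2) : L2 :=
  mulOp (lowSym n (asym β η)) g - mulOp (lowSym n fun ξ => (wt 1 ξ : ℂ)) (bil s hs g g)

lemma bddMeas_low_asym (β η n : ℝ) : BddMeas (lowSym n (asym β η)) :=
  bddMeas_lowSym n (continuous_asym β η)

lemma bddMeas_low_wt (n : ℝ) : BddMeas (lowSym n fun ξ => (wt 1 ξ : ℂ)) :=
  bddMeas_lowSym n (Complex.continuous_ofReal.comp (continuous_wt 1))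

lemma bddMeas_low_one (n : ℝ) : BddMeas (lowSym n fun _ => 1) := bddMeas_lowSym n continuous_const

lemma lowSym_neg {n : ℝ} {m : ℝ → ℂ} (hm : ∀ ξ, m (-ξ) = (starRingEnd ℂ) (m ξ)) (ξ : ℝ) :
    lowSym n m (-ξ) = (starRingEnd ℂ) (lowSym n m ξ) := by
  rcases le_or_gt |ξ| n with h | h
  · rw [lowSym_of_le h, lowSym_of_le (by rwa [abs_neg]), hm]
  · rw [lowSym_of_lt h, lowSym_of_lt (by rwa [abs_neg]), map_zero]

lemma asym_neg (β η ξ : ℝ) : asym β η (-ξ) = (starRingEnd ℂ) (asym β η ξ) := by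
  simp only [asym, map_sub, map_mul, Complex.conj_I, Complex.conj_ofReal, mul_neg, abs_neg]
  push_cast
  ring

lemma refl_galVec {s : ℝ} (hs : 3 / 2 < s) (β η n : ℝ) (g : L2) :
    refl (galVec s hs β η n g) = galVec s hs β η n (refl g) := by
  rw [galVec, galVec, map_sub, refl_mulOp (bddMeas_low_asym β η n) (lowSym_neg (asym_neg β η)),
    refl_mulOp (bddMeas_low_wt n) (lowSym_neg (by simp)), refl_bil]

lemma low_mulOp_low (n : ℝ) {m : ℝ → ℂ} (hm : Continuous m) (g : L2) :
    mulOp (lowSym n fun _ => 1) (mulOp (lowSym n m) g) = mulOp (lowSym n m) g := by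
  rw [mulOp_mulOp (bddMeas_low_one n) (bddMeas_lowSym n hm)]
  congr 2
  ext ξ
  rcases le_or_gt |ξ| n with h | h
  · rw [lowSym_of_le h, one_mul]
  · rw [lowSym_of_lt h, lowSym_of_lt h, zero_mul]

lemma low_galVec {s : ℝ} (hs : 3 / 2 < s) (β η n : ℝ) (g : L2) :
    mulOp (lowSym n fun _ => 1) (galVec s hs β η n g) = galVec s hs β η n g := by
  rw [galVec, map_sub, low_mulOp_low n (continuous_asym β η),
    low_mulOp_low n (m := fun ξ => (wt 1 ξ : ℂ))
      (Complex.continuous_ofReal.comp (continuous_wt 1))]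

lemma eq_zero_of_low_eq {n : ℝ} {g : L2} (h : mulOp (lowSym n fun _ => 1) g = g) :
    ∀ᵐ ξ, n < |ξ| → g ξ = 0 := by
  have h1 := mulOp_coe (bddMeas_low_one n) g
  rw [h] at h1
  filter_upwards [h1] with ξ h1 h2
  rw [h1, lowSym_of_lt h2, zero_mul]

lemma norm_galVec_sub_le {s : ℝ} (hs : 3 / 2 < s) (β η n : ℝ) {M : ℝ} {x y : L2}
    (hx : ‖x‖ ≤ M) (hy : ‖y‖ ≤ M) :
    ‖galVec s hs β η n x - galVec s hs β η n y‖ ≤ (‖mulOp (lowSym n (asym β η))‖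
      + ‖mulOp (lowSym n fun ξ => (wt 1 ξ : ℂ))‖ * (2 * (bilK s).toReal * M)) * ‖x - y‖ := by
  have hb : 0 ≤ (bilK s).toReal := ENNReal.toReal_nonneg
  have e : galVec s hs β η n x - galVec s hs β η n y = mulOp (lowSym n (asym β η)) (x - y)
      - mulOp (lowSym n fun ξ => (wt 1 ξ : ℂ)) (bil s hs x (x - y) + bil s hs (x - y) y) := by
    simp only [galVec, map_sub, map_add, sub_apply]
    abel
  rw [e]
  refine (norm_sub_le _ _).trans ?_
  have h1 : ‖bil s hs x (x - y) + bil s hs (x - y) y‖ ≤ 2 * (bilK s).toReal * M * ‖x - y‖ := by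
    refine (norm_add_le _ _).trans ?_
    have h2 : ‖bil s hs x (x - y)‖ ≤ (bilK s).toReal * M * ‖x - y‖ :=
      (norm_bil_le hs _ _).trans (by gcongr)
    have h3 : ‖bil s hs (x - y) y‖ ≤ (bilK s).toReal * ‖x - y‖ * M :=
      (norm_bil_le hs _ _).trans (by gcongr)
    linarith
  have h4 := (mulOp (lowSym n (asym β η))).le_opNorm (x - y)
  have h5 := ((mulOp (lowSym n fun ξ => (wt 1 ξ : ℂ))).le_opNorm
    (bil s hs x (x - y) + bil s hs (x - y) y)).trans (mul_le_mul_of_nonneg_left h1 (norm_nonneg _))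
  linarith

/-- The energy estimate at high frequencies for the truncated vector field; a scalar truncation of
its argument does not disturb it. -/
lemma inner_tail_galVec_le {s : ℝ} (hs : 3 / 2 < s) {β η n N M c : ℝ} (h0 : 0 ≤ η) (h1 : η ≤ 1)
    (hN : 0 < N) {x : L2} (hherm : Herm x) (hsupp : ∀ᵐ ξ, n < |ξ| → x ξ = 0) (hc0 : 0 ≤ c)
    (hc1 : c ≤ 1) (hcM : c * ‖x‖ ≤ M) :
    inner ℝ (tailOp N x) (tailOp N (galVec s hs β η n (c • x)))
      ≤ (1 / 4 + (nlK s).toReal * M) * ‖tailOp N x‖ ^ 2 := by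
  have hn : 0 ≤ (nlK s).toReal := ENNReal.toReal_nonneg
  have hM : 0 ≤ M := (mul_nonneg hc0 (norm_nonneg _)).trans hcM
  have e : galVec s hs β η n (c • x) = c • mulOp (lowSym n (asym β η)) x
      - (c * c) • mulOp (lowSym n fun ξ => (wt 1 ξ : ℂ)) (bil s hs x x) := by
    have e1 : ∀ y : L2, c • y = (c : ℂ) • y := fun y => (algebraMap_smul ℂ c y).symm
    rw [mul_smul]
    simp only [galVec, e1, map_smul, smul_apply]
  rw [e, map_sub, ContinuousLinearMap.map_smul_of_tower, ContinuousLinearMap.map_smul_of_tower,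
    inner_sub_right, real_inner_smul_right, real_inner_smul_right]
  have i1 : inner ℝ (tailOp N x) (tailOp N (mulOp (lowSym n (asym β η)) x))
      ≤ 1 / 4 * ‖tailOp N x‖ ^ 2 := by
    rw [tailOp, mulOp_comm (bddMeas_tailWt hN) (bddMeas_low_asym β η n)]
    refine inner_mulOp_le (bddMeas_low_asym β η n) (fun ξ => ?_) _
    rcases le_or_gt |ξ| n with h | h
    · rw [lowSym_of_le h]; exact re_asym_le h0 h1 β ξ
    · rw [lowSym_of_lt h]; norm_num
  have i2 := abs_inner_tail_bil_le hs (n := n) hN hherm hsupp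
  rw [← tailOp] at i2
  have i3 := neg_le_of_abs_le i2
  have hx0 := norm_nonneg x
  have hs0 := sq_nonneg ‖tailOp N x‖
  have i4 : c * inner ℝ (tailOp N x) (tailOp N (mulOp (lowSym n (asym β η)) x))
      ≤ 1 / 4 * ‖tailOp N x‖ ^ 2 := by
    calc _ ≤ c * (1 / 4 * ‖tailOp N x‖ ^ 2) := by gcongr
      _ ≤ 1 * (1 / 4 * ‖tailOp N x‖ ^ 2) := by gcongr
      _ = _ := one_mul _
  have i5 : (c * c) * ((nlK s).toReal * ‖x‖ * ‖tailOp N x‖ ^ 2)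
      ≤ (nlK s).toReal * M * ‖tailOp N x‖ ^ 2 := by
    calc _ = c * ((nlK s).toReal * (c * ‖x‖) * ‖tailOp N x‖ ^ 2) := by ring
      _ ≤ 1 * ((nlK s).toReal * M * ‖tailOp N x‖ ^ 2) := by gcongr
      _ = _ := one_mul _
  have i6 := mul_le_mul_of_nonneg_left i3 (mul_nonneg hc0 hc0)
  linarith

/-- The Galerkin approximations exist on a time interval that depends only on a bound for the
data, and obey the energy estimates. -/
theorem exists_galerkin {s : ℝ} (hs : 3 / 2 < s) {β η R T : ℝ} (h0 : 0 ≤ η) (h1 : η ≤ 1)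
    (hR : 0 < R) (hT0 : 0 ≤ T)
    (hT : Real.exp ((1 / 2 + 4 * (nlK s).toReal * (2 * R)) * T) ≤ 4) {φ : L2} (hφ : Herm φ)
    (hφR : ‖φ‖ ≤ R) (n : ℝ) :
    ∃ g, Sol s hs T (2 * R) β η (lowSym n fun _ => 1) φ g := by
  have hn : 0 ≤ (nlK s).toReal := ENNReal.toReal_nonneg
  have hb : 0 ≤ (bilK s).toReal := ENNReal.toReal_nonneg
  set M := 2 * R with hMdef
  have hM : 0 < M := by positivity
  set A := mulOp (lowSym n (asym β η))
  set W := mulOp (lowSym n fun ξ => (wt 1 ξ : ℂ))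
  set P := mulOp (lowSym n fun _ => 1) with hP
  -- the retraction makes the vector field bounded and Lipschitz; the energy estimate shows
  -- afterwards that the solution stays in the ball where it does nothing
  set V : L2 → L2 := fun x => galVec s hs β η n (retr M x) with hV
  set K : ℝ := (‖A‖ + ‖W‖ * (2 * (bilK s).toReal * M)) * 2
  have hK : 0 ≤ K := by positivity
  have hVsub : ∀ x y, ‖V x - V y‖ ≤ K * ‖x - y‖ := by
    intro x y
    refine (norm_galVec_sub_le hs β η n (norm_retr_le hM x) (norm_retr_le hM y)).trans ?_
    refine (mul_le_mul_of_nonneg_left (norm_retr_sub_le hM x y) (by positivity)).trans (le_of_eq ?_)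
    simp only [K, A, W]; ring
  have hVlip : LipschitzWith K.toNNReal V := by
    refine LipschitzWith.of_dist_le_mul fun x y => ?_
    rw [dist_eq_norm, dist_eq_norm, Real.coe_toNNReal K hK]
    exact hVsub x y
  have hVbd : ∀ x, ‖V x‖ ≤ ((K * M).toNNReal : ℝ) := by
    intro x
    rw [Real.coe_toNNReal _ (by positivity)]
    have := norm_galVec_sub_le hs β η n (norm_retr_le hM x) (y := 0) (by simpa using hM.le)
    have e0 : galVec s hs β η n 0 = 0 := by simp [galVec]
    rw [e0, sub_zero, sub_zero] at this
    refine this.trans ?_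
    have h2 := norm_retr_le hM x
    calc _ ≤ (‖A‖ + ‖W‖ * (2 * (bilK s).toReal * M)) * M := by gcongr
      _ ≤ K * M := by
        have : 0 ≤ ‖A‖ + ‖W‖ * (2 * (bilK s).toReal * M) := by positivity
        simp only [K]
        nlinarith
  obtain ⟨g, hg0, hg⟩ := exists_integralCurve hVlip hVbd hT0 (P φ)
  have hzero : (0 : ℝ) ∈ Icc (0 : ℝ) T := left_mem_Icc.mpr hT0
  have hcont : ContinuousOn g (Icc 0 T) := fun t ht => (hg t ht).continuousWithinAt
  -- the vector field takes values in the functions supported in `|ξ| ≤ n`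
  have hPg : ∀ t ∈ Icc (0 : ℝ) T, P (g t) = g t := by
    intro t ht
    have hd : ∀ τ ∈ Icc (0 : ℝ) T,
        HasDerivWithinAt (fun τ => g τ - P (g τ)) (0 : L2) (Icc 0 T) τ := by
      intro τ hτ
      have := (hg τ hτ).sub (hasDerivWithinAt_clm (hg τ hτ) P)
      rwa [hV, low_galVec, sub_self] at this
    have h2 := (convex_Icc (0 : ℝ) T).norm_image_sub_le_of_norm_hasDerivWithin_le (C := 0) hd
      (fun _ _ => by simp) hzero ht
    rw [zero_mul, norm_le_zero_iff, hg0, low_mulOp_low n continuous_const, sub_self, sub_zero,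
      sub_eq_zero] at h2
    exact h2.symm
  -- the reflection of a solution is a solution with the same initial value
  have hherm : ∀ t ∈ Icc (0 : ℝ) T, Herm (g t) := by
    intro t ht
    rw [← refl_eq_iff]
    set D : ℝ → L2 := fun τ => refl (g τ) - g τ
    have hrV : ∀ x, refl (V x) = V (refl x) := by
      intro x
      have e1 : refl (retr M x) = retr M (refl x) := by
        rw [retr, retr, norm_refl, map_smul]
      simp only [hV, refl_galVec, e1]
    have hd : ∀ τ ∈ Icc (0 : ℝ) T, HasDerivWithinAt (fun τ => ‖D τ‖ ^ 2)
        (2 * inner ℝ (D τ) (V (refl (g τ)) - V (g τ))) (Icc 0 T) τ := by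
      intro τ hτ
      refine HasDerivWithinAt.norm_sq ?_
      have h2 := refl.hasFDerivAt.comp_hasDerivWithinAt τ (hg τ hτ)
      rw [hrV] at h2
      exact h2.sub (hg τ hτ)
    have h3 := gronwall_le (K := 2 * K) (ε := 0) (by positivity) le_rfl hd (fun τ _ => by
      have := (real_inner_le_norm (D τ) (V (refl (g τ)) - V (g τ))).trans
        (mul_le_mul_of_nonneg_left (hVsub (refl (g τ)) (g τ)) (norm_nonneg _))
      calc _ ≤ 2 * (‖D τ‖ * (K * ‖D τ‖)) := by linarith
        _ = _ := by ring) t ht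
    have hD0 : D 0 = 0 := by
      simp only [D, hg0, hP]
      rw [refl_mulOp (bddMeas_low_one n) (lowSym_neg (by simp)), (refl_eq_iff φ).mpr hφ, sub_self]
    simp only [hD0, norm_zero, zero_mul, add_zero] at h3
    have h4 : ‖D t‖ = 0 := by
      have : ‖D t‖ ^ 2 ≤ 0 := by simpa using h3
      nlinarith [norm_nonneg (D t)]
    exact sub_eq_zero.mp (norm_eq_zero.mp h4)
  have htail : ∀ N, 0 < N → ∀ t ∈ Icc (0 : ℝ) T, ‖tailOp N (g t)‖ ≤ 2 * ‖tailOp N φ‖ := by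
    intro N hN t ht
    have hd : ∀ τ ∈ Icc (0 : ℝ) T, HasDerivWithinAt (fun τ => ‖tailOp N (g τ)‖ ^ 2)
        (2 * inner ℝ (tailOp N (g τ)) (tailOp N (V (g τ)))) (Icc 0 T) τ := fun τ hτ =>
      (hasDerivWithinAt_clm (hg τ hτ) (tailOp N)).norm_sq
    have h3 := gronwall_le (K := 1 / 2 + 4 * (nlK s).toReal * M) (ε := 0) (by positivity) le_rfl hd
      (fun τ hτ => by
        have := inner_tail_galVec_le hs (β := β) (n := n) h0 h1 hN (hherm τ hτ)
          (eq_zero_of_low_eq (hPg τ hτ)) (retr_coef_nonneg hM ‖g τ‖) (retr_coef_le_one hM ‖g τ‖)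
          (retr_coef_mul_le hM ‖g τ‖)
        have h4 : 0 ≤ (nlK s).toReal * M * ‖tailOp N (g τ)‖ ^ 2 := by positivity
        simp only [hV, retr]
        linarith) t ht
    have h5 : ‖tailOp N (g 0)‖ ≤ ‖tailOp N φ‖ := by
      rw [hg0, tailOp, hP, mulOp_comm (bddMeas_tailWt hN) (bddMeas_low_one n)]
      have := norm_mulOp_le (bddMeas_low_one n) (C := 1) (fun ξ => by
        rcases le_or_gt |ξ| n with h | h
        · rw [lowSym_of_le h]; simp
        · rw [lowSym_of_lt h]; simp) (mulOp (fun ξ => (tailWt N ξ : ℂ)) φ)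
      simpa using this
    have h6 : ‖tailOp N (g t)‖ ^ 2 ≤ (2 * ‖tailOp N φ‖) ^ 2 := by
      calc ‖tailOp N (g t)‖ ^ 2
          ≤ ‖tailOp N (g 0)‖ ^ 2 * Real.exp ((1 / 2 + 4 * (nlK s).toReal * M) * t) := by
            simpa using h3
        _ ≤ ‖tailOp N φ‖ ^ 2 * 4 := by
            gcongr
            refine le_trans ?_ hT
            gcongr
            exact ht.2
        _ = _ := by ring
    exact le_of_sq_le_sq h6 (by positivity)
  -- the tail operator with `N = 1` is the identity
  have hbound : ∀ t ∈ Icc (0 : ℝ) T, ‖g t‖ ≤ M := by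
    intro t ht
    have := htail 1 one_pos t ht
    rw [tailOp_one, tailOp_one] at this
    exact this.trans (by rw [hMdef]; gcongr)
  refine ⟨g, ⟨hcont, fun t ht => ?_⟩, hg0, hherm, hbound, htail⟩
  have hd := hasDerivWithinAt_clm (hg t ht) (J 2)
  -- on `|ξ| ≤ n` the truncated vector field is the equation in `H^{s-2}`, with the weight
  -- of `H^s` restored
  have e : J 2 (V (g t)) = linOp β η (g t) - J 1 (mulOp (lowSym n fun _ => 1)
      (bil s hs (g t) (g t))) := by
    simp only [hV, retr_of_norm_le hM (hbound t ht), galVec, map_sub]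
    congr 1
    · apply Lp.ext
      filter_upwards [J_coe (r := 2) (by norm_num) (mulOp (lowSym n (asym β η)) (g t)),
        mulOp_coe (bddMeas_low_asym β η n) (g t), linOp_coe β η (g t),
        eq_zero_of_low_eq (hPg t ht)] with ξ e1 e2 e3 e4
      rw [e1, e3, fh, e2]
      rcases le_or_gt |ξ| n with h | h
      · rw [lowSym_of_le h]; ring
      · rw [e4 h]; simp
    · have h12 : ∀ B : L2, J 2 (mulOp (lowSym n fun ξ => (wt 1 ξ : ℂ)) B)
          = J 1 (mulOp (lowSym n fun _ => 1) B) := by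
        intro B
        rw [J, J, mulOp_mulOp (bddMeas_wt (by norm_num)) (bddMeas_low_wt n),
          mulOp_mulOp (bddMeas_wt (by norm_num)) (bddMeas_low_one n)]
        congr 2
        ext ξ
        rcases le_or_gt |ξ| n with h | h
        · rw [lowSym_of_le h, lowSym_of_le h, mul_one, ← Complex.ofReal_mul, ← wt_add]
          norm_num
        · rw [lowSym_of_lt h, lowSym_of_lt h, mul_zero, mul_zero]
      exact h12 _
  rwa [e] at hd

/-! ### Stability and existence of solutions -/

/-- The truncation `χ(D)` is close to the identity as an operator `H^{s-1} → L²`. -/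
structure NearId (s δ : ℝ) (χ : ℝ → ℂ) : Prop where
  bddMeas : BddMeas χ
  le : ∀ ξ, ‖χ ξ - 1‖ * wt (-(s - 1)) ξ ≤ δ

lemma nearId_one {s δ : ℝ} (hδ : 0 ≤ δ) : NearId s δ (fun _ => 1) :=
  ⟨bddMeas_one, fun ξ => by simpa using hδ⟩

lemma norm_low_sub_one_mul_wt_le {r n : ℝ} (hr : 0 ≤ r) (hn : 0 ≤ n) (ξ : ℝ) :
    ‖lowSym n (fun _ => 1) ξ - 1‖ * wt (-r) ξ ≤ wt (-r) n := by
  rcases le_or_gt |ξ| n with h | h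
  · rw [lowSym_of_le h, sub_self, norm_zero, zero_mul]
    exact wt_nonneg _ _
  · rw [lowSym_of_lt h, zero_sub, norm_neg, norm_one, one_mul, wt_neg, wt_neg]
    exact inv_anti₀ (wt_pos _ _) (wt_mono_abs hr (by rw [abs_of_nonneg hn]; exact h.le))

lemma nearId_low {s n : ℝ} (hs : 1 ≤ s) (hn : 0 ≤ n) :
    NearId s (wt (-(s - 1)) n) (lowSym n fun _ => 1) :=
  ⟨bddMeas_low_one n, norm_low_sub_one_mul_wt_le (by linarith) hn⟩

lemma tendsto_wt_neg {r : ℝ} (hr : 0 < r) :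
    Tendsto (fun n : ℕ => wt (-r) n) atTop (𝓝 0) := by
  have h1 : Tendsto (fun n : ℕ => 1 + (n : ℝ) ^ 2) atTop atTop :=
    tendsto_atTop_add_const_left _ _
      ((tendsto_pow_atTop two_ne_zero).comp tendsto_natCast_atTop_atTop)
  have h2 := (tendsto_rpow_neg_atTop (y := r / 2) (by positivity)).comp h1
  refine h2.congr fun n => ?_
  simp only [Function.comp, wt, neg_div]

/-- The `H^s` norm at frequencies up to `N` is controlled by the `L²` norm, and the rest by the
tail. -/
lemma norm_le_low_add_tail {s N : ℝ} (hs : 0 ≤ s) (hN : 1 ≤ N) (x : L2) :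
    ‖x‖ ≤ N ^ s * ‖J s x‖ + ‖tailOp N x‖ := by
  have hN0 : 0 < N := by linarith
  have h1 : ‖x‖ₑ ≤ ENNReal.ofReal (N ^ s) * ‖J s x‖ₑ + ‖tailOp N x‖ₑ := by
    rw [enorm_eq_n2 x, enorm_J hs, tailOp, enorm_mulOp (bddMeas_tailWt hN0),
      ← n2_const_mul _ (measurable_fh s x).enorm]
    have hx := L2_measurable x
    refine le_trans (n2_mono (ae_of_all _ fun ξ => ?_)) (n2_add (by fun_prop) (by fun_prop))
    rw [enorm_fh, enorm_coe_of_nonneg (tailWt_nonneg hN0 ξ), ← mul_assoc,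
      ← ENNReal.ofReal_mul (by positivity), ← add_mul,
      ← ENNReal.ofReal_add (mul_nonneg (by positivity) (wt_nonneg _ _)) (tailWt_nonneg hN0 ξ)]
    refine le_mul_of_one_le_left zero_le ?_
    rw [← ENNReal.ofReal_one]
    apply ENNReal.ofReal_le_ofReal
    rcases le_or_gt (wt 1 ξ) N with h | h
    · have h2 : wt s ξ ≤ N ^ s := by
        have : wt s ξ = wt 1 ξ ^ s := by
          rw [wt, wt, ← Real.rpow_mul (by positivity)]; congr 1; ring
        rw [this]
        exact Real.rpow_le_rpow (wt_nonneg _ _) h hs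
      have h3 : 1 ≤ N ^ s * wt (-s) ξ := by
        rw [wt_neg, ← div_eq_mul_inv, one_le_div (wt_pos _ _)]
        exact h2
      linarith [tailWt_nonneg hN0 ξ]
    · have h2 : tailWt N ξ = 1 := min_eq_left ((one_le_div hN0).mpr h.le)
      rw [h2]
      linarith [mul_nonneg (Real.rpow_nonneg hN0.le s) (wt_nonneg (-s) ξ)]
  have hfin : ENNReal.ofReal (N ^ s) * ‖J s x‖ₑ ≠ ∞ :=
    ENNReal.mul_ne_top ENNReal.ofReal_ne_top (by simp)
  have h2 := ENNReal.toReal_mono (ENNReal.add_ne_top.mpr ⟨hfin, by simp⟩) h1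
  rw [ENNReal.toReal_add hfin (by simp), ENNReal.toReal_mul,
    ENNReal.toReal_ofReal (by positivity)] at h2
  simpa using h2

/-- The tails of a fixed function tend to zero. -/
lemma tendsto_tailOp (x : L2) : Tendsto (fun n : ℕ => ‖tailOp (n + 1 : ℕ) x‖) atTop (𝓝 0) := by
  have hx := L2_measurable x
  have h1 : Tendsto (fun n : ℕ => ∫⁻ ξ, (ENNReal.ofReal (tailWt (n + 1 : ℕ) ξ) * ‖x ξ‖ₑ) ^ (2 : ℝ))
      atTop (𝓝 (∫⁻ _ : ℝ, 0)) := by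
    refine tendsto_lintegral_of_dominated_convergence (fun ξ => ‖x ξ‖ₑ ^ (2 : ℝ))
      (fun n => by fun_prop) (fun n => ae_of_all _ fun ξ => ?_) ?_ (ae_of_all _ fun ξ => ?_)
    · refine ENNReal.rpow_le_rpow (mul_le_of_le_one_left zero_le ?_) (by norm_num)
      rw [← ENNReal.ofReal_one]
      exact ENNReal.ofReal_le_ofReal (tailWt_le_one _ _)
    · rw [← n2_sq, ← enorm_eq_n2]
      simp
    · have h2 : Tendsto (fun n : ℕ => tailWt (n + 1 : ℕ) ξ) atTop (𝓝 0) := by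
        have h3 : Tendsto (fun n : ℕ => wt 1 ξ / ((n + 1 : ℕ) : ℝ)) atTop (𝓝 0) :=
          (tendsto_const_nhds.div_atTop tendsto_natCast_atTop_atTop).comp (tendsto_add_atTop_nat 1)
        exact squeeze_zero (fun n => tailWt_nonneg (by positivity) ξ) (fun n => min_le_right _ _) h3
      have h4 : Tendsto (fun n : ℕ => ENNReal.ofReal (tailWt (n + 1 : ℕ) ξ) * ‖x ξ‖ₑ) atTop
          (𝓝 (0 * ‖x ξ‖ₑ)) := by
        refine ENNReal.Tendsto.mul_const ?_ (Or.inr (by simp))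
        simpa using ENNReal.tendsto_ofReal h2
      have h5 := (ENNReal.continuous_rpow_const (y := (2 : ℝ))).tendsto (0 * ‖x ξ‖ₑ) |>.comp h4
      simpa [Function.comp_def] using h5
  have h2 : Tendsto (fun n : ℕ => ‖tailOp (n + 1 : ℕ) x‖ₑ) atTop (𝓝 0) := by
    have h3 := (ENNReal.continuous_rpow_const (y := (1 / 2 : ℝ))).tendsto _ |>.comp h1
    simp only [lintegral_zero, one_div, inv_pos, Nat.ofNat_pos, ENNReal.zero_rpow_of_pos] at h3
    refine h3.congr fun n => ?_
    rw [tailOp, enorm_mulOp (bddMeas_tailWt (by positivity))]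
    simp only [n2, Function.comp, one_div, enorm_coe_of_nonneg (tailWt_nonneg
      (show (0 : ℝ) < ((n + 1 : ℕ) : ℝ) by positivity) _)]
  have h3 := (ENNReal.tendsto_toReal (a := 0) (by simp)).comp h2
  simpa [Function.comp_def] using h3

lemma NearId.norm_J_le {s δ : ℝ} {χ : ℝ → ℂ} (h : NearId s δ χ) (hs : 0 ≤ s) (φ : L2) :
    ‖J s (mulOp χ φ - φ)‖ ≤ δ * ‖φ‖ := by
  refine L2_norm_le_of_ae ?_
  filter_upwards [J_coe hs (mulOp χ φ - φ), Lp.coeFn_sub (mulOp χ φ) φ, mulOp_coe h.bddMeas φ]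
    with ξ h1 h2 h3
  rw [h1, fh, h2, Pi.sub_apply, h3]
  have e : (wt (-s) ξ : ℂ) * (χ ξ * φ ξ - φ ξ) = (χ ξ - 1) * (wt (-s) ξ : ℂ) * φ ξ := by ring
  rw [e, norm_mul, norm_mul, Complex.norm_real, Real.norm_of_nonneg (wt_nonneg _ _)]
  gcongr
  exact (mul_le_mul_of_nonneg_left (wt_le_wt (by linarith) ξ) (norm_nonneg _)).trans (h.le ξ)

/-- Solutions depend continuously, in `H^s`, on the data, the dissipation and the truncation. The
low frequencies of the difference are controlled by its `L²` norm and the high frequencies by the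
tails of the data. -/
theorem Sol.stable {s : ℝ} (hs : 3 / 2 < s) {T M : ℝ} (hT0 : 0 ≤ T) (hM : 0 ≤ M)
    (hT : Real.exp ((1 / 2 + 4 * (nlK s).toReal * M) * T) ≤ 4) (φ₀ : L2) {ε : ℝ} (hε : 0 < ε) :
    ∃ d > 0, ∀ (β η₁ η₂ : ℝ) (χ₁ χ₂ : ℝ → ℂ) (φ₁ φ₂ : L2) (g₁ g₂ : ℝ → L2), 0 ≤ η₁ → η₁ ≤ 1 →
      |η₁ - η₂| ≤ d → NearId s d χ₁ → NearId s d χ₂ → ‖φ₁ - φ₀‖ ≤ d → ‖φ₂ - φ₀‖ ≤ d →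
      Sol s hs T M β η₁ χ₁ φ₁ g₁ → Sol s hs T M β η₂ χ₂ φ₂ g₂ →
      ∀ t ∈ Icc (0 : ℝ) T, ‖g₁ t - g₂ t‖ < ε := by
  have hb : 0 ≤ (bilK s).toReal := ENNReal.toReal_nonneg
  -- the threshold between low and high frequencies is chosen first, depending on `φ₀` and `ε`
  obtain ⟨n, hn⟩ := ((tendsto_tailOp φ₀).eventually_lt_const (show 0 < ε / 8 by positivity)).exists
  set N : ℝ := ((n + 1 : ℕ) : ℝ) with hNdef
  have hN1 : 1 ≤ N := by rw [hNdef]; exact_mod_cast Nat.le_add_left 1 n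
  have hN0 : 0 < N := by linarith
  -- the bound for the low frequencies, as a function of the size `d` of the perturbation
  set E : ℝ → ℝ := fun d => (2 * d + 2 * d * (‖φ₀‖ + 1)) ^ 2
    + (4 * M ^ 2 * (8 * Real.pi ^ 2 * d + (bilK s).toReal * M * (d + d))) * T with hE
  have hcont : Continuous fun d => N ^ s * Real.sqrt (E d * 4) + 4 * d := by fun_prop
  have hlim : Tendsto (fun d => N ^ s * Real.sqrt (E d * 4) + 4 * d) (𝓝[>] 0) (𝓝 0) := by
    have h0 : N ^ s * Real.sqrt (E 0 * 4) + 4 * 0 = 0 := by simp [hE]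
    have h1 := (hcont.tendsto 0).mono_left (nhdsWithin_le_nhds (s := Ioi 0))
    rwa [h0] at h1
  -- `d` is so small that the low frequencies, and the deviation of the tails from those of `φ₀`,
  -- contribute less than `ε / 2`; the tails of `φ₀` contribute the other half
  obtain ⟨d, ⟨hd1, hd0⟩, hdle⟩ := ((hlim.eventually_lt_const (show 0 < ε / 2 by positivity)).and
    self_mem_nhdsWithin |>.and (mem_nhdsWithin_of_mem_nhds (Iic_mem_nhds zero_lt_one))).exists
  have hd0' : 0 < d := hd0
  have hdle' : d ≤ 1 := hdle
  refine ⟨d, hd0', ?_⟩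
  intro β η₁ η₂ χ₁ χ₂ φ₁ φ₂ g₁ g₂ h0 h1 hη hχ₁ hχ₂ hφ₁ hφ₂ S₁ S₂ t ht
  have hcomp := S₁.evol.compare S₂.evol h0 h1 S₁.herm S₁.bound S₂.bound hχ₁.bddMeas hχ₂.bddMeas
    hχ₁.le hχ₂.le t ht
  have nφ : ∀ φ : L2, ‖φ - φ₀‖ ≤ d → ‖φ‖ ≤ ‖φ₀‖ + 1 := fun φ h => by
    have := norm_add_le (φ - φ₀) φ₀
    rw [sub_add_cancel] at this
    linarith
  have hinit : ‖J s (g₁ 0 - g₂ 0)‖ ≤ 2 * d + 2 * d * (‖φ₀‖ + 1) := by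
    rw [S₁.init, S₂.init]
    have e : J s (mulOp χ₁ φ₁ - mulOp χ₂ φ₂) = J s (mulOp χ₁ φ₁ - φ₁) - J s (mulOp χ₂ φ₂ - φ₂)
        + J s ((φ₁ - φ₀) - (φ₂ - φ₀)) := by
      simp only [map_sub]; abel
    rw [e]
    have i1 := hχ₁.norm_J_le (by linarith) φ₁
    have i2 := hχ₂.norm_J_le (by linarith) φ₂
    have i3 := (ChenLee.norm_J_le (by linarith : 0 ≤ s) ((φ₁ - φ₀) - (φ₂ - φ₀))).trans
      (norm_sub_le _ _)
    have i4 : d * ‖φ₁‖ ≤ d * (‖φ₀‖ + 1) := by gcongr; exact nφ φ₁ hφ₁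
    have i5 : d * ‖φ₂‖ ≤ d * (‖φ₀‖ + 1) := by gcongr; exact nφ φ₂ hφ₂
    refine (norm_add_le _ _).trans ?_
    have := norm_sub_le (J s (mulOp χ₁ φ₁ - φ₁)) (J s (mulOp χ₂ φ₂ - φ₂))
    linarith
  have hlow : ‖J s (g₁ t - g₂ t)‖ ≤ Real.sqrt (E d * 4) := by
    refine Real.le_sqrt_of_sq_le (hcomp.trans ?_)
    simp only [hE]
    gcongr
  have htail : ‖tailOp N (g₁ t - g₂ t)‖ ≤ 4 * (ε / 8) + 4 * d := by
    rw [map_sub]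
    have tφ : ∀ φ : L2, ‖φ - φ₀‖ ≤ d → ‖tailOp N φ‖ ≤ ε / 8 + d := fun φ h => by
      have h2 := norm_add_le (tailOp N (φ - φ₀)) (tailOp N φ₀)
      rw [← map_add, sub_add_cancel] at h2
      have h3 := norm_tailOp_le hN0 (φ - φ₀)
      linarith
    have i1 := S₁.tail N hN0 t ht
    have i2 := S₂.tail N hN0 t ht
    have i3 := tφ φ₁ hφ₁
    have i4 := tφ φ₂ hφ₂
    refine (norm_sub_le _ _).trans ?_
    linarith
  have := norm_le_low_add_tail (by linarith : 0 ≤ s) hN1 (g₁ t - g₂ t)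
  have h5 : N ^ s * ‖J s (g₁ t - g₂ t)‖ ≤ N ^ s * Real.sqrt (E d * 4) := by gcongr
  linarith

section FTC

variable {E : Type*} [NormedAddCommGroup E] [NormedSpace ℝ E] [CompleteSpace E]

lemma hasDerivWithinAt_of_integral_eq {T : ℝ} {y F : ℝ → E} (hF : ContinuousOn F (Icc 0 T))
    (hy : ∀ t ∈ Icc (0 : ℝ) T, y t = y 0 + ∫ τ in (0 : ℝ)..t, F τ) :
    ∀ t ∈ Icc (0 : ℝ) T, HasDerivWithinAt y (F t) (Icc 0 T) t := by
  intro t ht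
  have h0 : (0 : ℝ) ∈ Icc (0 : ℝ) T := ⟨le_rfl, ht.1.trans ht.2⟩
  have : Fact (t ∈ Icc (0 : ℝ) T) := ⟨ht⟩
  refine HasDerivWithinAt.congr (HasDerivWithinAt.const_add (y 0) ?_) hy (hy t ht)
  exact intervalIntegral.integral_hasDerivWithinAt_right
    ((hF.mono (uIcc_subset_Icc h0 ht)).intervalIntegrable)
    (hF.stronglyMeasurableAtFilter_nhdsWithin measurableSet_Icc t) (hF t ht)

lemma integral_eq_of_hasDerivWithinAt {T : ℝ} {y F : ℝ → E} (hF : ContinuousOn F (Icc 0 T))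
    (hy : ∀ t ∈ Icc (0 : ℝ) T, HasDerivWithinAt y (F t) (Icc 0 T) t) :
    ∀ t ∈ Icc (0 : ℝ) T, y t = y 0 + ∫ τ in (0 : ℝ)..t, F τ := by
  intro t ht
  have hsub : Icc 0 t ⊆ Icc 0 T := Icc_subset_Icc_right ht.2
  rw [intervalIntegral.integral_eq_sub_of_hasDerivAt_of_le ht.1
    (fun τ hτ => ((hy τ (hsub hτ)).continuousWithinAt).mono hsub)
    (fun τ hτ => (hy τ (hsub (Ioo_subset_Icc_self hτ))).hasDerivAt
      (Icc_mem_nhds hτ.1 (hτ.2.trans_le ht.2)))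
    ((hF.mono (by rw [uIcc_of_le ht.1]; exact hsub)).intervalIntegrable)]
  abel

end FTC

lemma eq_zero_of_J_eq_zero {r : ℝ} (hr : 0 ≤ r) {x : L2} (h : J r x = 0) : x = 0 := by
  apply Lp.ext
  have h1 := J_coe hr x
  rw [h] at h1
  filter_upwards [h1, Lp.coeFn_zero ℂ 2 (volume : Measure ℝ)] with ξ h1 h2
  rw [h2] at h1 ⊢
  simp only [fh, Pi.zero_apply] at h1 ⊢
  rcases mul_eq_zero.mp h1.symm with h | h
  · exact absurd h (by exact_mod_cast (wt_pos (-r) ξ).ne')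
  · exact h

lemma J_injective {r : ℝ} (hr : 0 ≤ r) : Function.Injective (J r) := fun x y h =>
  sub_eq_zero.mp (eq_zero_of_J_eq_zero hr (by rw [map_sub, h, sub_self]))

/-- A real-valued solution is the only solution with its initial data, even among complex-valued
ones. -/
theorem Evol.eq_of_herm {s : ℝ} {hs : 3 / 2 < s} {T β η : ℝ} {g₁ g₂ : ℝ → L2}
    (h₁ : Evol s hs T β η (fun _ => 1) g₁) (h₂ : Evol s hs T β η (fun _ => 1) g₂)
    (hη0 : 0 ≤ η) (hη1 : η ≤ 1) (hherm : ∀ t ∈ Icc (0 : ℝ) T, Herm (g₁ t)) (h0 : g₁ 0 = g₂ 0) :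
    ∀ t ∈ Icc (0 : ℝ) T, g₁ t = g₂ t := by
  intro t ht
  obtain ⟨M₁, hM₁⟩ := isCompact_Icc.exists_bound_of_continuousOn h₁.cont
  obtain ⟨M₂, hM₂⟩ := isCompact_Icc.exists_bound_of_continuousOn h₂.cont
  have := h₁.compare h₂ hη0 hη1 hherm (M := max M₁ M₂)
    (fun t ht => (hM₁ t ht).trans (le_max_left _ _))
    (fun t ht => (hM₂ t ht).trans (le_max_right _ _))
    bddMeas_one bddMeas_one
    (nearId_one (s := s) le_rfl).le (nearId_one (s := s) le_rfl).le t ht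
  simp only [h0, sub_self, map_zero, norm_zero, abs_zero, add_zero, mul_zero, ne_eq,
    OfNat.ofNat_ne_zero, not_false_eq_true, zero_pow, zero_mul] at this
  have h2 : J s (g₁ t - g₂ t) = 0 := by
    rw [← norm_eq_zero]
    exact pow_eq_zero_iff two_ne_zero |>.mp (le_antisymm this (sq_nonneg _))
  exact sub_eq_zero.mp (eq_zero_of_J_eq_zero (by linarith) h2)

lemma norm_low_one_le (n : ℝ) (x : L2) : ‖mulOp (lowSym n fun _ => 1) x‖ ≤ ‖x‖ := by
  have := norm_mulOp_le (bddMeas_low_one n) (C := 1) (fun ξ => by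
    rcases le_or_gt |ξ| n with h | h
    · rw [lowSym_of_le h, norm_one]
    · rw [lowSym_of_lt h, norm_zero]; exact zero_le_one) x
  simpa using this

lemma norm_J_one_low_sub_le {n : ℝ} (hn : 0 ≤ n) (B : L2) :
    ‖J 1 (mulOp (lowSym n fun _ => 1) B - B)‖ ≤ wt (-1) n * ‖B‖ := by
  refine L2_norm_le_of_ae ?_
  filter_upwards [J_coe zero_le_one (mulOp (lowSym n fun _ => 1) B - B),
    Lp.coeFn_sub (mulOp (lowSym n fun _ => 1) B) B, mulOp_coe (bddMeas_low_one n) B] with ξ h1 h2 h3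
  rw [h1, fh, h2, Pi.sub_apply, h3]
  have e : (wt (-1) ξ : ℂ) * (lowSym n (fun _ => 1) ξ * B ξ - B ξ)
      = (lowSym n (fun _ => 1) ξ - 1) * (wt (-1) ξ : ℂ) * B ξ := by ring
  rw [e, norm_mul, norm_mul, Complex.norm_real, Real.norm_of_nonneg (wt_nonneg _ _)]
  gcongr
  exact norm_low_sub_one_mul_wt_le zero_le_one hn ξ

/-- The Galerkin approximations converge uniformly in `H^s`, by `Sol.stable`; the equation for the
limit is obtained from its integrated form. -/
theorem exists_sol {s : ℝ} (hs : 3 / 2 < s) {β η R T : ℝ} (h0 : 0 ≤ η) (h1 : η ≤ 1)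
    (hR : 0 < R) (hT0 : 0 ≤ T)
    (hT : Real.exp ((1 / 2 + 4 * (nlK s).toReal * (2 * R)) * T) ≤ 4) {φ : L2} (hφ : Herm φ)
    (hφR : ‖φ‖ ≤ R) :
    ∃ g, Sol s hs T (2 * R) β η (fun _ => 1) φ g := by
  have hb : 0 ≤ (bilK s).toReal := ENNReal.toReal_nonneg
  choose g hg using fun n : ℕ => exists_galerkin hs h0 h1 hR hT0 hT hφ hφR (β := β) (n : ℝ)
  have h0T : (0 : ℝ) ∈ Icc (0 : ℝ) T := ⟨le_rfl, hT0⟩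
  have hcauchy : UniformCauchySeqOn g atTop (Icc (0 : ℝ) T) := by
    rw [Metric.uniformCauchySeqOn_iff]
    intro ε hε
    obtain ⟨d, hd, H⟩ := Sol.stable hs hT0 (by positivity : 0 ≤ 2 * R) hT φ hε
    obtain ⟨N, hN⟩ := eventually_atTop.mp
      ((tendsto_wt_neg (r := s - 1) (by linarith)).eventually_le_const hd)
    have near : ∀ n ≥ N, NearId s d (lowSym (n : ℝ) fun _ => 1) := fun n hn =>
      ⟨bddMeas_low_one _, fun ξ =>
        ((nearId_low (by linarith) (Nat.cast_nonneg n)).le ξ).trans (hN n hn)⟩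
    refine ⟨N, fun m hm n hn t ht => ?_⟩
    rw [dist_eq_norm]
    exact H β η η _ _ φ φ _ _ h0 h1 (by simpa using hd.le) (near m hm) (near n hn)
      (by simpa using hd.le) (by simpa using hd.le) (hg m) (hg n) t ht
  -- the limit exists, and so is meaningful, for `t ∈ [0, T]` only
  set G : ℝ → L2 := fun t => limUnder atTop fun n => g n t
  have hG : ∀ t ∈ Icc (0 : ℝ) T, Tendsto (fun n => g n t) atTop (𝓝 (G t)) := fun t ht =>
    (hcauchy.cauchySeq ht).tendsto_limUnder
  have hunif := hcauchy.tendstoUniformlyOn_of_tendsto hG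
  have hGc : ContinuousOn G (Icc 0 T) :=
    hunif.continuousOn (Frequently.of_forall fun n => (hg n).evol.cont)
  have hGb : ∀ t ∈ Icc (0 : ℝ) T, ‖G t‖ ≤ 2 * R := fun t ht =>
    le_of_tendsto (hG t ht).norm (Eventually.of_forall fun n => (hg n).bound t ht)
  have hbc : Continuous fun x : L2 => bil s hs x x := by fun_prop
  have hJ : ∀ x : L2, ‖J 1 x‖ ≤ ‖x‖ := fun x => norm_J_le zero_le_one x
  refine ⟨G, ⟨hGc, ?_⟩, ?_, fun t ht => ?_, hGb, fun N hN t ht => ?_⟩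
  · set F : ℝ → L2 := fun t => linOp β η (G t) - J 1 (mulOp (fun _ => 1) (bil s hs (G t) (G t)))
    set Fn : ℕ → ℝ → L2 := fun n t => linOp β η (g n t)
      - J 1 (mulOp (lowSym n fun _ => 1) (bil s hs (g n t) (g n t)))
    have hFc : ContinuousOn F (Icc 0 T) :=
      ((linOp β η).continuous.comp_continuousOn hGc).sub
        (((J 1).continuous.comp (mulOp _).continuous).comp_continuousOn
          (hbc.comp_continuousOn hGc))
    have hFnc : ∀ n, ContinuousOn (Fn n) (Icc 0 T) := fun n =>
      ((linOp β η).continuous.comp_continuousOn (hg n).evol.cont).sub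
        (((J 1).continuous.comp (mulOp _).continuous).comp_continuousOn
          (hbc.comp_continuousOn (hg n).evol.cont))
    have hlim : ∀ t ∈ Icc (0 : ℝ) T, Tendsto (fun n => Fn n t) atTop (𝓝 (F t)) := by
      intro t ht
      refine (((linOp β η).continuous.tendsto _).comp (hG t ht)).sub ?_
      rw [mulOp_one]
      have hB : Tendsto (fun n => bil s hs (g n t) (g n t)) atTop (𝓝 (bil s hs (G t) (G t))) :=
        (hbc.tendsto _).comp (hG t ht)
      set B := bil s hs (G t) (G t)
      rw [tendsto_iff_norm_sub_tendsto_zero]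
      have hz : Tendsto (fun n : ℕ => ‖bil s hs (g n t) (g n t) - B‖ + wt (-1) n * ‖B‖) atTop
          (𝓝 0) := by
        have := (tendsto_iff_norm_sub_tendsto_zero.mp hB).add
          ((tendsto_wt_neg (r := 1) one_pos).mul_const ‖B‖)
        simpa using this
      refine squeeze_zero (fun _ => norm_nonneg _) (fun n => ?_) hz
      have e : J 1 (mulOp (lowSym n fun _ => 1) (bil s hs (g n t) (g n t))) - J 1 B
          = J 1 (mulOp (lowSym n fun _ => 1) (bil s hs (g n t) (g n t) - B))
            + J 1 (mulOp (lowSym n fun _ => 1) B - B) := by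
        simp only [map_sub]; abel
      rw [e]
      exact (norm_add_le _ _).trans (add_le_add ((hJ _).trans (norm_low_one_le _ _))
        (norm_J_one_low_sub_le (Nat.cast_nonneg n) B))
    have hbound : ∀ n, ∀ t ∈ Icc (0 : ℝ) T, ‖Fn n t‖ ≤ ‖linOp β η‖ * (2 * R)
        + (bilK s).toReal * (2 * R) * (2 * R) := by
      intro n t ht
      have hgn := (hg n).bound t ht
      refine (norm_sub_le _ _).trans (add_le_add ?_ ?_)
      · exact ((linOp β η).le_opNorm _).trans (by gcongr)
      · exact ((hJ _).trans (norm_low_one_le _ _)).trans ((norm_bil_le hs _ _).trans (by gcongr))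
    refine hasDerivWithinAt_of_integral_eq hFc fun t ht => ?_
    have hsub : uIoc 0 t ⊆ Icc 0 T := by
      rw [uIoc_of_le ht.1]
      exact Ioc_subset_Icc_self.trans (Icc_subset_Icc_right ht.2)
    have hint : Tendsto (fun n => ∫ τ in (0 : ℝ)..t, Fn n τ) atTop
        (𝓝 (∫ τ in (0 : ℝ)..t, F τ)) := by
      refine intervalIntegral.tendsto_integral_filter_of_dominated_convergence
        (fun _ => ‖linOp β η‖ * (2 * R) + (bilK s).toReal * (2 * R) * (2 * R))
        (Eventually.of_forall fun n => ?_) (Eventually.of_forall fun n => ?_)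
        intervalIntegrable_const ?_
      · exact ((hFnc n).mono hsub).aestronglyMeasurable measurableSet_uIoc
      · exact ae_of_all _ fun τ hτ => hbound n τ (hsub hτ)
      · exact ae_of_all _ fun τ hτ => hlim τ (hsub hτ)
    have hl : Tendsto (fun n => J 2 (g n t)) atTop (𝓝 (J 2 (G t))) :=
      ((J 2).continuous.tendsto _).comp (hG t ht)
    have hl0 : Tendsto (fun n => J 2 (g n 0)) atTop (𝓝 (J 2 (G 0))) :=
      ((J 2).continuous.tendsto _).comp (hG 0 h0T)
    refine tendsto_nhds_unique hl ((hl0.add hint).congr fun n => ?_)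
    exact (integral_eq_of_hasDerivWithinAt (hFnc n) (hg n).evol.deriv t ht).symm
  · rw [mulOp_one]
    apply J_injective (r := 1) zero_le_one
    have hl0 : Tendsto (fun n => J 1 (g n 0)) atTop (𝓝 (J 1 (G 0))) :=
      ((J 1).continuous.tendsto _).comp (hG 0 h0T)
    refine tendsto_nhds_unique hl0 ?_
    rw [tendsto_iff_norm_sub_tendsto_zero]
    refine squeeze_zero (fun _ => norm_nonneg _) (fun n => ?_)
      (by simpa using (tendsto_wt_neg (r := 1) one_pos).mul_const ‖φ‖)
    rw [(hg n).init, ← map_sub]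
    exact norm_J_one_low_sub_le (Nat.cast_nonneg n) φ
  · rw [← refl_eq_iff]
    refine tendsto_nhds_unique ((refl.continuous.tendsto _).comp (hG t ht))
      ((hG t ht).congr fun n => ?_)
    exact ((refl_eq_iff _).mpr ((hg n).herm t ht)).symm
  · exact le_of_tendsto (((tailOp N).continuous.tendsto _).comp (hG t ht)).norm
      (Eventually.of_forall fun n => (hg n).tail N hN t ht)

/-! ### Fourier transforms of elements of `H^r` -/

/-- The Fourier transform of the tempered distribution `T` is the locally integrable function `h`,
whose products with all Schwartz functions are integrable. -/
structure HasHat (T : 𝓢'(ℝ, ℂ)) (h : ℝ → ℂ) : Prop where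
  locallyIntegrable : LocallyIntegrable h
  integrable : ∀ ψ : 𝓢(ℝ, ℂ), Integrable (fun ξ => h ξ * ψ ξ)
  eq : ∀ ψ : 𝓢(ℝ, ℂ), 𝓕 T ψ = ∫ ξ, h ξ * ψ ξ

lemma ae_eq_of_integral_schwartz_eq {h h' : ℝ → ℂ} (hl : LocallyIntegrable h)
    (hl' : LocallyIntegrable h')
    (H : ∀ ψ : 𝓢(ℝ, ℂ), ∫ ξ, h ξ * ψ ξ = ∫ ξ, h' ξ * ψ ξ) : h =ᵐ[volume] h' := by
  refine ae_eq_of_integral_contDiff_smul_eq hl hl' fun g hg hc => ?_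
  have hc' : HasCompactSupport (Complex.ofRealCLM ∘ g) := hc.comp_left rfl
  have hg' : ContDiff ℝ ((⊤ : ℕ∞) : WithTop ℕ∞) (Complex.ofRealCLM ∘ g) := by fun_prop
  have := H (hc'.toSchwartzMap hg')
  simpa [mul_comm] using this

namespace HasHat

variable {T T' : 𝓢'(ℝ, ℂ)} {h h' : ℝ → ℂ}

lemma ae_eq (H : HasHat T h) (H' : HasHat T h') : h =ᵐ[volume] h' :=
  ae_eq_of_integral_schwartz_eq H.locallyIntegrable H'.locallyIntegrable fun ψ => by
    rw [← H.eq, ← H'.eq]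

lemma dist_eq (H : HasHat T h) (H' : HasHat T' h') (e : h =ᵐ[volume] h') : T = T' := by
  have : 𝓕 T = 𝓕 T' := by
    ext ψ
    rw [H.eq, H'.eq]
    refine integral_congr_ae ?_
    filter_upwards [e] with ξ e
    rw [e]
  calc T = 𝓕⁻ (𝓕 T) := (fourierInv_fourier_eq T).symm
    _ = 𝓕⁻ (𝓕 T') := by rw [this]
    _ = T' := fourierInv_fourier_eq T'

lemma congr (H : HasHat T h) (e : h =ᵐ[volume] h') : HasHat T h' := by
  have e2 : ∀ ψ : 𝓢(ℝ, ℂ), (fun ξ => h ξ * ψ ξ) =ᵐ[volume] fun ξ => h' ξ * ψ ξ := fun ψ => by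
    filter_upwards [e] with ξ e
    rw [e]
  refine ⟨fun x => (H.locallyIntegrable x).congr e, fun ψ => (H.integrable ψ).congr (e2 ψ),
    fun ψ => ?_⟩
  rw [H.eq, integral_congr_ae (e2 ψ)]

lemma add (H : HasHat T h) (H' : HasHat T' h') : HasHat (T + T') (fun ξ => h ξ + h' ξ) where
  locallyIntegrable := H.locallyIntegrable.add H'.locallyIntegrable
  integrable ψ := by
    simp only [add_mul]
    exact (H.integrable ψ).add (H'.integrable ψ)
  eq ψ := by
    simp only [add_mul]
    rw [integral_add (H.integrable ψ) (H'.integrable ψ), FourierTransform.fourier_add, ← H.eq,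
      ← H'.eq]
    rfl

lemma smul (H : HasHat T h) (c : ℂ) : HasHat (c • T) (fun ξ => c * h ξ) where
  locallyIntegrable := H.locallyIntegrable.smul c
  integrable ψ := by simpa only [mul_assoc] using (H.integrable ψ).const_mul c
  eq ψ := by
    simp only [mul_assoc]
    rw [integral_const_mul, ← H.eq, FourierTransform.fourier_smul]
    rfl

lemma sub (H : HasHat T h) (H' : HasHat T' h') : HasHat (T - T') (fun ξ => h ξ - h' ξ) := by
  have := H.add (H'.smul (-1))
  have e : T + (-1 : ℂ) • T' = T - T' := by
    ext ψ
    change T ψ + (-1 : ℂ) • T' ψ = T ψ - T' ψ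
    rw [neg_one_smul, sub_eq_add_neg]
  rw [e] at this
  simpa only [neg_one_mul, ← sub_eq_add_neg] using this

/-- Fourier multipliers with smooth symbols of tempered growth act by multiplication. -/
lemma of_smulLeft (H : HasHat T h) {m : ℝ → ℂ} (hm : m.HasTemperateGrowth) (hmc : Continuous m)
    (e : 𝓕 T' = smulLeftCLM ℂ m (𝓕 T)) : HasHat T' (fun ξ => m ξ * h ξ) := by
  have e1 : ∀ ψ : 𝓢(ℝ, ℂ), (fun ξ => m ξ * h ξ * ψ ξ)
      = fun ξ => h ξ * SchwartzMap.smulLeftCLM ℂ m ψ ξ := by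
    intro ψ
    ext ξ
    rw [SchwartzMap.smulLeftCLM_apply_apply hm, smul_eq_mul]
    ring
  refine ⟨H.locallyIntegrable.continuous_mul hmc, fun ψ => ?_, fun ψ => ?_⟩
  · rw [e1]
    exact H.integrable _
  · rw [e1, e, smulLeftCLM_apply_apply, H.eq]

lemma besselPotential (H : HasHat T h) (r : ℝ) :
    HasHat (TemperedDistribution.besselPotential ℝ ℂ r T) (fun ξ => (wt r ξ : ℂ) * h ξ) := by
  have e : (fun ξ : ℝ => (wt r ξ : ℂ)) = fun x : ℝ => (((1 + ‖x‖ ^ 2) ^ (r / 2) : ℝ) : ℂ) := by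
    ext ξ
    rw [wt, Real.norm_eq_abs, sq_abs]
  refine H.of_smulLeft (m := fun ξ => (wt r ξ : ℂ)) ?_
    (Complex.continuous_ofReal.comp (continuous_wt r)) ?_
  · rw [e]
    fun_prop
  · rw [e]
    exact fourier_besselPotential_eq_smulLeftCLM_fourier_apply r T

lemma lineDeriv (H : HasHat T h) : HasHat (∂_{(1 : ℝ)} T) (dsym h) := by
  have e : dsym h = fun ξ : ℝ => (2 * Real.pi * Complex.I * ξ : ℂ) * h ξ := rfl
  have hm : (fun ξ : ℝ => ((inner ℝ ξ (1 : ℝ) : ℝ) : ℂ)).HasTemperateGrowth := by fun_prop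
  rw [e]
  refine H.of_smulLeft (m := fun ξ : ℝ => (2 * Real.pi * Complex.I * ξ : ℂ)) ?_ (by fun_prop) ?_
  · have : (fun ξ : ℝ => (2 * Real.pi * Complex.I * ξ : ℂ))
        = (2 * Real.pi * Complex.I) • fun ξ : ℝ => ((inner ℝ ξ (1 : ℝ) : ℝ) : ℂ) := by
      ext ξ; simp
    rw [this]
    fun_prop
  · have : (fun ξ : ℝ => (2 * Real.pi * Complex.I * ξ : ℂ))
        = (2 * Real.pi * Complex.I) • fun ξ : ℝ => ((inner ℝ ξ (1 : ℝ) : ℝ) : ℂ) := by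
      ext ξ; simp
    rw [this, fourier_lineDerivOp_eq, smulLeftCLM_smul hm]
    rfl

end HasHat

lemma integrable_L2_mul_schwartz (g : L2) (ψ : 𝓢(ℝ, ℂ)) : Integrable (fun ξ => g ξ * ψ ξ) :=
  (Lp.memLp g).integrable_mul (ψ.memLp 2)

lemma hasHat_L2 (g : L2) : HasHat (g : 𝓢'(ℝ, ℂ)) (𝓕 g : L2) where
  locallyIntegrable := (Lp.memLp _).locallyIntegrable one_le_two
  integrable := integrable_L2_mul_schwartz _
  eq ψ := by
    rw [Lp.fourier_toTemperedDistribution_eq, Lp.toTemperedDistribution_apply]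
    simp [mul_comm]

/-- The weighted Fourier transform `f ↦ (1 + |ξ|²)^{r/2} 𝓕 f`, an isometry of `H^r` onto `L²`. -/
def wF (r : ℝ) : Hs r ≃ₗᵢ[ℂ] L2 := (Hs.toL2Isometry r).trans (Lp.fourierTransformₗᵢ ℝ ℂ)

lemma wF_eq {r : ℝ} (f : Hs r) : wF r f = 𝓕 (Hs.toL2 r f) := rfl

/-- The Fourier transform of an element of `H^r`, `r ∈ ℝ`, is a function. -/
lemma hasHat_dist {r : ℝ} (f : Hs r) : HasHat f.dist (fh r (wF r f)) := by
  have h := (hasHat_L2 (Hs.toL2 r f)).besselPotential (-r)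
  rwa [← Hs.besselPotential_dist, besselPotential_besselPotential_apply, add_neg_cancel,
    besselPotential_zero] at h

lemma eq_of_fh_eq {r : ℝ} {x y : L2} (h : fh r x =ᵐ[volume] fh r y) : x = y := by
  apply Lp.ext
  filter_upwards [h] with ξ h
  exact mul_left_cancel₀ (by exact_mod_cast (wt_pos (-r) ξ).ne') h

lemma wF_eq_of_hasHat {r : ℝ} {f : Hs r} {x : L2} (h : HasHat f.dist (fh r x)) : wF r f = x :=
  eq_of_fh_eq ((hasHat_dist f).ae_eq h)

lemma wF_incl {r s : ℝ} (h : r ≤ s) (f : Hs s) : wF r (f.incl h) = J (s - r) (wF s f) := by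
  have e : (f.incl h).dist = f.dist := by rw [Hs.incl, Hs.dist_mk]
  refine wF_eq_of_hasHat ?_
  rw [e]
  refine (hasHat_dist f).congr ?_
  filter_upwards [J_coe (sub_nonneg.mpr h) (wF s f)] with ξ e
  rw [fh, fh, e, fh, ← mul_assoc, ← Complex.ofReal_mul, ← wt_add]
  congr 3
  ring

lemma hasHat_deriv {r : ℝ} (f : Hs r) : HasHat f.deriv.dist (dsym (fh r (wF r f))) :=
  (hasHat_dist f).lineDeriv

lemma wF_multiplier {m : ℝ → ℂ} (hm : BddMeas m) {r : ℝ} (f : Hs r) :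
    wF r (f.multiplier m) = mulOp m (wF r f) := by
  have hm' : MemLp m ∞ (volume : Measure ℝ) := hm.memLp
  rw [wF_eq, Hs.multiplier, dif_pos hm', LinearEquiv.apply_symm_apply,
    FourierTransform.fourier_fourierInv_eq]
  apply Lp.ext
  filter_upwards [Lp.coeFn_lpSMul (p := ∞) (q := 2) (r := 2) (hm'.toLp m)
    (𝓕 (Hs.toL2 r f) : L2), hm'.coeFn_toLp, mulOp_coe hm (wF r f)] with ξ h1 h2 h3
  rw [h1, h3, Pi.smul_apply', h2, smul_eq_mul, wF_eq]

lemma hasHat_multiplier {m : ℝ → ℂ} (hm : BddMeas m) {r : ℝ} (f : Hs r) {h : ℝ → ℂ}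
    (hf : HasHat f.dist h) : HasHat (f.multiplier m).dist (fun ξ => m ξ * h ξ) := by
  refine (hasHat_dist (f.multiplier m)).congr ?_
  rw [wF_multiplier hm]
  filter_upwards [mulOp_coe hm (wF r f), (hasHat_dist f).ae_eq hf] with ξ e1 e2
  rw [← e2, fh, fh, e1]
  ring

/-! ### Real-valued elements of `H^r` -/

/-- The complex conjugate of a Schwartz function. -/
def conjS (ψ : 𝓢(ℝ, ℂ)) : 𝓢(ℝ, ℂ) :=
  SchwartzMap.postcompCLM (𝕜 := ℝ) (Complex.conjCLE : ℂ →L[ℝ] ℂ) ψ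

lemma conjS_apply (ψ : 𝓢(ℝ, ℂ)) (x : ℝ) : conjS ψ x = (starRingEnd ℂ) (ψ x) := rfl

/-- The function `ξ ↦ conj (χ (-ξ))`, whose Fourier transform is the complex conjugate of that of
`χ`. -/
def starS (χ : 𝓢(ℝ, ℂ)) : 𝓢(ℝ, ℂ) :=
  SchwartzMap.compCLMOfContinuousLinearEquiv ℝ (ContinuousLinearEquiv.neg ℝ) (conjS χ)

lemma starS_apply (χ : 𝓢(ℝ, ℂ)) (x : ℝ) : starS χ x = (starRingEnd ℂ) (χ (-x)) := rfl

lemma fourier_starS (χ : 𝓢(ℝ, ℂ)) : 𝓕 (starS χ) = conjS (𝓕 χ) := by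
  ext w
  rw [conjS_apply, SchwartzMap.fourier_coe, SchwartzMap.fourier_coe,
    Real.fourier_real_eq_integral_exp_smul, Real.fourier_real_eq_integral_exp_smul,
    ← integral_conj, ← integral_neg_eq_self]
  refine integral_congr_ae (ae_of_all _ fun v => ?_)
  simp only [starS_apply, neg_neg, smul_eq_mul, map_mul, ← Complex.exp_conj, Complex.conj_I,
    Complex.conj_ofReal]
  congr 2
  push_cast
  ring

/-- A distribution is real-valued if and only if it commutes with complex conjugation. -/
lemma isReal_iff_dist_conjS {r : ℝ} (f : Hs r) :
    f.IsReal ↔ ∀ ψ, f.dist (conjS ψ) = (starRingEnd ℂ) (f.dist ψ) := by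
  constructor
  · intro hf ψ
    have h1 := hf (ψ + conjS ψ) fun x => by
      rw [add_apply, conjS_apply]; simp
    have h2 := hf (Complex.I • (ψ - conjS ψ)) fun x => by
      rw [smul_apply, sub_apply, conjS_apply]; simp
    rw [map_add, Complex.add_im] at h1
    rw [map_smul, map_sub, smul_eq_mul, Complex.mul_im] at h2
    simp only [Complex.I_re, Complex.I_im, Complex.sub_re, zero_mul, one_mul, zero_add] at h2
    apply Complex.ext
    · rw [Complex.conj_re]; linarith
    · rw [Complex.conj_im]; linarith
  · intro hf ψ hψ
    have : conjS ψ = ψ := by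
      ext x
      rw [conjS_apply, Complex.conj_eq_iff_im, hψ x]
    have h := hf ψ
    rw [this] at h
    exact Complex.conj_eq_iff_im.mp h.symm

/-- `refl` corresponds to the complex conjugation of distributions. -/
lemma dist_wF_symm_refl {r : ℝ} (f : Hs r) (ψ : 𝓢(ℝ, ℂ)) :
    ((wF r).symm (refl (wF r f))).dist ψ = (starRingEnd ℂ) (f.dist (conjS ψ)) := by
  obtain ⟨χ, rfl⟩ : ∃ χ : 𝓢(ℝ, ℂ), 𝓕 χ = ψ := ⟨𝓕⁻ ψ, FourierTransform.fourier_fourierInv_eq ψ⟩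
  rw [← fourier_starS, ← TemperedDistribution.fourier_apply, ← TemperedDistribution.fourier_apply,
    (hasHat_dist _).eq, (hasHat_dist f).eq, ← integral_conj,
    LinearIsometryEquiv.apply_symm_apply, ← integral_neg_eq_self]
  refine integral_congr_ae ?_
  filter_upwards [ae_neg (refl_coe (wF r f))] with ξ h
  rw [fh, h, neg_neg, fh, starS_apply, wt_even]
  simp

lemma isReal_iff_herm {r : ℝ} (f : Hs r) : f.IsReal ↔ Herm (wF r f) := by
  rw [isReal_iff_dist_conjS, ← refl_eq_iff]
  have h : refl (wF r f) = wF r f ↔ (wF r).symm (refl (wF r f)) = f := by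
    rw [LinearIsometryEquiv.symm_apply_eq]
  rw [h]
  constructor
  · intro H
    apply Hs.ext
    ext ψ
    rw [dist_wF_symm_refl, H, Complex.conj_conj]
  · intro H ψ
    have := dist_wF_symm_refl f ψ
    rw [H] at this
    rw [this, Complex.conj_conj]

/-! ### Products and convolutions -/

lemma integral_fourierInv_mul_schwartz {a : ℝ → ℂ} (ha : Integrable a) (ψ : 𝓢(ℝ, ℂ)) :
    ∫ x, 𝓕⁻ a x * ψ x = ∫ ξ, a ξ * 𝓕⁻ ψ ξ := by
  have := VectorFourier.integral_fourierIntegral_smul_eq_flip (L := -innerₗ ℝ)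
    (μ := volume) (ν := volume) Real.continuous_fourierChar
    (by simp only [LinearMap.neg_apply, innerₗ_apply_apply]; fun_prop) ha ψ.integrable
  have e : (-innerₗ ℝ).flip = -innerₗ ℝ := by
    ext; simp
  rw [e] at this
  rw [SchwartzMap.fourierInv_coe]
  exact this

lemma continuous_fourierInv {a : ℝ → ℂ} (ha : Integrable a) : Continuous (𝓕⁻ a) := by
  have : Continuous (VectorFourier.fourierIntegral Real.fourierChar volume (-innerₗ ℝ) a) :=
    VectorFourier.fourierIntegral_continuous Real.continuous_fourierChar
      (by simp only [LinearMap.neg_apply, innerₗ_apply_apply]; fun_prop) ha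
  exact this

/-- An `L²` function with integrable Fourier transform is given by the Fourier inversion formula. -/
lemma ae_eq_fourierInv {F : L2} {a : ℝ → ℂ} (h : HasHat (F : 𝓢'(ℝ, ℂ)) a) (ha : Integrable a) :
    F =ᵐ[volume] 𝓕⁻ a := by
  refine ae_eq_of_integral_schwartz_eq ((Lp.memLp F).locallyIntegrable one_le_two)
    (continuous_fourierInv ha).locallyIntegrable fun ψ => ?_
  rw [integral_fourierInv_mul_schwartz ha, ← h.eq, TemperedDistribution.fourier_apply,
    FourierTransform.fourier_fourierInv_eq, Lp.toTemperedDistribution_apply]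
  simp [mul_comm]

lemma exists_L2_of_hasHat {T : 𝓢'(ℝ, ℂ)} {a : ℝ → ℂ} (h : HasHat T a)
    (ha : MemLp a 2 volume) : ∃ F : L2, T = (F : 𝓢'(ℝ, ℂ)) := by
  refine ⟨𝓕⁻ (ha.toLp a), h.dist_eq (hasHat_L2 _) ?_⟩
  rw [FourierTransform.fourier_fourierInv_eq]
  exact ha.coeFn_toLp.symm

lemma mul_fourierInv_eq {a b : ℝ → ℂ} (ha : Integrable a) (hb : Integrable b) (x : ℝ) :
    𝓕⁻ a x * 𝓕⁻ b x = 𝓕⁻ (cv a b) x := by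
  have h := Real.fourier_mul_convolution_eq hb ha (-x)
  have e : (convolution b a (ContinuousLinearMap.mul ℂ ℂ) volume) = cv a b := by
    ext ξ
    simp only [convolution, cv, ContinuousLinearMap.mul_apply', mul_comm]
  rw [e] at h
  rw [Real.fourierInv_eq_fourier_neg, Real.fourierInv_eq_fourier_neg,
    Real.fourierInv_eq_fourier_neg, h, mul_comm]

lemma integrable_cv_self {a b : ℝ → ℂ} (ha : Integrable a) (hb : Integrable b) :
    Integrable (cv a b) := by
  have e : (convolution b a (ContinuousLinearMap.mul ℂ ℂ) volume) = cv a b := by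
    ext ξ
    simp only [convolution, cv, ContinuousLinearMap.mul_apply', mul_comm]
  rw [← e]
  exact hb.integrable_convolution _ ha

/-- The Fourier transform of a product is the convolution of the Fourier transforms. -/
theorem hasHat_mulDist {f g : 𝓢'(ℝ, ℂ)} {a b : ℝ → ℂ} (hf : HasHat f a) (hg : HasHat g b)
    (ha : Integrable a) (hb : Integrable b) (ha2 : MemLp a 2 volume) (hb2 : MemLp b 2 volume) :
    HasHat (mulDist f g) (cv a b) := by
  have hc := integrable_cv_self ha hb
  refine ⟨hc.locallyIntegrable, fun ψ => ?_, fun ψ => ?_⟩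
  · exact hc.mul_bdd ψ.continuous.aestronglyMeasurable
      (ae_of_all _ fun x => ψ.norm_le_seminorm ℝ x)
  · have h : (∃ F : L2, f = (F : 𝓢'(ℝ, ℂ))) ∧ (∃ G : L2, g = (G : 𝓢'(ℝ, ℂ))) :=
      ⟨exists_L2_of_hasHat hf ha2, exists_L2_of_hasHat hg hb2⟩
    rw [TemperedDistribution.fourier_apply, mulDist, dif_pos h, Lp.toTemperedDistribution_apply]
    have hF := h.1.choose_spec
    have hG := h.2.choose_spec
    set F := h.1.choose
    set G := h.2.choose
    rw [hF] at hf
    rw [hG] at hg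
    have e : ∫ ξ, cv a b ξ * ψ ξ = ∫ x, 𝓕⁻ (cv a b) x * 𝓕 ψ x := by
      rw [integral_fourierInv_mul_schwartz hc, FourierTransform.fourierInv_fourier_eq]
    rw [e]
    refine integral_congr_ae ?_
    filter_upwards [Lp.coeFn_lpSMul (p := 2) (q := 2) (r := 1) F G, ae_eq_fourierInv hf ha,
      ae_eq_fourierInv hg hb] with x h1 h2 h3
    rw [h1, Pi.smul_apply', h2, h3, smul_eq_mul, smul_eq_mul, mul_fourierInv_eq ha hb, mul_comm]

/-- The product `u u_x` in terms of weighted Fourier transforms. -/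
lemma dist_eq_mulDist_iff {s : ℝ} (hs : 3 / 2 < s) (u : Hs s) (N : Hs (s - 1)) :
    N.dist = mulDist u.dist u.deriv.dist ↔ wF (s - 1) N = bil s hs (wF s u) (wF s u) := by
  set g := wF s u with hg
  have hm : HasHat (mulDist u.dist u.deriv.dist) (cv (fh s g) (dsym (fh s g))) :=
    hasHat_mulDist (hasHat_dist u) (hasHat_deriv u) (integrable_fh hs g) (integrable_dsym_fh hs g)
      (memLp_fh (by linarith) g) (memLp_dsym_fh (by linarith) g)
  have e : cv (fh s g) (dsym (fh s g)) =ᵐ[volume] fh (s - 1) (bil s hs g g) := by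
    filter_upwards [bil_coe hs g g] with ξ h
    rw [fh, h, bilFun, ← mul_assoc, ← Complex.ofReal_mul, wt_neg_mul_self, Complex.ofReal_one,
      one_mul]
  constructor
  · intro h
    refine wF_eq_of_hasHat ?_
    rw [h]
    exact hm.congr e
  · intro h
    have hN := hasHat_dist N
    rw [h] at hN
    exact hN.dist_eq hm e.symm

/-! ### The semigroup and the integral equation -/

/-- The symbol of the semigroup at time `t`. For `η > 0` it is bounded for `t ≥ 0` only. -/
def expSym (β η t ξ : ℝ) : ℂ := Complex.exp (t * asym β η ξ)

lemma continuous_expSym (β η t : ℝ) : Continuous (expSym β η t) := by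
  have := continuous_asym β η
  unfold expSym
  fun_prop

lemma expSym_add (β η t t' ξ : ℝ) : expSym β η (t + t') ξ = expSym β η t ξ * expSym β η t' ξ := by
  rw [expSym, expSym, expSym, ← Complex.exp_add]
  push_cast
  ring_nf

lemma norm_expSym_le {η : ℝ} (h0 : 0 ≤ η) (h1 : η ≤ 1) (β : ℝ) {t : ℝ} (ht : 0 ≤ t) (ξ : ℝ) :
    ‖expSym β η t ξ‖ ≤ Real.exp (t / 4) := by
  rw [expSym, Complex.norm_exp, Complex.re_ofReal_mul]
  have := mul_le_mul_of_nonneg_left (re_asym_le h0 h1 β ξ) ht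
  exact Real.exp_le_exp.mpr (by linarith)

lemma bddMeas_expSym {η : ℝ} (h0 : 0 ≤ η) (h1 : η ≤ 1) (β : ℝ) {t : ℝ} (ht : 0 ≤ t) :
    BddMeas (expSym β η t) :=
  ⟨(continuous_expSym β η t).measurable, _, norm_expSym_le h0 h1 β ht⟩

/-- The projection to the frequencies `|ξ| ≤ n`. -/
def lowP (n : ℝ) : L2 →L[ℂ] L2 := mulOp (lowSym n fun _ => 1)

/-- The group generated by the linear equation, on the frequencies `|ξ| ≤ n`. -/
def lowE (β η n t : ℝ) : L2 →L[ℂ] L2 := mulOp (lowSym n (expSym β η t))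

lemma lowSym_mulOp {n : ℝ} {m m' m'' : ℝ → ℂ} (hm : Continuous m) (hm' : BddMeas m')
    (e : ∀ ξ, m ξ * m' ξ = m'' ξ) (x : L2) :
    mulOp (lowSym n m) (mulOp m' x) = mulOp (lowSym n m'') x := by
  rw [mulOp_mulOp (bddMeas_lowSym n hm) hm']
  congr 2
  ext ξ
  rcases le_or_gt |ξ| n with h | h
  · rw [lowSym_of_le h, lowSym_of_le h, e]
  · rw [lowSym_of_lt h, lowSym_of_lt h, zero_mul]

lemma lowSym_lowSym {n : ℝ} {m m' m'' : ℝ → ℂ} (hm : Continuous m) (hm' : Continuous m')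
    (e : ∀ ξ, m ξ * m' ξ = m'' ξ) (x : L2) :
    mulOp (lowSym n m) (mulOp (lowSym n m') x) = mulOp (lowSym n m'') x := by
  rw [mulOp_mulOp (bddMeas_lowSym n hm) (bddMeas_lowSym n hm')]
  congr 2
  ext ξ
  rcases le_or_gt |ξ| n with h | h
  · rw [lowSym_of_le h, lowSym_of_le h, lowSym_of_le h, e]
  · rw [lowSym_of_lt h, lowSym_of_lt h, lowSym_of_lt h, zero_mul]

lemma lowE_lowE (β η n t t' : ℝ) (x : L2) :
    lowE β η n t (lowE β η n t' x) = lowE β η n (t + t') x :=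
  lowSym_lowSym (continuous_expSym _ _ _) (continuous_expSym _ _ _)
    (fun ξ => (expSym_add β η t t' ξ).symm) x

lemma lowE_zero (β η n : ℝ) (x : L2) : lowE β η n 0 x = lowP n x := by
  have : expSym β η 0 = fun _ => 1 := by ext ξ; simp [expSym]
  rw [lowE, this, lowP]

lemma lowP_expSym {η : ℝ} (h0 : 0 ≤ η) (h1 : η ≤ 1) (β : ℝ) {t : ℝ} (ht : 0 ≤ t) (n : ℝ) (x : L2) :
    lowP n (mulOp (expSym β η t) x) = lowE β η n t x :=
  lowSym_mulOp continuous_const (bddMeas_expSym h0 h1 β ht) (fun _ => one_mul _) x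

lemma norm_lowP_sub_le {N : ℝ} (hN : 0 < N) (x : L2) : ‖lowP N x - x‖ ≤ ‖tailOp N x‖ := by
  have h : ∀ᵐ ξ, ‖(lowP N x - x) ξ‖ ≤ ‖(tailOp N x) ξ‖ := by
    filter_upwards [Lp.coeFn_sub (lowP N x) x, mulOp_coe (bddMeas_low_one N) x,
      mulOp_coe (bddMeas_tailWt hN) x] with ξ h1 h2 h3
    rw [h1, Pi.sub_apply, lowP, h2, tailOp, h3]
    rcases le_or_gt |ξ| N with h | h
    · rw [lowSym_of_le h, one_mul, sub_self, norm_zero]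
      exact norm_nonneg _
    · have : tailWt N ξ = 1 :=
        min_eq_left ((one_le_div hN).mpr (h.le.trans (abs_le_wt_one ξ)))
      rw [lowSym_of_lt h, zero_mul, zero_sub, norm_neg, this, Complex.ofReal_one, one_mul]
  exact Lp.norm_le_norm_of_ae_le h

lemma tendsto_lowP (x : L2) : Tendsto (fun n : ℕ => lowP (n + 1 : ℕ) x) atTop (𝓝 x) := by
  rw [tendsto_iff_norm_sub_tendsto_zero]
  exact squeeze_zero (fun _ => norm_nonneg _) (fun n => norm_lowP_sub_le (by positivity) x)
    (tendsto_tailOp x)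

lemma eq_of_lowP_eq {x y : L2} (h : ∀ n, lowP n x = lowP n y) : x = y :=
  tendsto_nhds_unique (tendsto_lowP x) (by simpa only [h] using tendsto_lowP y)

/-- On a bounded set of frequencies the symbol is bounded, so that the group is differentiable in
the operator norm. -/
lemma hasDerivAt_lowE (β η n t : ℝ) :
    HasDerivAt (fun t => lowE β η n t)
      (mulOp (lowSym n fun ξ => asym β η ξ * expSym β η t ξ)) t := by
  obtain ⟨K, hK⟩ := (isCompact_Icc (a := -n) (b := n)).exists_bound_of_continuousOn
    (continuous_asym β η).continuousOn
  obtain ⟨C, hC⟩ := (isCompact_Icc (a := -n) (b := n)).exists_bound_of_continuousOn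
    (continuous_expSym β η t).continuousOn
  have hda : Continuous fun ξ => asym β η ξ * expSym β η t ξ :=
    (continuous_asym β η).mul (continuous_expSym β η t)
  rw [hasDerivAt_iff_isLittleO_nhds_zero]
  have hO : (fun h : ℝ => lowE β η n (t + h) - lowE β η n t
      - h • mulOp (lowSym n fun ξ => asym β η ξ * expSym β η t ξ)) =O[𝓝 0] fun h : ℝ => h ^ 2 := by
    refine Asymptotics.IsBigO.of_bound (|C| * |K| ^ 2) ?_
    have hball : ∀ᶠ h : ℝ in 𝓝 0, |h| * |K| < 1 := by
      have : Tendsto (fun h : ℝ => |h| * |K|) (𝓝 0) (𝓝 (|0| * |K|)) :=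
        (Continuous.tendsto (by fun_prop) 0)
      exact this.eventually_lt_const (by simp)
    filter_upwards [hball] with h hh
    rw [Real.norm_of_nonneg (sq_nonneg h)]
    refine ContinuousLinearMap.opNorm_le_bound _ (by positivity) fun x => L2_norm_le_of_ae ?_
    have e : (lowE β η n (t + h) - lowE β η n t
        - h • mulOp (lowSym n fun ξ => asym β η ξ * expSym β η t ξ)) x
        = lowE β η n (t + h) x - lowE β η n t x
          - (h : ℂ) • mulOp (lowSym n fun ξ => asym β η ξ * expSym β η t ξ) x := by
      rw [sub_apply, sub_apply, smul_apply]
      congr 1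
    rw [e]
    filter_upwards [mulOp_coe (bddMeas_lowSym n (continuous_expSym β η (t + h))) x,
      mulOp_coe (bddMeas_lowSym n (continuous_expSym β η t)) x,
      mulOp_coe (bddMeas_lowSym n hda) x,
      Lp.coeFn_sub (lowE β η n (t + h) x - lowE β η n t x)
        ((h : ℂ) • mulOp (lowSym n fun ξ => asym β η ξ * expSym β η t ξ) x),
      Lp.coeFn_sub (lowE β η n (t + h) x) (lowE β η n t x),
      Lp.coeFn_smul (h : ℂ) (mulOp (lowSym n fun ξ => asym β η ξ * expSym β η t ξ) x)]
      with ξ e1 e2 e3 e4 e5 e6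
    rw [e4, Pi.sub_apply, e5, Pi.sub_apply, e6, Pi.smul_apply, lowE, e1, lowE, e2, e3, smul_eq_mul]
    rcases le_or_gt |ξ| n with hξ | hξ
    · rw [lowSym_of_le hξ, lowSym_of_le hξ, lowSym_of_le hξ, expSym_add]
      have hξ' : ξ ∈ Icc (-n) n := by rwa [mem_Icc, ← abs_le]
      have k1 : ‖asym β η ξ‖ ≤ |K| := (hK ξ hξ').trans (le_abs_self K)
      have k2 : ‖expSym β η t ξ‖ ≤ |C| := (hC ξ hξ').trans (le_abs_self C)
      have e7 : expSym β η t ξ * expSym β η h ξ * x ξ - expSym β η t ξ * x ξ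
          - h * (asym β η ξ * expSym β η t ξ * x ξ)
          = expSym β η t ξ * (Complex.exp (h * asym β η ξ) - 1 - h * asym β η ξ) * x ξ := by
        rw [expSym, expSym]
        ring
      rw [e7, norm_mul, norm_mul]
      have k3 : ‖(h : ℂ) * asym β η ξ‖ ≤ |h| * |K| := by
        rw [norm_mul, Complex.norm_real, Real.norm_eq_abs]
        gcongr
      have k4 := Complex.norm_exp_sub_one_sub_id_le (k3.trans hh.le)
      have k5 : ‖(h : ℂ) * asym β η ξ‖ ^ 2 ≤ |K| ^ 2 * h ^ 2 := by
        calc ‖(h : ℂ) * asym β η ξ‖ ^ 2 ≤ (|h| * |K|) ^ 2 := by gcongr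
          _ = |K| ^ 2 * h ^ 2 := by rw [mul_pow, sq_abs h, mul_comm]
      have k6 := k4.trans k5
      calc ‖expSym β η t ξ‖ * ‖Complex.exp (h * asym β η ξ) - 1 - h * asym β η ξ‖ * ‖x ξ‖
          ≤ |C| * (|K| ^ 2 * h ^ 2) * ‖x ξ‖ := by gcongr
        _ = _ := by ring
    · rw [lowSym_of_lt hξ, lowSym_of_lt hξ, lowSym_of_lt hξ]
      simp only [zero_mul, mul_zero, sub_zero, norm_zero]
      positivity
  exact hO.trans_isLittleO (Asymptotics.isLittleO_pow_id one_lt_two)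

lemma continuous_lowE (β η n : ℝ) : Continuous fun t => lowE β η n t :=
  continuous_iff_continuousAt.mpr fun t => (hasDerivAt_lowE β η n t).continuousAt

/-- The product rule for the truncated group applied to a curve. -/
lemma hasDerivWithinAt_lowE_apply (β η n : ℝ) {y : ℝ → L2} {y' : L2} {σ : ℝ → ℝ} {σ' t : ℝ}
    {S : Set ℝ} (hσ : HasDerivWithinAt σ σ' S t) (hy : HasDerivWithinAt y y' S t) :
    HasDerivWithinAt (fun τ => lowE β η n (σ τ) (y τ))
      ((σ' : ℂ) • mulOp (lowSym n fun ξ => asym β η ξ * expSym β η (σ t) ξ) (y t)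
        + lowE β η n (σ t) y') S t := by
  have h1 := (hasDerivAt_lowE β η n (σ t)).scomp_hasDerivWithinAt t hσ
  have h2 :=
    (ContinuousLinearMap.restrictScalarsL ℂ L2 L2 ℝ ℝ).hasFDerivAt.comp_hasDerivWithinAt t h1
  have h3 := h2.clm_apply hy
  refine h3.congr_deriv ?_
  congr 1

/-- The semigroup is not continuous in the operator norm; the integrand is measurable as the limit
of its truncations to bounded frequencies. -/
lemma intervalIntegrable_expSym {η : ℝ} (h0 : 0 ≤ η) (h1 : η ≤ 1) (β : ℝ) {T : ℝ} {B : ℝ → L2}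
    (hB : ContinuousOn B (Icc 0 T)) {t : ℝ} (ht : t ∈ Icc (0 : ℝ) T) :
    IntervalIntegrable (fun τ => mulOp (expSym β η (t - τ)) (B τ)) volume 0 t := by
  have hsub : uIoc 0 t ⊆ Icc 0 T := by
    rw [uIoc_of_le ht.1]
    exact Ioc_subset_Icc_self.trans (Icc_subset_Icc_right ht.2)
  have hpos : ∀ τ ∈ uIoc 0 t, 0 ≤ t - τ := fun τ hτ => by
    rw [uIoc_of_le ht.1] at hτ
    linarith [hτ.2]
  have hmeas : MeasurableSet (uIoc (0 : ℝ) t) := measurableSet_uIoc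
  obtain ⟨M, hM⟩ := isCompact_Icc.exists_bound_of_continuousOn hB
  rw [intervalIntegrable_iff]
  have hm : AEStronglyMeasurable (fun τ => mulOp (expSym β η (t - τ)) (B τ))
      (volume.restrict (uIoc 0 t)) := by
    refine aestronglyMeasurable_of_tendsto_ae atTop
      (f := fun (n : ℕ) τ => lowE β η (n + 1 : ℕ) (t - τ) (B τ)) (fun n => ?_) ?_
    · refine ContinuousOn.aestronglyMeasurable ?_ hmeas
      exact
        ((continuous_lowE β η _).comp (continuous_const.sub continuous_id)).continuousOn.clm_apply (hB.mono hsub)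
    · filter_upwards [ae_restrict_mem hmeas] with τ hτ
      simp only [← lowP_expSym h0 h1 β (hpos τ hτ)]
      exact tendsto_lowP _
  have hb : ∀ᵐ τ ∂(volume.restrict (uIoc 0 t)),
      ‖mulOp (expSym β η (t - τ)) (B τ)‖ ≤ Real.exp (t / 4) * M := by
    filter_upwards [ae_restrict_mem hmeas] with τ hτ
    refine (norm_mulOp_le (bddMeas_expSym h0 h1 β (hpos τ hτ))
      (norm_expSym_le h0 h1 β (hpos τ hτ)) _).trans ?_
    have h2 : 0 ≤ τ := by
      rw [uIoc_of_le ht.1] at hτ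
      exact hτ.1.le
    have h3 := hM τ (hsub hτ)
    gcongr
    linarith
  have : IsFiniteMeasure (volume.restrict (uIoc (0 : ℝ) t)) := ⟨by simp⟩
  exact Integrable.of_bound hm _ hb

/-- On low frequencies the semigroup in the integral is replaced by a group. -/
lemma lowP_integral_expSym {η : ℝ} (h0 : 0 ≤ η) (h1 : η ≤ 1) (β : ℝ) {T : ℝ} {B : ℝ → L2}
    (hB : ContinuousOn B (Icc 0 T)) {t : ℝ} (ht : t ∈ Icc (0 : ℝ) T) (n : ℝ) :
    lowP n (∫ τ in (0 : ℝ)..t, mulOp (expSym β η (t - τ)) (B τ))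
      = ∫ τ in (0 : ℝ)..t, lowE β η n (t - τ) (B τ) := by
  rw [← ContinuousLinearMap.intervalIntegral_comp_comm _ (intervalIntegrable_expSym h0 h1 β hB ht)]
  refine intervalIntegral.integral_congr fun τ hτ => ?_
  rw [uIcc_of_le ht.1] at hτ
  exact lowP_expSym h0 h1 β (by linarith [hτ.2]) n (B τ)

lemma J_lowE (β η n t : ℝ) {r : ℝ} (hr : 0 ≤ r) (x : L2) :
    J r (lowE β η n t x) = lowE β η n t (J r x) :=
  mulOp_comm (bddMeas_wt (by linarith)) (bddMeas_lowSym n (continuous_expSym β η t)) x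

lemma J_lowP (n : ℝ) {r : ℝ} (hr : 0 ≤ r) (x : L2) : J r (lowP n x) = lowP n (J r x) :=
  mulOp_comm (bddMeas_wt (by linarith)) (bddMeas_low_one n) x

lemma J_one_J_one (x : L2) : J 1 (J 1 x) = J 2 x := by
  rw [J, J, mulOp_mulOp (bddMeas_wt (by norm_num)) (bddMeas_wt (by norm_num))]
  congr 2
  ext ξ
  rw [← Complex.ofReal_mul, ← wt_add]
  norm_num

/-- The linear part of the equation acts on low frequencies as multiplication by its symbol. -/
lemma lowSym_asym_J (β η n : ℝ) (x : L2) :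
    mulOp (lowSym n (asym β η)) (J 2 x) = lowP n (linOp β η x) := by
  rw [J, lowSym_mulOp (continuous_asym β η) (bddMeas_wt (by norm_num))
      (m'' := fun ξ => (wt (-2) ξ : ℂ) * asym β η ξ) (fun ξ => mul_comm _ _),
    lowP, linOp, lowSym_mulOp continuous_const (bddMeas_asym β η) (fun ξ => one_mul _)]

lemma lowSym_asym_expSym (β η n t : ℝ) (x : L2) :
    mulOp (lowSym n fun ξ => asym β η ξ * expSym β η t ξ) x
      = mulOp (lowSym n (asym β η)) (lowE β η n t x) :=
  (lowSym_lowSym (continuous_asym β η) (continuous_expSym β η t) (fun _ => rfl) x).symm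

/-- The integral equation and the differential equation have the same solutions. Both directions
are checked on the frequencies `|ξ| ≤ n`, where the equation is an ordinary differential equation
with a bounded linear part. -/
theorem evol_iff_mild {s : ℝ} (hs : 3 / 2 < s) {T β η : ℝ} (hT : 0 ≤ T) (h0 : 0 ≤ η) (h1 : η ≤ 1)
    {g : ℝ → L2} (hg : ContinuousOn g (Icc 0 T)) (φ : L2) :
    (Evol s hs T β η (fun _ => 1) g ∧ g 0 = φ) ↔
      ∀ t ∈ Icc (0 : ℝ) T, J 1 (g t) = mulOp (expSym β η t) (J 1 φ)
        - ∫ τ in (0 : ℝ)..t, mulOp (expSym β η (t - τ)) (bil s hs (g τ) (g τ)) := by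
  set B : ℝ → L2 := fun τ => bil s hs (g τ) (g τ) with hBdef
  have hbc : Continuous fun x : L2 => bil s hs x x := by fun_prop
  have hB : ContinuousOn B (Icc 0 T) := hbc.comp_continuousOn hg
  have h0T : (0 : ℝ) ∈ Icc (0 : ℝ) T := ⟨le_rfl, hT⟩
  constructor
  · rintro ⟨hev, rfl⟩ t ht
    apply J_injective (r := 1) zero_le_one
    refine eq_of_lowP_eq fun n => ?_
    have hsub : Icc 0 t ⊆ Icc 0 T := Icc_subset_Icc_right ht.2
    -- the nonlinear equation in the interaction picture: the derivatives of the linear flow cancel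
    have hz : ∀ τ ∈ Icc (0 : ℝ) t, HasDerivWithinAt
        (fun τ => lowE β η n (t - τ) (J 2 (g τ)))
        (-(lowE β η n (t - τ) (J 1 (B τ)))) (Icc 0 t) τ := by
      intro τ hτ
      have h2 := hasDerivWithinAt_lowE_apply β η n
        ((hasDerivWithinAt_id τ (Icc 0 t)).const_sub t) ((hev.deriv τ (hsub hτ)).mono hsub)
      refine h2.congr_deriv ?_
      have e : mulOp (lowSym n fun ξ => asym β η ξ * expSym β η (t - τ) ξ) (J 2 (g τ))
          = lowE β η n (t - τ) (linOp β η (g τ)) := by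
        have h3 := lowSym_asym_expSym β η n (t - τ) (J 2 (g τ))
        rw [h3, lowE, mulOp_comm (bddMeas_low_asym β η n)
          (bddMeas_lowSym n (continuous_expSym β η (t - τ))), lowSym_asym_J, lowP,
          lowSym_lowSym (continuous_expSym β η (t - τ)) continuous_const (fun ξ => mul_one _)]
      simp only [id]
      rw [e, mulOp_one, map_sub]
      push_cast
      rw [neg_one_smul]
      abel
    have hc : ContinuousOn (fun τ => -(lowE β η n (t - τ) (J 1 (B τ)))) (Icc 0 t) :=
      (((continuous_lowE β η n).comp (continuous_const.sub continuous_id)).continuousOn.clm_apply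
        ((J 1).continuous.comp_continuousOn (hB.mono hsub))).neg
    have hI := integral_eq_of_hasDerivWithinAt hc hz t ⟨ht.1, le_rfl⟩
    simp only [sub_self, sub_zero, lowE_zero] at hI
    rw [J_one_J_one, hI, map_sub, map_sub, ← J_lowP n zero_le_one, ← J_lowP n zero_le_one,
      lowP_integral_expSym h0 h1 β hB ht, lowP_expSym h0 h1 β ht.1, J_lowE _ _ _ _ zero_le_one,
      J_one_J_one, intervalIntegral.integral_neg, ← sub_eq_add_neg]
    congr 1
    rw [← ContinuousLinearMap.intervalIntegral_comp_comm]
    · refine intervalIntegral.integral_congr fun τ _ => ?_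
      exact (J_lowE β η n (t - τ) zero_le_one (B τ)).symm
    · refine ContinuousOn.intervalIntegrable ?_
      rw [uIcc_of_le ht.1]
      exact
        ((continuous_lowE β η n).comp (continuous_const.sub continuous_id)).continuousOn.clm_apply (hB.mono hsub)
  · intro H
    have hinit : g 0 = φ := by
      have := H 0 h0T
      have e : expSym β η 0 = fun _ => 1 := by ext ξ; simp [expSym]
      rw [intervalIntegral.integral_same, sub_zero, e, mulOp_one] at this
      exact J_injective zero_le_one this
    refine ⟨⟨hg, ?_⟩, hinit⟩
    set F : ℝ → L2 := fun t => linOp β η (g t) - J 1 (mulOp (fun _ => 1) (B t)) with hF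
    have hFc : ContinuousOn F (Icc 0 T) :=
      ((linOp β η).continuous.comp_continuousOn hg).sub
        (((J 1).continuous.comp (mulOp _).continuous).comp_continuousOn hB)
    refine hasDerivWithinAt_of_integral_eq hFc fun t ht => ?_
    refine eq_of_lowP_eq fun n => ?_
    have hcE : ContinuousOn (fun τ => -(lowE β η n (-τ) (B τ))) (Icc 0 T) :=
      (((continuous_lowE β η n).comp continuous_neg).continuousOn.clm_apply hB).neg
    -- the solution with the linear flow removed
    set w : ℝ → L2 := fun t => J 1 φ + ∫ τ in (0 : ℝ)..t, -(lowE β η n (-τ) (B τ)) with hw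
    have hw' : ∀ t ∈ Icc (0 : ℝ) T, HasDerivWithinAt w (-(lowE β η n (-t) (B t))) (Icc 0 T) t :=
      hasDerivWithinAt_of_integral_eq hcE fun t _ => by
        simp only [hw, intervalIntegral.integral_same, add_zero]
    have hrep : ∀ t ∈ Icc (0 : ℝ) T, lowP n (J 1 (g t)) = lowE β η n t (w t) := by
      intro t ht
      have hii : IntervalIntegrable (fun τ => -(lowE β η n (-τ) (B τ))) volume 0 t := by
        refine ContinuousOn.intervalIntegrable (hcE.mono ?_)
        rw [uIcc_of_le ht.1]
        exact Icc_subset_Icc_right ht.2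
      rw [H t ht, map_sub, lowP_expSym h0 h1 β ht.1, lowP_integral_expSym h0 h1 β hB ht, map_add,
        ← ContinuousLinearMap.intervalIntegral_comp_comm _ hii, sub_eq_add_neg,
        ← intervalIntegral.integral_neg]
      congr 1
      refine intervalIntegral.integral_congr fun τ _ => ?_
      simp only [map_neg, lowE_lowE, ← sub_eq_add_neg]
    have hder : ∀ t ∈ Icc (0 : ℝ) T, HasDerivWithinAt (fun t => lowP n (J 2 (g t)))
        (lowP n (F t)) (Icc 0 T) t := by
      intro t ht
      have h2 := hasDerivWithinAt_clm (hasDerivWithinAt_lowE_apply β η n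
        (hasDerivWithinAt_id t (Icc 0 T)) (hw' t ht)) (J 1)
      have e0 : ∀ τ ∈ Icc (0 : ℝ) T, lowP n (J 2 (g τ)) = J 1 (lowE β η n (id τ) (w τ)) :=
        fun τ hτ => by rw [id, ← hrep τ hτ, J_lowP n zero_le_one, J_one_J_one]
      have h3 := HasDerivWithinAt.congr h2 e0 (e0 t ht)
      refine h3.congr_deriv ?_
      have e1 := lowSym_asym_expSym β η n t (w t)
      have e2 : mulOp (lowSym n (asym β η)) (lowP n (J 1 (g t)))
          = mulOp (lowSym n (asym β η)) (J 1 (g t)) :=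
        lowSym_lowSym (continuous_asym β η) continuous_const (fun _ => mul_one _) _
      have e3 : J 1 (mulOp (lowSym n (asym β η)) (J 1 (g t))) = lowP n (linOp β η (g t)) := by
        rw [← lowSym_asym_J, ← J_one_J_one]
        exact mulOp_comm (bddMeas_wt (by norm_num)) (bddMeas_low_asym β η n) _
      simp only [id]
      rw [e1, ← hrep t ht, e2, map_neg, lowE_lowE, add_neg_cancel, lowE_zero]
      push_cast
      rw [one_smul, map_add, e3, map_neg, J_lowP n zero_le_one, hF]
      simp only [mulOp_one, sub_eq_add_neg, map_add, map_neg]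
    have hI := integral_eq_of_hasDerivWithinAt ((lowP n).continuous.comp_continuousOn hFc) hder t ht
    have hii : IntervalIntegrable F volume 0 t := by
      refine ContinuousOn.intervalIntegrable (hFc.mono ?_)
      rw [uIcc_of_le ht.1]
      exact Icc_subset_Icc_right ht.2
    rw [hI, map_add, ← ContinuousLinearMap.intervalIntegral_comp_comm _ hii]
    rfl

/-! ### Strong and mild solutions in terms of weighted Fourier transforms -/

lemma bddMeas_hilbert : BddMeas (fun ξ : ℝ => Complex.I * ((Real.sign ξ : ℝ) : ℂ)) := by
  refine ⟨?_, 1, fun ξ => ?_⟩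
  · have : Measurable Real.sign := by
      unfold Real.sign
      exact Measurable.ite measurableSet_Iio measurable_const
        (Measurable.ite measurableSet_Ioi measurable_const measurable_const)
    fun_prop
  · rw [norm_mul, Complex.norm_I, one_mul, Complex.norm_real]
    rcases lt_trichotomy ξ 0 with h | h | h
    · simp [Real.sign_of_neg h]
    · simp [h]
    · simp [Real.sign_of_pos h]

/-- The symbols of the Hilbert transform and the derivatives combine to `-asym β η`. -/
lemma hilbert_symbol (β η ξ : ℝ) (a : ℂ) :
    (β : ℂ) * (Complex.I * ((Real.sign ξ : ℝ) : ℂ) * dsym (dsym fun _ => a) ξ)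
      + (η : ℂ) * (Complex.I * ((Real.sign ξ : ℝ) : ℂ) * dsym (fun _ => a) ξ
        - dsym (dsym fun _ => a) ξ) = -(asym β η ξ * a) := by
  have h1 : |2 * Real.pi * ξ| = Real.sign ξ * (2 * Real.pi * ξ) := by
    rw [abs_mul, abs_of_pos Real.two_pi_pos]
    rcases lt_trichotomy ξ 0 with h | h | h
    · rw [Real.sign_of_neg h, abs_of_neg h]; ring
    · simp [h]
    · rw [Real.sign_of_pos h, abs_of_pos h]; ring
  simp only [dsym, asym, h1]
  push_cast
  linear_combination (4 * β * Complex.I * Real.sign ξ * Real.pi ^ 2 * ξ ^ 2 * a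
    + 2 * Real.sign ξ * Real.pi * ξ * a * η - 4 * Real.pi ^ 2 * ξ ^ 2 * a * η) * Complex.I_sq

/-- The equation at a fixed time, in terms of weighted Fourier transforms. -/
lemma equation_iff {s : ℝ} (hs : 3 / 2 < s) (β η : ℝ) (u : Hs s) (v : Hs (s - 2)) :
    v.dist + mulDist u.dist u.deriv.dist + (β : ℂ) • u.deriv.deriv.hilbert.dist
      + (η : ℂ) • (u.deriv.hilbert.dist - u.deriv.deriv.dist) = 0 ↔
    wF (s - 2) v = linOp β η (wF s u) - J 1 (bil s hs (wF s u) (wF s u)) := by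
  set g := wF s u with hg
  set B := bil s hs g g with hB
  have hm : HasHat (mulDist u.dist u.deriv.dist) (fh (s - 1) B) := by
    have h := (dist_eq_mulDist_iff hs u ((wF (s - 1)).symm B)).mpr (by simp [hB, hg])
    have h2 := hasHat_dist ((wF (s - 1)).symm B)
    rwa [h, LinearIsometryEquiv.apply_symm_apply] at h2
  have hd1 : HasHat u.deriv.dist (dsym (fh s g)) := hasHat_deriv u
  have hd2 : HasHat u.deriv.deriv.dist (dsym (dsym (fh s g))) := hd1.lineDeriv
  have hh1 : HasHat u.deriv.hilbert.dist
      (fun ξ => Complex.I * ((Real.sign ξ : ℝ) : ℂ) * dsym (fh s g) ξ) :=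
    hasHat_multiplier bddMeas_hilbert u.deriv hd1
  have hh2 : HasHat u.deriv.deriv.hilbert.dist
      (fun ξ => Complex.I * ((Real.sign ξ : ℝ) : ℂ) * dsym (dsym (fh s g)) ξ) :=
    hasHat_multiplier bddMeas_hilbert u.deriv.deriv hd2
  have hall := (((hasHat_dist v).add hm).add (hh2.smul β)).add ((hh1.sub hd2).smul η)
  have hz : HasHat (0 : 𝓢'(ℝ, ℂ)) (fun _ => 0) := by
    refine ⟨locallyIntegrable_zero, fun ψ => by simp, fun ψ => ?_⟩
    rw [TemperedDistribution.fourier_apply]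
    simp only [zero_mul, integral_zero]
    rfl
  have e1 : fh (s - 2) (linOp β η g - J 1 B) =ᵐ[volume]
      fun ξ => asym β η ξ * fh s g ξ - fh (s - 1) B ξ := by
    filter_upwards [Lp.coeFn_sub (linOp β η g) (J 1 B), linOp_coe β η g,
      J_coe zero_le_one B] with ξ h1 h2 h3
    have w1 : wt (-s) ξ = wt (-(s - 2)) ξ * wt (-2) ξ := by rw [← wt_add]; congr 1; ring
    have w2 : wt (-(s - 1)) ξ = wt (-(s - 2)) ξ * wt (-1) ξ := by rw [← wt_add]; congr 1; ring
    rw [fh, h1, Pi.sub_apply, h2, h3, fh, fh, fh, w1, w2]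
    push_cast
    ring
  constructor
  · intro H
    refine eq_of_fh_eq (r := s - 2) ?_
    rw [H] at hall
    have h0 := hall.ae_eq hz
    filter_upwards [h0, e1] with ξ h0 e1
    have h2 := hilbert_symbol β η ξ (fh s g ξ)
    rw [e1]
    simp only [dsym] at h0 h2
    linear_combination h0 - h2
  · intro H
    refine HasHat.dist_eq hall hz ?_
    rw [H]
    filter_upwards [e1] with ξ e1
    have h2 := hilbert_symbol β η ξ (fh s g ξ)
    rw [e1]
    simp only [dsym] at h2 ⊢
    linear_combination h2

/-- A curve in `H^s` as a curve of weighted Fourier transforms, extended constantly outside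
`[0, T]`. -/
def curve {s T : ℝ} (hT : 0 < T) (u : C(Icc (0 : ℝ) T, Hs s)) (τ : ℝ) : L2 :=
  wF s (IccExtend hT.le u τ)

section

variable {s T : ℝ} {hT : 0 < T}

lemma curve_of_mem (u : C(Icc (0 : ℝ) T, Hs s)) {t : ℝ} (ht : t ∈ Icc (0 : ℝ) T) :
    curve hT u t = wF s (u ⟨t, ht⟩) := by
  rw [curve, IccExtend_of_mem _ _ ht]

lemma curve_coe (u : C(Icc (0 : ℝ) T, Hs s)) (t : Icc (0 : ℝ) T) :
    curve hT u t = wF s (u t) := curve_of_mem u t.2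

lemma continuous_curve (u : C(Icc (0 : ℝ) T, Hs s)) : Continuous (curve hT u) :=
  (wF s).continuous.comp (u.continuous.Icc_extend' )

lemma hasDerivWithinAt_wF_iff {r : ℝ} {f : ℝ → Hs r} {f' : Hs r} {S : Set ℝ} {t : ℝ} :
    HasDerivWithinAt f f' S t ↔ HasDerivWithinAt (fun τ => wF r (f τ)) (wF r f') S t := by
  have key : ∀ {E F : Type} [NormedAddCommGroup E] [NormedSpace ℂ E] [NormedAddCommGroup F]
      [NormedSpace ℂ F] (L : E →L[ℂ] F) {f : ℝ → E} {f' : E}, HasDerivWithinAt f f' S t →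
      HasDerivWithinAt (fun τ => L (f τ)) (L f') S t := fun L _ _ h =>
    (L.restrictScalars ℝ).hasFDerivAt.comp_hasDerivWithinAt t h
  constructor
  · intro h
    exact key ((wF r).toContinuousLinearEquiv : Hs r →L[ℂ] L2) h
  · intro h
    have := key ((wF r).symm.toContinuousLinearEquiv : L2 →L[ℂ] Hs r) h
    simpa using this

/-- Strong solutions in terms of weighted Fourier transforms. -/
theorem isStrongSolution_iff (hs : 3 / 2 < s) {β η : ℝ} {φ : Hs s} {u : C(Icc (0 : ℝ) T, Hs s)}
    {u' : C(Icc (0 : ℝ) T, Hs (s - 2))} :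
    IsStrongSolution β η hT φ u u' ↔
      (Evol s hs T β η (fun _ => 1) (curve hT u) ∧ curve hT u 0 = wF s φ) ∧
      ∀ t, wF (s - 2) (u' t)
        = linOp β η (curve hT u t) - J 1 (bil s hs (curve hT u t) (curve hT u t)) := by
  have h0 : (0 : ℝ) ∈ Icc (0 : ℝ) T := left_mem_Icc.mpr hT.le
  have hinit : u ⟨0, h0⟩ = φ ↔ curve hT u 0 = wF s φ := by
    rw [curve_of_mem u h0, (wF s).injective.eq_iff]
  have hincl : ∀ τ : ℝ, wF (s - 2) ((IccExtend hT.le u τ).incl (sub_le_self s zero_le_two))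
      = J 2 (curve hT u τ) := fun τ => by
    rw [wF_incl, curve, show s - (s - 2) = 2 by ring]
  have hder : ∀ t : Icc (0 : ℝ) T, HasDerivWithinAt
      (fun τ : ℝ => (IccExtend hT.le u τ).incl (sub_le_self s zero_le_two)) (u' t) (Icc 0 T) t ↔
      HasDerivWithinAt (fun τ => J 2 (curve hT u τ)) (wF (s - 2) (u' t)) (Icc 0 T) t := fun t => by
    rw [hasDerivWithinAt_wF_iff]
    simp only [hincl]
  have heq := fun t : Icc (0 : ℝ) T => equation_iff hs β η (u t) (u' t)
  constructor
  · rintro ⟨hi, H⟩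
    have e : ∀ t : Icc (0 : ℝ) T, wF (s - 2) (u' t)
        = linOp β η (curve hT u t) - J 1 (bil s hs (curve hT u t) (curve hT u t)) := fun t => by
      rw [curve_coe]
      exact (heq t).mp (H t).2
    refine ⟨⟨⟨(continuous_curve u).continuousOn, fun t ht => ?_⟩, hinit.mp hi⟩, e⟩
    rw [mulOp_one, ← e ⟨t, ht⟩]
    exact (hder ⟨t, ht⟩).mp (H ⟨t, ht⟩).1
  · rintro ⟨⟨hev, hi⟩, H⟩
    refine ⟨hinit.mpr hi, fun t => ⟨(hder t).mpr ?_, (heq t).mpr ?_⟩⟩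
    · rw [H t, ← mulOp_one (bil s hs (curve hT u t) (curve hT u t))]
      exact hev.deriv t t.2
    · rw [H t, curve_coe]

lemma wF_semigroup {β η : ℝ} (h0 : 0 ≤ η) (h1 : η ≤ 1) {t : ℝ} (ht : 0 ≤ t) {r : ℝ} (f : Hs r) :
    wF r (f.semigroup β η t) = mulOp (expSym β η t) (wF r f) := by
  have e : (fun ξ : ℝ => Complex.exp
      (Complex.I * ((β * (2 * Real.pi * ξ) * |2 * Real.pi * ξ| * t : ℝ) : ℂ)
        - ((η * ((2 * Real.pi * ξ) ^ 2 - |2 * Real.pi * ξ|) * t : ℝ) : ℂ))) = expSym β η t := by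
    ext ξ
    rw [expSym, asym]
    congr 1
    push_cast
    ring
  rw [Hs.semigroup, e, wF_multiplier (bddMeas_expSym h0 h1 β ht)]

lemma wF_intervalIntegral {r : ℝ} (f : ℝ → Hs r) (t : ℝ) :
    wF r (∫ τ in (0 : ℝ)..t, f τ) = ∫ τ in (0 : ℝ)..t, wF r (f τ) := by
  simp only [intervalIntegral.intervalIntegral_eq_integral_uIoc]
  have h1 : wF r (∫ τ in uIoc 0 t, f τ) = ∫ τ in uIoc 0 t, wF r (f τ) :=
    ((wF r).toContinuousLinearEquiv.integral_comp_comm _).symm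
  have h2 : ∀ (c : ℝ) (x : Hs r), wF r (c • x) = c • wF r x :=
    (((wF r).toContinuousLinearEquiv : Hs r →L[ℂ] L2).restrictScalars ℝ).map_smul
  rw [h2, h1]

/-- Mild solutions are the strong solutions, in terms of weighted Fourier transforms. -/
theorem isMildSolution_iff (hs : 3 / 2 < s) {β η : ℝ} (h0 : 0 ≤ η) (h1 : η ≤ 1) {φ : Hs s}
    {u : C(Icc (0 : ℝ) T, Hs s)} :
    IsMildSolution β η hT φ u ↔
      Evol s hs T β η (fun _ => 1) (curve hT u) ∧ curve hT u 0 = wF s φ := by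
  rw [evol_iff_mild hs hT.le h0 h1 (continuous_curve u).continuousOn]
  have hincl : ∀ f : Hs s, wF (s - 1) (f.incl (sub_le_self s zero_le_one)) = J 1 (wF s f) :=
    fun f => by rw [wF_incl, show s - (s - 1) = 1 by ring]
  have hN : ∀ (N : C(Icc (0 : ℝ) T, Hs (s - 1))) (t : ℝ), t ∈ Icc (0 : ℝ) T →
      (∀ τ, wF (s - 1) (IccExtend hT.le N τ) = bil s hs (curve hT u τ) (curve hT u τ)) →
      wF (s - 1) (∫ τ in (0 : ℝ)..t, (IccExtend hT.le N τ).semigroup β η (t - τ))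
        = ∫ τ in (0 : ℝ)..t, mulOp (expSym β η (t - τ)) (bil s hs (curve hT u τ) (curve hT u τ)) := by
    intro N t ht h
    rw [wF_intervalIntegral]
    refine intervalIntegral.integral_congr fun τ hτ => ?_
    rw [uIcc_of_le ht.1] at hτ
    rw [wF_semigroup h0 h1 (by linarith [hτ.2]), h]
  constructor
  · rintro ⟨N, hN1, hN2⟩ t ht
    have hB : ∀ τ, wF (s - 1) (IccExtend hT.le N τ) = bil s hs (curve hT u τ) (curve hT u τ) :=
      fun τ => (dist_eq_mulDist_iff hs _ _).mp (hN1 _)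
    have := congrArg (wF (s - 1)) (hN2 ⟨t, ht⟩)
    rw [hincl, map_sub, wF_semigroup h0 h1 ht.1, hincl, hN N t ht hB, ← curve_of_mem u ht] at this
    exact this
  · intro H
    have hc : Continuous fun t : Icc (0 : ℝ) T =>
        (wF (s - 1)).symm (bil s hs (wF s (u t)) (wF s (u t))) := by
      have h1 : Continuous fun t => wF s (u t) := (wF s).continuous.comp u.continuous
      exact (wF (s - 1)).symm.continuous.comp (by fun_prop)
    refine ⟨⟨_, hc⟩, fun t => ?_, fun t => (wF (s - 1)).injective ?_⟩
    · exact (dist_eq_mulDist_iff hs _ _).mpr (LinearIsometryEquiv.apply_symm_apply _ _)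
    · rw [hincl, map_sub, wF_semigroup h0 h1 t.2.1, hincl, hN _ t t.2, ← curve_coe (hT := hT) u t]
      · exact H t t.2
      · exact fun τ => LinearIsometryEquiv.apply_symm_apply _ _

end

/-! ### The solutions for all `η ∈ [0, 1]` and their limit -/

/-- `u`, with time derivative `u'`, is a real-valued solution with data `φ`, with the bounds of the
energy method. -/
structure Solves (s : ℝ) (hs : 3 / 2 < s) {T : ℝ} (hT : 0 < T) (M β η : ℝ) (φ : Hs s)
    (u : C(Icc (0 : ℝ) T, Hs s)) (u' : C(Icc (0 : ℝ) T, Hs (s - 2))) : Prop where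
  sol : Sol s hs T M β η (fun _ => 1) (wF s φ) (curve hT u)
  deriv : ∀ t, wF (s - 2) (u' t)
    = linOp β η (curve hT u t) - J 1 (bil s hs (curve hT u t) (curve hT u t))

section

variable {s : ℝ} {hs : 3 / 2 < s} {T : ℝ} {hT : 0 < T} {M β η : ℝ} {φ : Hs s}
  {u : C(Icc (0 : ℝ) T, Hs s)} {u' : C(Icc (0 : ℝ) T, Hs (s - 2))}

lemma Sol.congr {χ : ℝ → ℂ} {x : L2} {g g' : ℝ → L2} (hT : 0 ≤ T) (h : Sol s hs T M β η χ x g)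
    (e : ∀ t ∈ Icc (0 : ℝ) T, g' t = g t) : Sol s hs T M β η χ x g' where
  evol := by
    refine ⟨h.evol.cont.congr e, fun t ht => ?_⟩
    rw [e t ht]
    exact (h.evol.deriv t ht).congr (fun τ hτ => by rw [e τ hτ]) (by rw [e t ht])
  init := by rw [e 0 (left_mem_Icc.mpr hT), h.init]
  herm t ht := by rw [e t ht]; exact h.herm t ht
  bound t ht := by rw [e t ht]; exact h.bound t ht
  tail N hN t ht := by rw [e t ht]; exact h.tail N hN t ht

/-- The existence part of the theorem, for all `η ∈ [0, 1]` at once. -/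
lemma exists_solves (hs : 3 / 2 < s) (hT : 0 < T) {R : ℝ} (hR : 0 < R)
    (hTR : Real.exp ((1 / 2 + 4 * (nlK s).toReal * (2 * R)) * T) ≤ 4) (h0 : 0 ≤ η) (h1 : η ≤ 1)
    (hφ : φ.IsReal) (hφR : ‖φ‖ ≤ R) : ∃ u u', Solves s hs hT (2 * R) β η φ u u' := by
  obtain ⟨g, hg⟩ := exists_sol hs (β := β) h0 h1 hR hT.le hTR ((isReal_iff_herm φ).mp hφ)
    (by rwa [LinearIsometryEquiv.norm_map])
  have hgc : Continuous fun t : Icc (0 : ℝ) T => g t := hg.evol.cont.domRestrict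
  refine ⟨⟨fun t => (wF s).symm (g t), (wF s).symm.continuous.comp hgc⟩,
    ⟨fun t => (wF (s - 2)).symm (linOp β η (g t) - J 1 (bil s hs (g t) (g t))), ?_⟩, ?_, ?_⟩
  · have hbc : Continuous fun x : L2 => bil s hs x x := by fun_prop
    have hF : Continuous fun x : L2 => linOp β η x - J 1 (bil s hs x x) :=
      (linOp β η).continuous.sub ((J 1).continuous.comp hbc)
    exact (wF (s - 2)).symm.continuous.comp (hF.comp hgc)
  · refine hg.congr hT.le fun t ht => ?_
    rw [curve_of_mem _ ht]
    exact LinearIsometryEquiv.apply_symm_apply _ _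
  · intro t
    rw [curve_coe]
    simp only [ContinuousMap.coe_mk, LinearIsometryEquiv.apply_symm_apply]

lemma norm_linOp_le (h0 : 0 ≤ η) (h1 : η ≤ 1) (x : L2) :
    ‖linOp β η x‖ ≤ (‖linOp β 0‖ + 8 * Real.pi ^ 2) * ‖x‖ := by
  have e1 := norm_linOp_sub_le β η 0 x
  have e2 := (linOp β 0).le_opNorm x
  have e3 := norm_add_le (linOp β η x - linOp β 0 x) (linOp β 0 x)
  rw [sub_add_cancel] at e3
  rw [sub_zero, abs_of_nonneg h0] at e1
  have e4 : 8 * Real.pi ^ 2 * η * ‖x‖ ≤ 8 * Real.pi ^ 2 * 1 * ‖x‖ := by gcongr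
  linarith

namespace Solves

lemma evol_and_init (h : Solves s hs hT M β η φ u u') :
    Evol s hs T β η (fun _ => 1) (curve hT u) ∧ curve hT u 0 = wF s φ :=
  ⟨h.sol.evol, by rw [h.sol.init, mulOp_one]⟩

lemma isReal (h : Solves s hs hT M β η φ u u') (t : Icc (0 : ℝ) T) : (u t).IsReal := by
  rw [isReal_iff_herm, ← curve_coe (hT := hT)]
  exact h.sol.herm t t.2

lemma isMildSolution (h : Solves s hs hT M β η φ u u') (h0 : 0 ≤ η) (h1 : η ≤ 1) :
    IsMildSolution β η hT φ u :=
  (isMildSolution_iff hs h0 h1).mpr h.evol_and_init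

lemma isStrongSolution (h : Solves s hs hT M β η φ u u') : IsStrongSolution β η hT φ u u' :=
  (isStrongSolution_iff hs).mpr ⟨h.evol_and_init, h.deriv⟩

/-- Uniqueness among all solutions, whether or not they are real-valued or obey the bounds. -/
lemma eq_of_evol (h : Solves s hs hT M β η φ u u') (h0 : 0 ≤ η) (h1 : η ≤ 1)
    {v : C(Icc (0 : ℝ) T, Hs s)}
    (hv : Evol s hs T β η (fun _ => 1) (curve hT v) ∧ curve hT v 0 = wF s φ) : v = u := by
  ext1 t
  have := h.sol.evol.eq_of_herm hv.1 h0 h1 h.sol.herm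
    (h.evol_and_init.2.trans hv.2.symm) t t.2
  rw [curve_coe, curve_coe] at this
  exact ((wF s).injective this).symm

lemma eq_of_isMildSolution (h : Solves s hs hT M β η φ u u') (h0 : 0 ≤ η) (h1 : η ≤ 1)
    {v : C(Icc (0 : ℝ) T, Hs s)} (hv : IsMildSolution β η hT φ v) : v = u :=
  h.eq_of_evol h0 h1 ((isMildSolution_iff hs h0 h1).mp hv)

lemma eq_of_isStrongSolution (h : Solves s hs hT M β η φ u u') (h0 : 0 ≤ η) (h1 : η ≤ 1)
    {v : C(Icc (0 : ℝ) T, Hs s)} {v' : C(Icc (0 : ℝ) T, Hs (s - 2))}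
    (hv : IsStrongSolution β η hT φ v v') : v = u :=
  h.eq_of_evol h0 h1 ((isStrongSolution_iff hs).mp hv).1

/-- Solutions depend continuously on `η` and `φ` in `C([0,T]; H^s) ∩ C¹([0,T]; H^{s-2})`. -/
theorem stable (hs : 3 / 2 < s) (hT : 0 < T) (hM : 0 ≤ M)
    (hTM : Real.exp ((1 / 2 + 4 * (nlK s).toReal * M) * T) ≤ 4) (β : ℝ) (φ₀ : Hs s) {ε : ℝ}
    (hε : 0 < ε) :
    ∃ d > 0, ∀ (η₁ η₂ : ℝ) (φ₁ φ₂ : Hs s) (u₁ u₂ : C(Icc (0 : ℝ) T, Hs s))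
      (u₁' u₂' : C(Icc (0 : ℝ) T, Hs (s - 2))), 0 ≤ η₁ → η₁ ≤ 1 → |η₁ - η₂| ≤ d →
      ‖φ₁ - φ₀‖ ≤ d → ‖φ₂ - φ₀‖ ≤ d → Solves s hs hT M β η₁ φ₁ u₁ u₁' →
      Solves s hs hT M β η₂ φ₂ u₂ u₂' → dist u₁ u₂ < ε ∧ dist u₁' u₂' < ε := by
  have hb : 0 ≤ (bilK s).toReal := ENNReal.toReal_nonneg
  set L := ‖linOp β 0‖ + 8 * Real.pi ^ 2 + 2 * (bilK s).toReal * M with hL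
  have hL0 : 0 ≤ L := by positivity
  -- `L` is a Lipschitz constant, on the ball of radius `M`, of the time derivative as a function of
  -- the solution
  set ε' := min ε (ε / (2 * (L + 1))) with hε'
  have hε'0 : 0 < ε' := lt_min hε (by positivity)
  obtain ⟨d, hd, H⟩ := Sol.stable hs hT.le hM hTM (wF s φ₀) hε'0
  -- the time derivative depends on `η` explicitly, too
  set d' := min d (ε / (2 * (8 * Real.pi ^ 2 * M + 1))) with hd'
  have hd'0 : 0 < d' := lt_min hd (by positivity)
  refine ⟨d', hd'0, ?_⟩
  intro η₁ η₂ φ₁ φ₂ u₁ u₂ u₁' u₂' h0 h1 hη hφ₁ hφ₂ S₁ S₂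
  have hclose : ∀ t : Icc (0 : ℝ) T, ‖curve hT u₁ t - curve hT u₂ t‖ < ε' := fun t =>
    H β η₁ η₂ _ _ _ _ _ _ h0 h1 (hη.trans (min_le_left _ _)) (nearId_one hd.le)
      (nearId_one hd.le)
      (by rw [← map_sub, LinearIsometryEquiv.norm_map]; exact hφ₁.trans (min_le_left _ _))
      (by rw [← map_sub, LinearIsometryEquiv.norm_map]; exact hφ₂.trans (min_le_left _ _))
      S₁.sol S₂.sol t t.2
  constructor
  · rw [ContinuousMap.dist_lt_iff hε]
    intro t
    rw [dist_eq_norm, ← LinearIsometryEquiv.norm_map (wF s), map_sub, ← curve_coe (hT := hT),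
      ← curve_coe (hT := hT)]
    exact (hclose t).trans_le (min_le_left _ _)
  · rw [ContinuousMap.dist_lt_iff hε]
    intro t
    rw [dist_eq_norm, ← LinearIsometryEquiv.norm_map (wF (s - 2)), map_sub, S₁.deriv, S₂.deriv]
    set x := curve hT u₁ t
    set y := curve hT u₂ t
    have bx : ‖x‖ ≤ M := S₁.sol.bound t t.2
    have by' : ‖y‖ ≤ M := S₂.sol.bound t t.2
    have e : linOp β η₁ x - J 1 (bil s hs x x) - (linOp β η₂ y - J 1 (bil s hs y y))
        = linOp β η₁ (x - y) + (linOp β η₁ y - linOp β η₂ y)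
          - J 1 (bil s hs x (x - y) + bil s hs (x - y) y) := by
      simp only [map_sub, map_add, sub_apply]
      abel
    have i1 : ‖linOp β η₁ (x - y)‖ ≤ _ := norm_linOp_le h0 h1 (x - y)
    have i2 : ‖linOp β η₁ y - linOp β η₂ y‖ ≤ 8 * Real.pi ^ 2 * |η₁ - η₂| * M :=
      (norm_linOp_sub_le β η₁ η₂ y).trans (by gcongr)
    have i3 : ‖J 1 (bil s hs x (x - y) + bil s hs (x - y) y)‖
        ≤ 2 * (bilK s).toReal * M * ‖x - y‖ := by
      refine (norm_J_le zero_le_one _).trans ((norm_add_le _ _).trans ?_)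
      have j1 : ‖bil s hs x (x - y)‖ ≤ (bilK s).toReal * M * ‖x - y‖ :=
        (norm_bil_le hs _ _).trans (by gcongr)
      have j2 : ‖bil s hs (x - y) y‖ ≤ (bilK s).toReal * ‖x - y‖ * M :=
        (norm_bil_le hs _ _).trans (by gcongr)
      linarith
    have i4 := norm_sub_le (linOp β η₁ (x - y) + (linOp β η₁ y - linOp β η₂ y))
      (J 1 (bil s hs x (x - y) + bil s hs (x - y) y))
    have i5 := norm_add_le (linOp β η₁ (x - y)) (linOp β η₁ y - linOp β η₂ y)
    rw [e]
    have i6 : L * ‖x - y‖ < ε / 2 := by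
      have k1 : ‖x - y‖ < ε / (2 * (L + 1)) := (hclose t).trans_le (min_le_right _ _)
      have k2 : ε / (2 * (L + 1)) * (L + 1) = ε / 2 := by field_simp
      nlinarith [norm_nonneg (x - y)]
    have i7 : 8 * Real.pi ^ 2 * |η₁ - η₂| * M ≤ ε / 2 := by
      have k1 : |η₁ - η₂| ≤ ε / (2 * (8 * Real.pi ^ 2 * M + 1)) := hη.trans (min_le_right _ _)
      have k2 : ε / (2 * (8 * Real.pi ^ 2 * M + 1)) * (8 * Real.pi ^ 2 * M + 1) = ε / 2 := by
        field_simp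
      have k3 : 0 ≤ 8 * Real.pi ^ 2 * M := by positivity
      nlinarith [abs_nonneg (η₁ - η₂)]
    have i8 : L * ‖x - y‖ = (‖linOp β 0‖ + 8 * Real.pi ^ 2) * ‖x - y‖
        + 2 * (bilK s).toReal * M * ‖x - y‖ := by rw [hL]; ring
    linarith

end Solves

end

end ChenLee

end

theorem mainTheorem5 (s : ℝ) (hs : 3 / 2 < s) (R : ℝ) :
    ∃ (T : ℝ) (hT : 0 < T), ∀ β : ℝ, 0 < β →
      ∃ (u : ℝ → ChenLee.Hs s → C(Set.Icc (0 : ℝ) T, ChenLee.Hs s))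
        (u' : ℝ → ChenLee.Hs s → C(Set.Icc (0 : ℝ) T, ChenLee.Hs (s - 2))),
        (∀ φ : ChenLee.Hs s, φ.IsReal → ‖φ‖ ≤ R →
          -- for `0 < η < 1`, `u η φ` is the solution of the Chen–Lee equation
          (∀ η ∈ Set.Ioo (0 : ℝ) 1,
            (∀ t, (u η φ t).IsReal) ∧
            ChenLee.IsMildSolution β η hT φ (u η φ) ∧
            (∀ v, ChenLee.IsMildSolution β η hT φ v → v = u η φ) ∧
            ChenLee.IsStrongSolution β η hT φ (u η φ) (u' η φ)) ∧
          -- convergence in `C([0,T]; H^s) ∩ C¹([0,T]; H^{s-2})` as `η → 0⁺`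
          Filter.Tendsto (fun η => u η φ) (nhdsWithin 0 (Set.Ioi 0)) (nhds (u 0 φ)) ∧
          Filter.Tendsto (fun η => u' η φ) (nhdsWithin 0 (Set.Ioi 0)) (nhds (u' 0 φ)) ∧
          -- the limit is the unique solution of the Benjamin–Ono equation
          (∀ t, (u 0 φ t).IsReal) ∧
          ChenLee.IsStrongSolution β 0 hT φ (u 0 φ) (u' 0 φ) ∧
          (∀ v v', ChenLee.IsStrongSolution β 0 hT φ v v' → v = u 0 φ)) ∧
        -- continuous dependence of the limit on the initial data
        ContinuousOn (fun φ => u 0 φ) {φ | φ.IsReal ∧ ‖φ‖ ≤ R} ∧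
        ContinuousOn (fun φ => u' 0 φ) {φ | φ.IsReal ∧ ‖φ‖ ≤ R} := by
  have hn : 0 ≤ (ChenLee.nlK s).toReal := ENNReal.toReal_nonneg
  set R' := |R| + 1 with hR'
  have hR'0 : 0 < R' := by positivity
  set K := 1 / 2 + 4 * (ChenLee.nlK s).toReal * (2 * R') with hK
  have hK0 : 0 < K := by positivity
  have hlog : 0 < Real.log 4 := Real.log_pos (by norm_num)
  -- up to this time, which does not depend on `β`, the energy estimates lose at most a factor `2`
  have hT : 0 < Real.log 4 / K := by positivity
  have hTK : Real.exp (K * (Real.log 4 / K)) ≤ 4 := by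
    rw [mul_div_cancel₀ _ hK0.ne', Real.exp_log (by norm_num)]
  refine ⟨Real.log 4 / K, hT, fun β _ => ?_⟩
  -- the solution operators are defined for all `η` and `φ`, with no meaning outside
  -- `0 ≤ η ≤ 1` and the ball of real-valued data
  have hex : ∀ (η : ℝ) (φ : ChenLee.Hs s), ∃ u u', 0 ≤ η → η ≤ 1 → φ.IsReal → ‖φ‖ ≤ R →
      ChenLee.Solves s hs hT (2 * R') β η φ u u' := by
    intro η φ
    by_cases h : 0 ≤ η ∧ η ≤ 1 ∧ φ.IsReal ∧ ‖φ‖ ≤ R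
    · obtain ⟨h0, h1, hφ, hφR⟩ := h
      obtain ⟨u, u', hu⟩ := ChenLee.exists_solves (β := β) hs hT hR'0 hTK h0 h1 hφ
        (hφR.trans ((le_abs_self R).trans (by linarith)))
      exact ⟨u, u', fun _ _ _ _ => hu⟩
    · exact ⟨0, 0, fun h0 h1 hφ hφR => absurd ⟨h0, h1, hφ, hφR⟩ h⟩
  choose u u' hu using hex
  have hstable := ChenLee.Solves.stable hs hT (by positivity : 0 ≤ 2 * R') hTK β
  have h00 : (0 : ℝ) ≤ 0 := le_rfl
  have h01 : (0 : ℝ) ≤ 1 := zero_le_one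
  refine ⟨u, u', fun φ hφ hφR => ?_, ?_⟩
  · have hS := hu 0 φ h00 h01 hφ hφR
    have hlim : ∀ ε > 0, ∀ᶠ η in 𝓝[>] (0 : ℝ),
        dist (u η φ) (u 0 φ) < ε ∧ dist (u' η φ) (u' 0 φ) < ε := by
      intro ε hε
      obtain ⟨d, hd, H⟩ := hstable φ hε
      filter_upwards [Ioo_mem_nhdsGT (lt_min hd one_pos)] with η hη
      have h1 : η ≤ 1 := hη.2.le.trans (min_le_right _ _)
      exact H η 0 φ φ _ _ _ _ hη.1.le h1
        (by rw [sub_zero, abs_of_pos hη.1]; exact hη.2.le.trans (min_le_left _ _))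
        (by simpa using hd.le) (by simpa using hd.le) (hu η φ hη.1.le h1 hφ hφR) hS
    refine ⟨fun η hη => ?_, Metric.tendsto_nhds.mpr fun ε hε => (hlim ε hε).mono fun _ h => h.1,
      Metric.tendsto_nhds.mpr fun ε hε => (hlim ε hε).mono fun _ h => h.2, hS.isReal,
      hS.isStrongSolution, fun v v' hv => hS.eq_of_isStrongSolution h00 h01 hv⟩
    have h := hu η φ hη.1.le hη.2.le hφ hφR
    exact ⟨h.isReal, h.isMildSolution hη.1.le hη.2.le,
      fun v hv => h.eq_of_isMildSolution hη.1.le hη.2.le hv, h.isStrongSolution⟩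
  · have hcont : ∀ φ₀ ∈ {φ : ChenLee.Hs s | φ.IsReal ∧ ‖φ‖ ≤ R}, ∀ ε > 0, ∃ δ > 0,
        ∀ φ ∈ {φ : ChenLee.Hs s | φ.IsReal ∧ ‖φ‖ ≤ R}, dist φ φ₀ < δ →
          dist (u 0 φ) (u 0 φ₀) < ε ∧ dist (u' 0 φ) (u' 0 φ₀) < ε := by
      intro φ₀ hφ₀ ε hε
      obtain ⟨d, hd, H⟩ := hstable φ₀ hε
      refine ⟨d, hd, fun φ hφ hdist => ?_⟩
      exact H 0 0 φ φ₀ _ _ _ _ h00 h01 (by simpa using hd.le)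
        (by rw [← dist_eq_norm]; exact hdist.le) (by simpa using hd.le)
        (hu 0 φ h00 h01 hφ.1 hφ.2) (hu 0 φ₀ h00 h01 hφ₀.1 hφ₀.2)
    constructor
    · refine Metric.continuousOn_iff.mpr fun φ₀ hφ₀ ε hε => ?_
      obtain ⟨δ, hδ, H⟩ := hcont φ₀ hφ₀ ε hε
      exact ⟨δ, hδ, fun φ hφ h => (H φ hφ h).1⟩
    · refine Metric.continuousOn_iff.mpr fun φ₀ hφ₀ ε hε => ?_
      obtain ⟨δ, hδ, H⟩ := hcont φ₀ hφ₀ ε hε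
      exact ⟨δ, hδ, fun φ hφ h => (H φ hφ h).2⟩
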